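/- **Setting.** Let $K$ be a field of characteristic $0$. Functions $f(n,t)$, $n\in\mathbb Z$, $t=(t_1,t_2,\dots)$, are formal power series in $t$ over $K$ for each $n$. Put $\Gamma f(n)=f(n+1)$, $\Delta=\Gamma-1$, $\Delta^*=\Gamma^{-1}-1$. Pseudo-difference operators $\sum_{k\le N}u_k(n,t)\Delta^k$ are multiplied by $\Delta^k\circ g=\sum_{i\ge0}\binom ki(\Delta^ig)(n+k-i)\Delta^{k-i}$; $(\cdot)_{\ge1}$ and $(\cdot)_{\le0}$ denote the parts with $k\ge1$ and $k\le0$, $\operatorname{res}_\Delta\sum u_k\Delta^k=u_{-1}$, and $(\sum u_k\Delta^k)^*=\sum(\Delta^*)^k\circ u_k$. Let $Z=z_0+z_1\Delta^{-1}+\cdots$ be a dressing operator of the discrete modified KP hierarchy: $Z$ has an inverse of the same form and, with $L=Z\Delta Z^{-1}$, $\partial Z/\partial t_i=-(L^i)_{\le0}Z$ for all $i\ge1$. With $\xi(t,\lambda)=\sum_{l\ge1}t_l\lambda^l$ and $[\lambda^{-1}]=(\lambda^{-1},\lambda^{-2}/2,\lambda^{-3}/3,\dots)$, let $$w(n,t,\lambda)=Z(n)(1+\lambda)^ne^{\xi(t,\lambda)},\qquad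 w^*(n,t,\lambda)=(Z^{-1}(n-1)\Delta^{-1})^*(1+\lambda)^{-n}e^{-\xi(t,\lambda)}$$ be the wave and adjoint wave functions, where $\Delta^k$ (respectively $(\Delta^*)^k$) acts on the exponential as $\lambda^k$. Everything is expanded in powers of $\lambda^{-1}$ (coefficientwise in $t$), $f(t\pm[\lambda^{-1}])$ is the formal expansion in $\lambda^{-1}$, and $\operatorname{res}_\lambda$ is the coefficient of $\lambda^{-1}$. An eigenfunction $\phi$ satisfies $\phi_{t_i}=(L^i)_{\ge1}(\phi)$ and an adjoint eigenfunction $\psi$ satisfies $\psi_{t_i}=-(\Delta^{-1}(L^i)_{\ge1}^*\Delta)(\psi)$, for all $i\ge1$. A *squared eigenfunction potential* $S(\phi,\Delta\psi)$ is a function $S$ with $$\Delta S=\phi\,(\Delta\psi),\qquad S_{t_i}=\operatorname{res}_\Delta\big(\Delta^{-1}(\Delta\psi)(L^i)_{\ge1}\,\phi\,\Delta^{-1}\big)\quad(i\ge1);$$ it is determined up to an additive constant (independent of $n$ and $t$). A potential $\hat S(\Delta\phi,\psi(n+1))$ is a function of the form $\phi\psi-S(\phi,\Delta\psi)$. The same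 definitions are used when $\phi$ or $\psi$ depends on spectral parameters, the constant then being allowed to depend on them. **Corollary.** Let $\phi$ be an eigenfunction and $\psi$ an adjoint eigenfunction. Up to constants, $$S(\phi,\Delta w^*(\lambda))=\phi(n,t+[\lambda^{-1}])\,w^*(n,t,\lambda),$$ $$\hat S(\Delta w(\mu),\psi(n+1))=w(n,t,\mu)\,\psi(n,t-[\mu^{-1}]),$$ $$S(w(\mu),\Delta\psi)=w(n,t,\mu)\big(\psi(n,t)-\psi(n,t-[\mu^{-1}])\big),$$ $$\hat S(\Delta\phi,w^*(n+1,\lambda))=w^*(n,t,\lambda)\big(\phi(n,t)-\phi(n,t+[\lambda^{-1}])\big),$$ that is, each right-hand side is such a potential. Likewise $S(w(\mu),\Delta w^*(\lambda))=w(n,t+[\lambda^{-1}],\mu)\,w^*(n,t,\lambda)$ (expanded for $|\mu|<|\lambda|$) and $\hat S(\Delta w(\mu),w^*(n+1,\lambda))=w(n,t,\mu)\,w^*(n,t-[\mu^{-1}],\lambda)$ (expanded for $|\lambda|<|\mu|$). Moreover, potentials $S(\phi,\Delta\psi)$ exist. Let $t'$ be a second set of times, and use the closed forms above to put $\rho(\mu)=S(\phi(n,t'),\Delta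 w^*(n,t',\mu))$, $h(\lambda)=\hat S(\Delta w(n,t',\lambda),\psi(n+1,t'))$. For each $n$, up to a term independent of $t$, $$S(\phi,\Delta\psi)(n,t)=\operatorname{res}_\mu\Big(\rho(\mu)\operatorname{res}_\lambda\big(S(w(n,t,\mu),\Delta w^*(n,t,\lambda))\,h(\lambda)\big)\Big),$$ $$\hat S(\Delta\phi,\psi(n+1))(n,t)=\operatorname{res}_\mu\Big(\rho(\mu)\operatorname{res}_\lambda\big(\hat S(\Delta w(n,t,\mu),w^*(n+1,t,\lambda))\,h(\lambda)\big)\Big),$$ where the kernels are the two basic closed forms. Precisely, for every potential $S=S(\phi,\Delta\psi)$ and $\hat S=\phi\psi-S$, the first double residue equals $S(n,t)+\hat S(n,t')$ and the second equals $\hat S(n,t)+S(n,t')$, as formal power series in $t$ and $t'$. -/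

import Mathlib

noncomputable section

namespace DmKP

/-! ### Functions of the discrete variable and of the times

A function `f(n, t)` is, for every `n : ℤ`, a formal power series in `t = (t₁, t₂, …)` with
coefficients in a commutative ring `R`. -/

/-- Functions `f(n, t)`, with `n : ℤ` and `t = (t₁, t₂, …)` formal. -/
abbrev Fn (R : Type*) := ℤ → MvPowerSeries ℕ+ R

/-- The difference operator `(Δ f)(n) = f(n+1) - f(n)`. -/
def Dl {R : Type*} [CommRing R] (f : Fn R) : Fn R := fun n => f (n + 1) - f n

/-- The adjoint difference operator `Δ^* = Γ⁻¹ - I`, that is `(Δ^* f)(n) = f(n-1) - f(n)`. -/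
def DlStar {R : Type*} [CommRing R] (f : Fn R) : Fn R := fun n => f (n - 1) - f n

/-- Extension of scalars along `ι : R → R'`. -/
def Fn.map {R R' : Type*} [CommRing R] [CommRing R'] (ι : R →+* R') (f : Fn R) : Fn R' :=
  fun n => MvPowerSeries.map ι (f n)

/-! ### Pseudo-difference operators -/

/-- A pseudo-difference operator `∑_{k ≤ N} u_k(n, t) Δ^k`; `coeff k` is `u_k`. -/
structure PDO (R : Type*) [CommRing R] where
  coeff : ℤ → Fn R
  bdd : ∃ N : ℤ, ∀ k, N < k → coeff k = 0

namespace PDO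

variable {R : Type*} [CommRing R]

/-- The power `Δ^k`, `k : ℤ`. -/
def Dpow (k : ℤ) : PDO R where
  coeff := fun m => if m = k then 1 else 0
  bdd := ⟨k, fun _ hm => if_neg (ne_of_gt hm)⟩

/-- The operator of multiplication by `g(n, t)`. -/
def ofFn (g : Fn R) : PDO R where
  coeff := fun m => if m = 0 then g else 0
  bdd := ⟨0, fun _ hm => if_neg (ne_of_gt hm)⟩

theorem iterate_Dl_zero (i : ℕ) : Dl^[i] (0 : Fn R) = 0 := by
  induction i with
  | zero => rfl
  | succ i ih =>
    rw [Function.iterate_succ_apply]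
    have h : Dl (0 : Fn R) = 0 := by
      funext n
      simp [Dl]
    rw [h, ih]

/-- The product of pseudo-difference operators, by the Leibniz rule
`u Δ^k ∘ v Δ^l = ∑_{i ≥ 0} binom(k, i) u(n) (Δ^i v)(n + k - i) Δ^{k + l - i}`.
The coefficient of `Δ^m` collects the pairs `(k, i)`, with `l = m - k + i`; only finitely many of
them contribute because the orders of `P` and `Q` are bounded above. -/
def mul (P Q : PDO R) : PDO R where
  coeff := fun m n => ∑ᶠ p : ℤ × ℕ, Ring.choose p.1 p.2 •
    (P.coeff p.1 n * (Dl^[p.2] (Q.coeff (m - p.1 + p.2))) (n + p.1 - p.2))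
  bdd := by
    obtain ⟨N, hN⟩ := P.bdd
    obtain ⟨M, hM⟩ := Q.bdd
    refine ⟨N + M, fun m hm => ?_⟩
    funext n
    have h : ∀ p : ℤ × ℕ, Ring.choose p.1 p.2 •
        (P.coeff p.1 n * (Dl^[p.2] (Q.coeff (m - p.1 + p.2))) (n + p.1 - p.2)) = 0 := by
      intro p
      by_cases hp : N < p.1
      · rw [hN _ hp]
        simp
      · have hq : M < m - p.1 + p.2 := by
          have : (0 : ℤ) ≤ p.2 := Int.natCast_nonneg _
          omega
        rw [hM _ hq, iterate_Dl_zero]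
        simp
    simp only [h, finsum_zero, Pi.zero_apply]

/-- The powers `P^i`, `i ≥ 0`. -/
def pow (P : PDO R) : ℕ → PDO R
  | 0 => Dpow 0
  | i + 1 => mul P (pow P i)

/-- The part `P_{≥ 1}`. -/
def posPart (P : PDO R) : PDO R where
  coeff := fun k => if 1 ≤ k then P.coeff k else 0
  bdd := by
    obtain ⟨N, hN⟩ := P.bdd
    exact ⟨N, fun k hk => by simp [hN k hk]⟩

/-- The part `P_{≤ 0}`. -/
def nonposPart (P : PDO R) : PDO R where
  coeff := fun k => if k ≤ 0 then P.coeff k else 0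
  bdd := ⟨0, fun _ hk => if_neg (not_le.mpr hk)⟩

/-- The operator `P(n-1)`: all coefficients are shifted from `n` to `n - 1`. -/
def shiftBack (P : PDO R) : PDO R where
  coeff := fun k n => P.coeff k (n - 1)
  bdd := by
    obtain ⟨N, hN⟩ := P.bdd
    exact ⟨N, fun k hk => by
      funext n
      simp [hN k hk]⟩

/-- The residue `res_Δ ∑ u_k Δ^k = u_{-1}`. -/
def res (P : PDO R) : Fn R := P.coeff (-1)

/-- Extension of scalars. -/
def map {R' : Type*} [CommRing R'] (ι : R →+* R') (P : PDO R) : PDO R' where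
  coeff := fun k => Fn.map ι (P.coeff k)
  bdd := by
    obtain ⟨N, hN⟩ := P.bdd
    exact ⟨N, fun k hk => by
      funext n
      simp [Fn.map, hN k hk]⟩

/-- The value `∑_{k ≥ 0} u_k (Δ^k f)` at `f` of an operator `∑_{k ≥ 0} u_k Δ^k`. -/
def act (P : PDO R) (f : Fn R) : Fn R :=
  fun n => ∑ᶠ k : ℕ, P.coeff k n * (Dl^[k] f) n

/-- The value at `f` of `Δ⁻¹ ∘ P^* ∘ Δ`, for an operator `P = ∑_{k ≥ 1} u_k Δ^k`. Here
`P^* = ∑_{k ≥ 1} (Δ^*)^k ∘ u_k`, and `Δ⁻¹ ∘ Δ^* = -Γ⁻¹` since `Δ^* = -Δ ∘ Γ⁻¹`. -/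
def conjAdjointAct (P : PDO R) (f : Fn R) : Fn R :=
  fun n => ∑ᶠ k : ℕ, -(DlStar^[k] (P.coeff (k + 1) * Dl f)) (n - 1)

/-- The adjoint `P^* = ∑_k (Δ^*)^k ∘ u_k` of `P = ∑_k u_k Δ^k`, rewritten as
`∑_m (adjCoeff P m) (Δ^*)^m` by the Leibniz rule
`(Δ^*)^k ∘ g = ∑_{i ≥ 0} binom(k, i) ((Δ^*)^i g)(n - k + i) (Δ^*)^{k - i}`. -/
def adjCoeff (P : PDO R) (m : ℤ) : Fn R :=
  fun n => ∑ᶠ i : ℕ, Ring.choose (m + i) i • (DlStar^[i] (P.coeff (m + i))) (n - m)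

end PDO

/-! ### Spectral parameters

A formal Laurent series in `λ⁻¹` is an element of `LaurentSeries R`, whose variable is `λ⁻¹`.
The coefficients of a series in `λ` and `μ` that is expanded for `|μ| < |λ|` lie in
`LaurentSeries (LaurentSeries R)`, with outer variable `λ⁻¹` and inner variable `μ⁻¹`. -/

/-- The spectral parameter `λ`. -/
def lam {R : Type*} [CommRing R] : LaurentSeries R := HahnSeries.single (-1) 1

/-- The weight `∑ l e_l` of a monomial `∏ t_l^{e_l}`. -/
def weight (e : ℕ+ →₀ ℕ) : ℕ := e.sum fun l k => (l : ℕ) * k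

/-- The exponential `e^{ε ξ(t, λ)} = ∏_l exp(ε t_l λ^l) = ∑_d ∏_l (ε λ^l)^{d_l} t_l^{d_l} / d_l!`. -/
def expXi {R : Type*} [CommRing R] [Algebra ℚ R] (ε : ℚ) : MvPowerSeries ℕ+ (LaurentSeries R) :=
  fun d => d.prod fun l k => (ε ^ k / (k.factorial : ℚ)) • (lam (R := R) ^ (l : ℕ)) ^ k

/-- The series `f(t + ε [λ⁻¹])`, with `[λ⁻¹] = (λ⁻¹, λ⁻²/2, λ⁻³/3, …)`: every monomial
`∏ t_l^{d_l + e_l}` is expanded at `t_l + ε λ^{-l} / l`, and the terms with `t^d λ^{-j}` are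
collected; they come from the finitely many `e` of weight `j`. -/
def shift {R : Type*} [CommRing R] [Algebra ℚ R] (ε : ℚ) (f : MvPowerSeries ℕ+ R) :
    MvPowerSeries ℕ+ (LaurentSeries R) :=
  fun d => HahnSeries.ofPowerSeries ℤ R (PowerSeries.mk fun j =>
    ∑ᶠ (e : ℕ+ →₀ ℕ) (_ : weight e = j),
      (e.prod fun l k => ((d l + k).choose k : ℚ) * (ε / (l : ℕ)) ^ k) •
        MvPowerSeries.coeff (d + e) f)

/-- The series `∑_{k ≥ 0} a_k(t) λ^{-k}`. -/
def assemble {R : Type*} [CommRing R] (a : ℕ → MvPowerSeries ℕ+ R) :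
    MvPowerSeries ℕ+ (LaurentSeries R) :=
  fun d => HahnSeries.ofPowerSeries ℤ R (PowerSeries.mk fun k => MvPowerSeries.coeff d (a k))

/-- A Laurent series with coefficients in `R`, regarded coefficientwise as a Laurent series with
coefficients in `LaurentSeries R` (a series that does not involve the inner variable). -/
def liftInner {R : Type*} [CommRing R] (f : MvPowerSeries ℕ+ (LaurentSeries R)) :
    MvPowerSeries ℕ+ (LaurentSeries (LaurentSeries R)) :=
  fun d => (MvPowerSeries.coeff d f).map (HahnSeries.C : R →+* LaurentSeries R)

/-- A series that does not involve the outer variable. -/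
def liftOuter {R : Type*} [CommRing R] (f : MvPowerSeries ℕ+ R) :
    MvPowerSeries ℕ+ (LaurentSeries R) :=
  MvPowerSeries.map (HahnSeries.C : R →+* LaurentSeries R) f

/-! ### The discrete modified KP hierarchy -/

section Hierarchy

variable {K : Type*} [Field K] [CharZero K]

/-- The Lax operator `L = Z Δ Z⁻¹`; `Y` is `Z⁻¹`. -/
def lax (Z Y : PDO K) : PDO K := ((Z.mul (PDO.Dpow 1)).mul Y)

/-- The operator `(L^i)_{≥ 1}`. -/
def laxPos (Z Y : PDO K) (i : ℕ+) : PDO K := ((lax Z Y).pow i).posPart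

/-- `Z = z_0 + z_1 Δ⁻¹ + z_2 Δ⁻² + ⋯` is a dressing operator of the discrete modified KP hierarchy,
and `Y` is its inverse, again of the form `y_0 + y_1 Δ⁻¹ + ⋯`: the Sato equations
`∂Z/∂t_i = -(L^i)_{≤ 0} Z` hold for all `i ≥ 1`. -/
structure IsDressing (Z Y : PDO K) : Prop where
  order_le : ∀ k, 0 < k → Z.coeff k = 0
  inv_order_le : ∀ k, 0 < k → Y.coeff k = 0
  mul_inv : Z.mul Y = PDO.Dpow 0
  inv_mul : Y.mul Z = PDO.Dpow 0
  sato : ∀ (i : ℕ+) (k n : ℤ), MvPowerSeries.pderiv K i (Z.coeff k n) =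
    -((((lax Z Y).pow i).nonposPart).mul Z).coeff k n

/-- The wave function `w(n, t, λ) = Z(n) (1+λ)^n e^{ξ(t, λ)}`, where `Δ^k` acts on
`(1+λ)^n e^{ξ(t, λ)}` as `λ^k`. -/
def wave (Z : PDO K) : Fn (LaurentSeries K) := fun n =>
  assemble (fun k : ℕ => Z.coeff (-(k : ℤ)) n) * MvPowerSeries.C ((1 + lam (R := K)) ^ n) *
    expXi 1

/-- The adjoint wave function
`w^*(n, t, λ) = (Z⁻¹(n-1) Δ⁻¹)^* (1+λ)^{-n} e^{-ξ(t, λ)}`, where `(Δ^*)^k` acts on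
`(1+λ)^{-n} e^{-ξ(t, λ)}` as `λ^k`. The operator has order at most `-1` in `Δ^*`. -/
def adjWave (Y : PDO K) : Fn (LaurentSeries K) := fun n =>
  assemble (fun k : ℕ => ((Y.shiftBack).mul (PDO.Dpow (-1))).adjCoeff (-1 - (k : ℤ)) n) *
    MvPowerSeries.C ((lam (R := K))⁻¹ * (1 + lam (R := K)) ^ (-n)) * expXi (-1)

/-- Eigenfunctions: `∂φ/∂t_i = (L^i)_{≥ 1}(φ)`. -/
def IsEigenfunction (Z Y : PDO K) (φ : Fn K) : Prop :=
  ∀ (i : ℕ+) (n : ℤ), MvPowerSeries.pderiv K i (φ n) = (laxPos Z Y i).act φ n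

/-- Adjoint eigenfunctions: `∂ψ/∂t_i = -(Δ⁻¹ (L^i)^*_{≥ 1} Δ)(ψ)`. -/
def IsAdjointEigenfunction (Z Y : PDO K) (ψ : Fn K) : Prop :=
  ∀ (i : ℕ+) (n : ℤ), MvPowerSeries.pderiv K i (ψ n) = -(laxPos Z Y i).conjAdjointAct ψ n

/-- `S` is a squared eigenfunction potential `S(φ, Δψ)`:
`Δ S = φ (Δψ)` and `∂S/∂t_i = res_Δ (Δ⁻¹ ∘ (Δψ) ∘ (L^i)_{≥ 1} ∘ φ ∘ Δ⁻¹)` for all `i ≥ 1`.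
The functions may have coefficients in a larger ring `R`, for instance in series in spectral
parameters; `ι : K → R` is the inclusion. -/
structure IsSEP (Z Y : PDO K) {R : Type*} [CommRing R] (ι : K →+* R) (φ ψ S : Fn R) : Prop where
  diff_eq : Dl S = φ * Dl ψ
  flow_eq : ∀ (i : ℕ+) (n : ℤ), MvPowerSeries.pderiv R i (S n) =
    ((PDO.Dpow (-1)).mul ((PDO.ofFn (Dl ψ)).mul (((laxPos Z Y i).map ι).mul
      ((PDO.ofFn φ).mul (PDO.Dpow (-1)))))).res n

/-- `T` is a squared eigenfunction potential `Ŝ(Δφ, ψ(n+1))`: it is `φ ψ - S(φ, Δψ)`. -/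
def IsHatSEP (Z Y : PDO K) {R : Type*} [CommRing R] (ι : K →+* R) (φ ψ T : Fn R) : Prop :=
  ∃ S : Fn R, IsSEP Z Y ι φ ψ S ∧ T = φ * ψ - S

/-- The inclusion of `K` into series in one spectral parameter. -/
abbrev incl₁ : K →+* LaurentSeries K := HahnSeries.C

/-- The inclusion of `K` into series in two spectral parameters. -/
abbrev incl₂ : K →+* LaurentSeries (LaurentSeries K) :=
  (HahnSeries.C : LaurentSeries K →+* LaurentSeries (LaurentSeries K)).comp HahnSeries.C

/-- The series `φ(n, t + [λ⁻¹]) w^*(n, t, λ)`. -/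
def eigenPot (Y : PDO K) (φ : Fn K) : Fn (LaurentSeries K) :=
  fun n => shift 1 (φ n) * adjWave Y n

/-- The series `w(n, t, λ) ψ(n, t - [λ⁻¹])`. -/
def adjPot (Z : PDO K) (ψ : Fn K) : Fn (LaurentSeries K) :=
  fun n => wave Z n * shift (-1) (ψ n)

/-- The series `w(n, t + [λ⁻¹], μ) w^*(n, t, λ)`, with outer variable `λ⁻¹` and inner variable
`μ⁻¹`. -/
def basicPot (Z Y : PDO K) : Fn (LaurentSeries (LaurentSeries K)) :=
  fun n => shift 1 (wave Z n) * liftInner (adjWave Y n)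

/-- The series `w(n, t, μ) w^*(n, t - [μ⁻¹], λ)`, with outer variable `μ⁻¹` and inner variable
`λ⁻¹`. -/
def basicHatPot (Z Y : PDO K) : Fn (LaurentSeries (LaurentSeries K)) :=
  fun n => liftInner (wave Z n) * shift (-1) (adjWave Y n)

/-! ### Residues of functions of two sets of times -/

/-- Formal power series in two sets of times `t` (outer) and `t'` (inner). -/
abbrev TwoTime (R : Type*) := MvPowerSeries ℕ+ (MvPowerSeries ℕ+ R)

/-- `f(t)` as a series in `t` and `t'`. -/
def atT {R : Type*} [CommRing R] (f : MvPowerSeries ℕ+ R) : TwoTime R :=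
  MvPowerSeries.map (MvPowerSeries.C : R →+* MvPowerSeries ℕ+ R) f

/-- `f(t')` as a series in `t` and `t'`. -/
def atT' {R : Type*} [CommRing R] (f : MvPowerSeries ℕ+ R) : TwoTime R := MvPowerSeries.C f

/-- The residue in the outer spectral parameter `λ`: the coefficient of `λ⁻¹`. -/
def resOuter {R : Type*} [CommRing R] (F : TwoTime (LaurentSeries R)) : TwoTime R :=
  fun d d' => HahnSeries.coeff (MvPowerSeries.coeff d' (MvPowerSeries.coeff d F)) 1

/-- The residue in the inner spectral parameter. -/
def resInner {R : Type*} [CommRing R] (F : TwoTime (LaurentSeries (LaurentSeries R))) :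
    TwoTime (LaurentSeries R) :=
  fun d d' => (MvPowerSeries.coeff d' (MvPowerSeries.coeff d F)).map
    (HahnSeries.coeff.addMonoidHom (1 : ℤ) : LaurentSeries R →+ R)

/-- The double residue `res_μ (ρ(μ) res_λ (S(w(n, t, μ), Δ w^*(n, t, λ)) h(λ)))`, where
`ρ(μ) = S(φ(n, t'), Δ w^*(n, t', μ))`, `h(λ) = Ŝ(Δ w(n, t', λ), ψ(n+1, t'))`. -/
def doubleRes (Z Y : PDO K) (φ ψ : Fn K) (n : ℤ) : TwoTime K :=
  resOuter (atT' (eigenPot Y φ n) *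
    resOuter (atT (basicPot Z Y n) * atT' (liftInner (R := K) (adjPot Z ψ n))))

/-- The double residue `res_μ (ρ(μ) res_λ (Ŝ(Δ w(n, t, μ), w^*(n+1, t, λ)) h(λ)))`, with the same
`ρ(μ)` and `h(λ)`. -/
def doubleHatRes (Z Y : PDO K) (φ ψ : Fn K) (n : ℤ) : TwoTime K :=
  resOuter (atT' (eigenPot Y φ n) *
    resInner (atT (basicHatPot Z Y n) * atT' (liftOuter (adjPot Z ψ n))))

end Hierarchy

end DmKP

end

noncomputable section

namespace DmKP

open Finset

/-! ### Laurent series in `λ⁻¹` -/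

section Laurent

variable {R : Type*} [CommRing R]

/-! Every operator is rewritten in powers of the shift `Γ` instead of `Δ`, that is, as an infinite
matrix bounded above (`PDO.toBand_mul`). Then `Z` and `Y` are mutually inverse lower triangular
matrices, `(L^i)_{≥1}` is a matrix `A_i` supported on the diagonals `0, …, i` with zero row sums,
and the Sato equations read `∂_i Z = A_i Z - Z Δ^i`, `∂_i Y = Δ^i Y - Y A_i`. Since `λ = (1+λ) - 1`
plays the role of `Δ = Γ - 1`, the coefficients of `e^{-ξ} w(n)` in powers of `1+λ` are the entries
`Z(n,m)`, and those of `e^{ξ} w^*(n)` are the partial row sums of `Y` (`IsDressing.isWave`,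
`IsDressing.isEigTransform_adjWave`).

The equation `Δσ = φ Δw^*` is solved by summing over `l ≥ n`, and `Δs = w Δψ` by summing over `l <
n`; for each power of `1+λ` these sums are finite. In the time derivative, `Δ^i` cancels against the
derivative of the exponential. What remains is a difference of row and column sums of a band matrix
cut at `n`, hence the sum over the rectangle `l < n ≤ m`, and this is also what the residue in the
definition of a potential amounts to (`PDO.IsPositive.res_eq_potFlow`).

For the closed forms, `ZY = 1` gives `res_λ w(m) σ(n) = φ(m)` for `m ≥ n`. Both `w` and `φ` solve
one linear system in `t`, so the differential operators that make up the shift of times can be moved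
from `φ` to `w`, where they turn `e^ξ` into a geometric series. The outcome is `λ⁻¹ φ(n, t+[λ⁻¹]) =
Θ (1+λ)^n e^ξ σ(n)` with `Θ` independent of `φ` (`exists_shift_eq_mul`). Taking `φ = 1`, `σ = w^*`
eliminates `Θ`. The case of `ψ` is dual, and the two basic kernels are the same statements over the
field of Laurent series in the other parameter, with `φ = w` or `ψ = w^*`.

For the double residues, taking the residue against a fixed series is a linear functional that
preserves the flows, and solutions of the flows are determined by their values at `t = 0`. Hence
`res_μ ρ(μ,t') w(m,t,μ) = φ(m,t)` for `m ≥ n`, and dually for `ψ`. A functional in one parameter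
commutes with the time shift by the other, so one of the two residues turns the kernel into a closed
form of a single parameter. The remaining residue is computed from its derivatives in `t` and in
`t'` (`IsEigTransform.res_mul_hat`). The same pairing with one set of times frozen at `0` has the
flow of a potential, and after a correction of its constant terms in `n` it is one. -/

theorem coeff_mul_eq_zero_of_lt {a b : ℤ} {x y : LaurentSeries R}
    (hx : ∀ k < a, x.coeff k = 0) (hy : ∀ k < b, y.coeff k = 0) {k : ℤ} (hk : k < a + b) :
    (x * y).coeff k = 0 := by
  rw [HahnSeries.coeff_mul]
  refine Finset.sum_eq_zero fun p hp => ?_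
  rw [Finset.mem_antidiagonal] at hp
  by_cases h : p.1 < a
  · rw [hx _ h, zero_mul]
  · rw [hy p.2 (by omega), mul_zero]

theorem coeff_mul_add {a b : ℤ} {x y : LaurentSeries R}
    (hx : ∀ k < a, x.coeff k = 0) (hy : ∀ k < b, y.coeff k = 0) :
    (x * y).coeff (a + b) = x.coeff a * y.coeff b := by
  have h1 : ((x - HahnSeries.single a (x.coeff a)) * y).coeff (a + b) = 0 := by
    refine coeff_mul_eq_zero_of_lt (a := a + 1) (b := b) (fun k hk => ?_) hy (by omega)
    rw [HahnSeries.coeff_sub, HahnSeries.coeff_single]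
    split_ifs with h
    · rw [h, sub_self]
    · rw [hx k (by omega), sub_zero]
  rw [sub_mul, HahnSeries.coeff_sub, sub_eq_zero] at h1
  rw [h1, add_comm a b, HahnSeries.coeff_single_mul_add]

theorem coeff_ofPowerSeries_of_neg (f : PowerSeries R) {k : ℤ} (hk : k < 0) :
    (HahnSeries.ofPowerSeries ℤ R f).coeff k = 0 := by
  rw [PowerSeries.coeff_coe, if_pos hk]

theorem coeff_ofPowerSeries_natCast (f : PowerSeries R) (k : ℕ) :
    (HahnSeries.ofPowerSeries ℤ R f).coeff k = PowerSeries.coeff k f := by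
  rw [HahnSeries.ofPowerSeries_apply_coeff]

/-- A Laurent series is determined, up to high order, by finitely many coefficients. -/
theorem coeff_ofPowerSeries_mul (f : PowerSeries R) {z : LaurentSeries R} {a k : ℤ}
    (hz : ∀ j < a, z.coeff j = 0) {J : ℕ} (hJ : k < a + J) :
    (HahnSeries.ofPowerSeries ℤ R f * z).coeff k
      = ∑ j ∈ range J, PowerSeries.coeff j f * z.coeff (k - j) := by
  -- Cutting `f` at degree `J` changes it by a series of order at least `J`, which is too small to
  -- reach the coefficient `k`.
  have h1 : ((HahnSeries.ofPowerSeries ℤ R f -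
      ∑ j ∈ range J, HahnSeries.single (j : ℤ) (PowerSeries.coeff j f)) * z).coeff k = 0 := by
    refine coeff_mul_eq_zero_of_lt (a := J) (b := a) (fun i hi => ?_) hz (by omega)
    rw [HahnSeries.coeff_sub, HahnSeries.coeff_sum]
    simp only [HahnSeries.coeff_single]
    by_cases h : i < 0
    · rw [coeff_ofPowerSeries_of_neg f h, Finset.sum_eq_zero, sub_zero]
      intro j _
      rw [if_neg (by omega)]
    · lift i to ℕ using (not_lt.mp h)
      rw [coeff_ofPowerSeries_natCast, Finset.sum_eq_single i, if_pos rfl, sub_self]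
      · intro j _ hj
        rw [if_neg (by omega)]
      · intro hj
        exact absurd (Finset.mem_range.mpr (by omega)) hj
  rw [sub_mul, HahnSeries.coeff_sub, sub_eq_zero] at h1
  rw [h1, Finset.sum_mul, HahnSeries.coeff_sum]
  refine Finset.sum_congr rfl fun j _ => ?_
  have := HahnSeries.coeff_single_mul_add (r := PowerSeries.coeff j f) (x := z)
    (a := k - j) (b := (j : ℤ))
  rwa [sub_add_cancel] at this

end Laurent

/-! ### Expansions in powers of `1 + λ` -/

section Zeta

variable {F : Type*} [Field F]

/-- The multiplier `1 + λ` of the shift of `n`. -/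
def zeta : LaurentSeries F := 1 + lam

theorem coeff_lam_mul (x : LaurentSeries F) (k : ℤ) : (lam * x).coeff k = x.coeff (k + 1) := by
  have := HahnSeries.coeff_single_mul_add (r := (1 : F)) (x := x) (a := k + 1) (b := (-1 : ℤ))
  rw [one_mul, add_neg_cancel_right] at this
  exact this

theorem lam_ne_zero : (lam : LaurentSeries F) ≠ 0 :=
  HahnSeries.single_ne_zero one_ne_zero

theorem coeff_lam_zpow_mul (p : ℤ) (x : LaurentSeries F) (k : ℤ) :
    (lam ^ p * x).coeff k = x.coeff (k + p) := by
  induction p generalizing k with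
  | zero => simp
  | succ n ih => rw [zpow_add_one₀ lam_ne_zero, mul_comm (lam ^ _), mul_assoc, coeff_lam_mul, ih]; congr 1; ring
  | pred n ih =>
    have h := coeff_lam_mul (lam ^ (-(n : ℤ) - 1) * x) (k - 1)
    rw [← mul_assoc, ← zpow_one_add₀ lam_ne_zero, sub_add_cancel, add_sub_cancel, ih] at h
    rw [← h]; congr 1; ring

theorem zeta_ne_zero : (zeta : LaurentSeries F) ≠ 0 := by
  intro h
  have := congrArg (fun x : LaurentSeries F => x.coeff (-1)) h
  simp [zeta, lam, HahnSeries.coeff_one] at this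

/-- Orders are counted in `λ⁻¹`: the leading term of `(1+λ)^j` is `λ^j`, which sits at index `-j`.
-/
theorem zeta_zpow_lead (j : ℤ) :
    (∀ k < -j, ((zeta : LaurentSeries F) ^ j).coeff k = 0) ∧
      ((zeta : LaurentSeries F) ^ j).coeff (-j) = 1 := by
  -- Negative powers are inverses of positive ones; comparing leading terms in `x y = 1` gives the
  -- order and leading coefficient of `y`.
  have key : ∀ x y : LaurentSeries F, ∀ a : ℤ, x * y = 1 → (∀ k < -a, x.coeff k = 0) →
      x.coeff (-a) = 1 → (∀ k < a, y.coeff k = 0) ∧ y.coeff a = 1 := by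
    intro x y a hxy hx hx1
    have hy0 : y ≠ 0 := right_ne_zero_of_mul (hxy ▸ one_ne_zero)
    have hy : ∀ k < y.order, y.coeff k = 0 := fun k hk => HahnSeries.coeff_eq_zero_of_lt_order hk
    have h := coeff_mul_add hx hy
    have hne : y.coeff y.order ≠ 0 := by
      rwa [HahnSeries.coeff_order_eq_zero.ne]
    rw [hxy, hx1, one_mul, HahnSeries.coeff_one] at h
    have ha : y.order = a := by
      by_contra hc
      rw [if_neg (by omega)] at h
      exact hne h.symm
    rw [ha, if_pos (by omega)] at h
    rw [ha] at hy
    exact ⟨hy, h.symm⟩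
  have h1 : ∀ k < (-1 : ℤ), (zeta : LaurentSeries F).coeff k = 0 := by
    intro k hk
    simp only [zeta, lam, HahnSeries.coeff_add, HahnSeries.coeff_one, HahnSeries.coeff_single]
    rw [if_neg (by omega), if_neg (by omega), add_zero]
  have h2 : (zeta : LaurentSeries F).coeff (-1) = 1 := by
    simp [zeta, lam, HahnSeries.coeff_one]
  have hn : ∀ n : ℕ, (∀ k < -(n : ℤ), ((zeta : LaurentSeries F) ^ n).coeff k = 0) ∧
      ((zeta : LaurentSeries F) ^ n).coeff (-(n : ℤ)) = 1 := by
    intro n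
    induction n with
    | zero =>
      simp only [pow_zero, HahnSeries.coeff_one]
      exact ⟨fun k hk => if_neg (by omega), by simp⟩
    | succ n ih =>
      rw [pow_succ]
      have e : -((n + 1 : ℕ) : ℤ) = -(n : ℤ) + -1 := by push_cast; ring
      rw [e]
      refine ⟨fun k hk => coeff_mul_eq_zero_of_lt ih.1 h1 hk, ?_⟩
      rw [coeff_mul_add ih.1 h1, ih.2, h2, one_mul]
  obtain ⟨n, rfl | rfl⟩ := j.eq_nat_or_neg
  · rw [zpow_natCast]; exact hn n
  · rw [neg_neg]
    refine key (zeta ^ n) _ n ?_ (hn n).1 (hn n).2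
    rw [zpow_neg, zpow_natCast, mul_inv_cancel₀ (pow_ne_zero _ zeta_ne_zero)]

/-- The coefficients in an expansion in powers of `1 + λ` determine the degree. -/
theorem coeff_eq_zero_of_res_zeta {x : LaurentSeries F} {M : ℤ}
    (h : ∀ m, M ≤ m → (x * zeta ^ (-m - 1)).coeff 1 = 0) : ∀ k ≤ -M, x.coeff k = 0 := by
  intro k hk
  by_contra hne
  have hx0 : x ≠ 0 := by rintro rfl; simp at hne
  have hord : x.order ≤ k := HahnSeries.order_le_of_coeff_ne_zero hne
  have hx : ∀ k < x.order, x.coeff k = 0 := fun k hk => HahnSeries.coeff_eq_zero_of_lt_order hk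
  -- Multiplication by the power `x.order - 1` of `1+λ` moves the leading coefficient of `x` to
  -- index `1`, so this residue is nonzero.
  have h0 := h (-x.order) (by omega)
  have h2 := coeff_mul_add hx (zeta_zpow_lead (F := F) (- -x.order - 1)).1
  rw [(zeta_zpow_lead (F := F) (- -x.order - 1)).2, mul_one] at h2
  have e : x.order + -(- -x.order - 1) = 1 := by ring
  rw [e, h0] at h2
  exact (HahnSeries.coeff_order_eq_zero.ne.mpr hx0) h2.symm

theorem eq_zero_of_res_zeta {x : LaurentSeries F}
    (h : ∀ m : ℤ, (x * zeta ^ m).coeff 1 = 0) : x = 0 := by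
  ext k
  exact coeff_eq_zero_of_res_zeta (M := -k) (fun m _ => h _) k (by omega)

/-- For `j ≥ 0` the power is a polynomial in `λ`, and for `j ≤ -2` it starts at `λ^j`; only `j = -1`
leaves a residue. Thus `(1+λ)^m` and `(1+λ)^{-m-1}` are dual bases for the residue pairing. -/
theorem coeff_zeta_zpow_one (j : ℤ) : ((zeta : LaurentSeries F) ^ j).coeff 1
    = if j = -1 then 1 else 0 := by
  split_ifs with h
  · have := (zeta_zpow_lead (F := F) j).2
    rw [← this]; congr 1; omega
  · rcases lt_or_gt_of_ne h with h | h
    · exact (zeta_zpow_lead (F := F) j).1 1 (by omega)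
    · lift j to ℕ using by omega
      rw [zpow_natCast, zeta, add_pow, HahnSeries.coeff_sum]
      refine Finset.sum_eq_zero fun i _ => ?_
      rw [one_pow, one_mul, lam, HahnSeries.single_pow, one_pow]
      have : ((j.choose i : ℕ) : LaurentSeries F) = HahnSeries.C ((j.choose i : ℕ) : F) := by simp
      rw [this, mul_comm, HahnSeries.C_mul_eq_smul, HahnSeries.coeff_smul, HahnSeries.coeff_single,
        if_neg (by simp; omega), smul_zero]

/-- The residue of a product in terms of expansions in powers of `1 + λ`. -/
theorem res_mul_eq_sum {x y : LaurentSeries F} {M N : ℤ}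
    (hx : ∀ m, N < m → (x * zeta ^ (-m - 1)).coeff 1 = 0)
    (hy : ∀ m, m < M → (y * zeta ^ m).coeff 1 = 0) :
    (x * y).coeff 1
      = ∑ m ∈ Icc M N, (x * zeta ^ (-m - 1)).coeff 1 * (y * zeta ^ m).coeff 1 := by
  -- Once the terms of degrees `M, …, N` are removed, `x'` is `O(λ^{M-1})`, while `y` is
  -- `O(λ^{-M-1})`. Their product has no residue, so only the removed terms contribute.
  set x' := x - ∑ m ∈ Icc M N, HahnSeries.C ((x * zeta ^ (-m - 1)).coeff 1) * zeta ^ m with hx'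
  have h1 : ∀ m, M ≤ m → (x' * zeta ^ (-m - 1)).coeff 1 = 0 := by
    intro m hm
    rw [hx', sub_mul, HahnSeries.coeff_sub, Finset.sum_mul, HahnSeries.coeff_sum]
    have e : ∀ i ∈ Icc M N, (HahnSeries.C ((x * zeta ^ (-i - 1)).coeff 1) * zeta ^ i *
        zeta ^ (-m - 1)).coeff 1 = if i = m then (x * zeta ^ (-m - 1)).coeff 1 else 0 := by
      intro i _
      rw [mul_assoc, ← zpow_add₀ zeta_ne_zero, HahnSeries.C_mul_eq_smul, HahnSeries.coeff_smul,
        coeff_zeta_zpow_one]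
      by_cases h : i = m
      · rw [if_pos (by omega), if_pos h, h, smul_eq_mul, mul_one]
      · rw [if_neg (by omega), if_neg h, smul_zero]
    rw [Finset.sum_congr rfl e, Finset.sum_ite_eq']
    split_ifs with hm'
    · rw [sub_self]
    · rw [hx m (by rw [mem_Icc] at hm'; omega), sub_zero]
  have h2 := coeff_eq_zero_of_res_zeta h1
  have h3 := coeff_eq_zero_of_res_zeta (x := y) (M := -M) fun m hm => hy (-m - 1) (by omega)
  have h4 : (x' * y).coeff 1 = 0 :=
    coeff_mul_eq_zero_of_lt (a := -M + 1) (b := M + 1) (fun k hk => h2 k (by omega))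
      (fun k hk => h3 k (by omega)) (by omega)
  rw [hx', sub_mul, HahnSeries.coeff_sub, sub_eq_zero] at h4
  rw [h4, Finset.sum_mul, HahnSeries.coeff_sum]
  refine Finset.sum_congr rfl fun m _ => ?_
  rw [mul_assoc, HahnSeries.C_mul_eq_smul, HahnSeries.coeff_smul, smul_eq_mul, mul_comm (zeta ^ m)]

end Zeta

/-! ### Coefficientwise functionals -/

section Functional

variable {F : Type*} [Field F]

/-- A functional on Laurent series, applied to all coefficients of a series in `t`. -/
def mapLin {A B : Type*} [Semiring A] [Semiring B] [Module F A] [Module F B] (ℓ : A →ₗ[F] B) :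
    MvPowerSeries ℕ+ A →ₗ[F] MvPowerSeries ℕ+ B where
  toFun X := fun d => ℓ (MvPowerSeries.coeff d X)
  map_add' X X' := by
    ext d
    exact map_add ℓ _ _
  map_smul' r X := by
    ext d
    exact map_smul ℓ _ _

theorem coeff_mapLin {A B : Type*} [Semiring A] [Semiring B] [Module F A] [Module F B]
    (ℓ : A →ₗ[F] B) (X : MvPowerSeries ℕ+ A) (d : ℕ+ →₀ ℕ) :
    MvPowerSeries.coeff d (mapLin ℓ X) = ℓ (MvPowerSeries.coeff d X) := rfl

theorem mapLin_pderiv {A B : Type*} [CommRing A] [CommRing B] [Module F A] [Module F B]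
    (ℓ : A →ₗ[F] B) (i : ℕ+) (X : MvPowerSeries ℕ+ A) :
    mapLin ℓ (MvPowerSeries.pderiv A i X) = MvPowerSeries.pderiv B i (mapLin ℓ X) := by
  ext d
  rw [coeff_mapLin, MvPowerSeries.coeff_pderiv, MvPowerSeries.coeff_pderiv, coeff_mapLin]
  rw [mul_comm, ← Nat.cast_succ, ← nsmul_eq_mul, map_nsmul, nsmul_eq_mul, mul_comm, Nat.cast_succ]

theorem mapLin_map_C_mul (ℓ : LaurentSeries F →ₗ[F] F) (f : MvPowerSeries ℕ+ F)
    (X : MvPowerSeries ℕ+ (LaurentSeries F)) :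
    mapLin ℓ (MvPowerSeries.map HahnSeries.C f * X) = f * mapLin ℓ X := by
  classical
  ext d
  rw [coeff_mapLin, MvPowerSeries.coeff_mul, MvPowerSeries.coeff_mul, map_sum]
  refine Finset.sum_congr rfl fun p _ => ?_
  rw [MvPowerSeries.coeff_map, HahnSeries.C_mul_eq_smul, map_smul, smul_eq_mul, coeff_mapLin]

theorem pderiv_map {A B : Type*} [CommRing A] [CommRing B] (f : A →+* B) (i : ℕ+)
    (X : MvPowerSeries ℕ+ A) :
    MvPowerSeries.pderiv B i (MvPowerSeries.map f X)
      = MvPowerSeries.map f (MvPowerSeries.pderiv A i X) := by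
  ext d
  simp [MvPowerSeries.coeff_pderiv, MvPowerSeries.coeff_map]

/-- The residue in `λ` of a series in `t`. -/
def resL : MvPowerSeries ℕ+ (LaurentSeries F) →ₗ[F] MvPowerSeries ℕ+ F :=
  mapLin (HahnSeries.coeff.linearMap (1 : ℤ))

theorem coeff_resL (X : MvPowerSeries ℕ+ (LaurentSeries F)) (d : ℕ+ →₀ ℕ) :
    MvPowerSeries.coeff d (resL X) = (MvPowerSeries.coeff d X).coeff 1 := rfl

theorem eq_of_resL_zeta {X X' : MvPowerSeries ℕ+ (LaurentSeries F)}
    (h : ∀ m : ℤ, resL (X * MvPowerSeries.C (zeta ^ m)) = resL (X' * MvPowerSeries.C (zeta ^ m))) :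
    X = X' := by
  ext1 d
  rw [← sub_eq_zero]
  refine eq_zero_of_res_zeta fun m => ?_
  have := congrArg (MvPowerSeries.coeff d) (h m)
  rw [coeff_resL, coeff_resL, MvPowerSeries.coeff_mul_C, MvPowerSeries.coeff_mul_C] at this
  rw [sub_mul, HahnSeries.coeff_sub, this, sub_self]

/-- The residue of a product in terms of the expansions in powers of `1 + λ`. -/
theorem resL_mul {X X' : MvPowerSeries ℕ+ (LaurentSeries F)} {a b : ℤ → MvPowerSeries ℕ+ F}
    {M N : ℤ} (hX : ∀ m, resL (X * MvPowerSeries.C (zeta ^ (-m - 1))) = a m)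
    (hX' : ∀ m, resL (X' * MvPowerSeries.C (zeta ^ m)) = b m)
    (ha : ∀ m, N < m → a m = 0) (hb : ∀ m, m < M → b m = 0) :
    resL (X * X') = ∑ m ∈ Icc M N, a m * b m := by
  classical
  have hX1 : ∀ d m, (MvPowerSeries.coeff d X * zeta ^ (-m - 1)).coeff 1
      = MvPowerSeries.coeff d (a m) := by
    intro d m
    rw [← hX m, coeff_resL, MvPowerSeries.coeff_mul_C]
  have hX2 : ∀ d m, (MvPowerSeries.coeff d X' * zeta ^ m).coeff 1
      = MvPowerSeries.coeff d (b m) := by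
    intro d m
    rw [← hX' m, coeff_resL, MvPowerSeries.coeff_mul_C]
  ext d
  rw [coeff_resL, MvPowerSeries.coeff_mul, HahnSeries.coeff_sum, map_sum]
  simp_rw [MvPowerSeries.coeff_mul]
  rw [Finset.sum_comm]
  refine Finset.sum_congr rfl fun p _ => ?_
  rw [res_mul_eq_sum (M := M) (N := N)]
  · simp_rw [hX1, hX2]
  · intro m hm
    rw [hX1, ha m hm, map_zero]
  · intro m hm
    rw [hX2, hb m hm, map_zero]

end Functional

/-- A linear system of differential equations with zero initial values has only the zero
solution. -/
theorem eq_zero_of_linear_system {A I : Type*} [CommRing A] [Algebra ℚ A]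
    (f : I → MvPowerSeries ℕ+ A) (s : ℕ+ → I → Finset I) (c : ℕ+ → I → I → MvPowerSeries ℕ+ A)
    (hf : ∀ i m, MvPowerSeries.pderiv A i (f m) = ∑ m' ∈ s i m, c i m m' * f m')
    (h0 : ∀ m, MvPowerSeries.constantCoeff (f m) = 0) (m : I) : f m = 0 := by
  classical
  -- Induction on total degree: up to a positive integer factor, the coefficient at `e + single i 1`
  -- is the coefficient at `e` of the right-hand side, which involves lower degrees only.
  have key : ∀ (N : ℕ) (d : ℕ+ →₀ ℕ), d.degree ≤ N → ∀ m, MvPowerSeries.coeff d (f m) = 0 := by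
    intro N
    induction N with
    | zero =>
      intro d hd m
      rw [Nat.le_zero, Finsupp.degree_eq_zero_iff] at hd
      rw [hd, MvPowerSeries.coeff_zero_eq_constantCoeff, h0]
    | succ N ih =>
      intro d hd m
      by_cases hd0 : d = 0
      · rw [hd0, MvPowerSeries.coeff_zero_eq_constantCoeff, h0]
      obtain ⟨i, hi⟩ := Finsupp.ne_iff.mp hd0
      rw [Finsupp.coe_zero, Pi.zero_apply] at hi
      have hle : Finsupp.single i 1 ≤ d := by
        rw [Finsupp.single_le_iff]; omega
      obtain ⟨e, rfl⟩ := exists_add_of_le hle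
      have hdeg : e.degree ≤ N := by
        rw [map_add, Finsupp.degree_single] at hd; omega
      have h1 := congrArg (MvPowerSeries.coeff e) (hf i m)
      rw [MvPowerSeries.coeff_pderiv, map_sum] at h1
      rw [Finset.sum_eq_zero] at h1
      · have h2 : ((e i + 1 : ℕ) : ℚ) • MvPowerSeries.coeff (Finsupp.single i 1 + e) (f m) = 0 := by
          rw [Algebra.smul_def, map_natCast, mul_comm, add_comm (Finsupp.single i 1) e]
          push_cast
          exact h1
        have h3 : ((e i + 1 : ℕ) : ℚ) ≠ 0 := by positivity
        calc _ = ((e i + 1 : ℕ) : ℚ)⁻¹ • ((e i + 1 : ℕ) : ℚ) •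
              MvPowerSeries.coeff (Finsupp.single i 1 + e) (f m) := by
                rw [smul_smul, inv_mul_cancel₀ h3, one_smul]
          _ = 0 := by rw [h2, smul_zero]
      · intro m' _
        rw [MvPowerSeries.coeff_mul]
        refine Finset.sum_eq_zero fun p hp => ?_
        rw [HasAntidiagonal.mem_antidiagonal] at hp
        rw [ih p.2 _ m', mul_zero]
        have := congrArg Finsupp.degree hp
        rw [map_add] at this
        omega
  ext d
  exact key _ d le_rfl m

/-! ### The exponential and the expansion of `f(t + ε [λ⁻¹])` -/

/-- Raising one exponent changes one factor, and `P` collects all the others. Used to compare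
neighbouring coefficients of the exponential and of the shift. -/
theorem prod_add_single {B : Type*} [CommMonoid B] (g : ℕ+ → ℕ → B) (hg : ∀ l, g l 0 = 1)
    (d : ℕ+ →₀ ℕ) (i : ℕ+) : ∃ P : B, d.prod g = g i (d i) * P ∧
      (d + Finsupp.single i 1).prod g = g i (d i + 1) * P := by
  classical
  refine ⟨∏ l ∈ d.support.erase i, g l (d l), ?_, ?_⟩
  · rw [Finsupp.prod_of_support_subset d (Finset.subset_insert i d.support) g (fun l _ => hg l),
      ← Finset.mul_prod_erase _ _ (Finset.mem_insert_self i d.support), Finset.erase_insert_eq_erase]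
  · have h : (d + Finsupp.single i 1).support ⊆ insert i d.support := by
      refine Finsupp.support_add.trans fun l hl => ?_
      rw [Finset.mem_union] at hl
      rcases hl with hl | hl
      · exact Finset.mem_insert_of_mem hl
      · have := Finsupp.support_single_subset hl
        rw [Finset.mem_singleton] at this
        rw [this]; exact Finset.mem_insert_self _ _
    rw [Finsupp.prod_of_support_subset _ h g (fun l _ => hg l),
      ← Finset.mul_prod_erase _ _ (Finset.mem_insert_self i d.support), Finset.erase_insert_eq_erase]
    congr 1
    · simp
    · refine Finset.prod_congr rfl fun l hl => ?_
      rw [Finsupp.add_apply, Finsupp.single_eq_of_ne (Finset.ne_of_mem_erase hl), add_zero]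

section Exp

variable {R : Type*} [CommRing R] [Algebra ℚ R]

theorem coeff_expXi (ε : ℚ) (d : ℕ+ →₀ ℕ) : MvPowerSeries.coeff d (expXi (R := R) ε) =
    d.prod fun l k => (ε ^ k / (k.factorial : ℚ)) • (lam (R := R) ^ (l : ℕ)) ^ k := rfl

theorem pderiv_expXi (ε : ℚ) (i : ℕ+) :
    MvPowerSeries.pderiv (LaurentSeries R) i (expXi (R := R) ε)
      = MvPowerSeries.C (ε • (lam (R := R)) ^ (i : ℕ)) * expXi ε := by
  ext1 d
  rw [MvPowerSeries.coeff_pderiv, MvPowerSeries.coeff_C_mul]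
  obtain ⟨P, h1, h2⟩ := prod_add_single
    (fun (l : ℕ+) (k : ℕ) => (ε ^ k / (k.factorial : ℚ)) • (lam (R := R) ^ (l : ℕ)) ^ k)
    (fun l => by simp) d i
  rw [coeff_expXi, coeff_expXi, h1, h2]
  have h3 : ε ^ (d i + 1) / ((d i + 1).factorial : ℚ) * (d i + 1) =
      ε * (ε ^ (d i) / ((d i).factorial : ℚ)) := by
    rw [Nat.factorial_succ]
    have := Nat.factorial_ne_zero (d i)
    push_cast
    field_simp
    ring
  rw [← Nat.cast_succ, mul_comm, ← nsmul_eq_mul, ← Nat.cast_smul_eq_nsmul ℚ, ← smul_mul_assoc,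
    smul_smul, Nat.cast_succ, mul_comm ((d i : ℚ) + 1), h3, pow_succ, ← smul_smul, smul_mul_assoc,
    smul_mul_assoc, smul_mul_assoc, smul_mul_assoc, mul_comm (_ ^ _) (lam ^ _), mul_assoc,
    mul_smul_comm]

theorem constantCoeff_expXi (ε : ℚ) : MvPowerSeries.constantCoeff (expXi (R := R) ε) = 1 := by
  rw [← MvPowerSeries.coeff_zero_eq_constantCoeff_apply]
  exact Finsupp.prod_zero_index (h := fun (l : ℕ+) (k : ℕ) =>
    (ε ^ k / (k.factorial : ℚ)) • (lam (R := R) ^ (l : ℕ)) ^ k)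

/-- Torsion-freeness is what makes a power series determined by its partial derivatives and its
constant term. -/
theorem isAddTorsionFree_of_rat (A : Type*) [CommRing A] [Algebra ℚ A] : IsAddTorsionFree A := by
  refine ⟨fun n hn x y hxy => ?_⟩
  have h3 : (n : ℚ) ≠ 0 := by exact_mod_cast hn
  have h : ∀ z : A, z = (n : ℚ)⁻¹ • (n • z) := by
    intro z
    rw [nsmul_eq_mul, Algebra.smul_def, ← mul_assoc, ← map_natCast (algebraMap ℚ A), ← map_mul,
      inv_mul_cancel₀ h3, map_one, one_mul]
  rw [h x, h y]
  exact congrArg _ hxy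

theorem expXi_mul_expXi_neg (ε : ℚ) : expXi (R := R) ε * expXi (-ε) = 1 := by
  have := isAddTorsionFree_of_rat (LaurentSeries R)
  refine MvPowerSeries.pderiv.ext (fun i => ?_) ?_
  · rw [Derivation.leibniz, pderiv_expXi, pderiv_expXi, MvPowerSeries.pderiv_one, neg_smul, map_neg]
    simp only [smul_eq_mul]
    ring
  · rw [map_mul, constantCoeff_expXi, constantCoeff_expXi, map_one, one_mul]

end Exp

theorem weight_add (e e' : ℕ+ →₀ ℕ) : weight (e + e') = weight e + weight e' :=
  Finsupp.sum_add_index' (fun _ => mul_zero _) (fun _ _ _ => mul_add _ _ _)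

theorem weight_single (l : ℕ+) (k : ℕ) : weight (Finsupp.single l k) = l * k :=
  Finsupp.sum_single_index (mul_zero _)

theorem le_weight (e : ℕ+ →₀ ℕ) (l : ℕ+) : (l : ℕ) * e l ≤ weight e := by
  by_cases h : l ∈ e.support
  · exact Finset.single_le_sum (f := fun l : ℕ+ => (l : ℕ) * e l) (fun _ _ => Nat.zero_le _) h
  · rw [Finsupp.notMem_support_iff.mp h, mul_zero]; exact Nat.zero_le _

/-- By `le_weight`, a bound on the weight bounds both the support and the exponents. -/
theorem finite_weight_eq (j : ℕ) : {e : ℕ+ →₀ ℕ | weight e = j}.Finite := by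
  classical
  have hfin : {l : ℕ+ | (l : ℕ) ≤ j}.Finite :=
    (Set.finite_Iic j).preimage PNat.coe_injective.injOn
  refine (Set.finite_Iic (Finsupp.indicator hfin.toFinset (fun _ _ => j))).subset fun e he => ?_
  rw [Set.mem_ofPred_eq] at he
  rw [Set.mem_Iic]
  intro l
  rw [Finsupp.indicator_apply]
  have h := le_weight e l
  rw [he] at h
  split_ifs with hl
  · exact le_trans (Nat.le_mul_of_pos_left _ l.pos) h
  · rw [Set.Finite.mem_toFinset, Set.mem_ofPred_eq] at hl
    by_contra hc
    have : (l : ℕ) * 1 ≤ l * e l := Nat.mul_le_mul_left _ (by omega)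
    omega

/-- The exponents of weight `j`. -/
def weightFinset (j : ℕ) : Finset (ℕ+ →₀ ℕ) := (finite_weight_eq j).toFinset

theorem mem_weightFinset {j : ℕ} {e : ℕ+ →₀ ℕ} : e ∈ weightFinset j ↔ weight e = j := by
  simp [weightFinset]

/-! ### The coefficients of the time shift as differential operators -/

section Schur

variable {A : Type*} [CommRing A] [Algebra ℚ A]

/-- The combinatorial factor of `shift`. -/
def shiftFactor (ε : ℚ) (d e : ℕ+ →₀ ℕ) : ℚ :=
  e.prod fun l k => ((d l + k).choose k : ℚ) * (ε / (l : ℕ)) ^ k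

/-- The coefficient of `λ^{-j}` in `f(t + ε [λ⁻¹])`. -/
def schur (ε : ℚ) (j : ℕ) : MvPowerSeries ℕ+ A →ₗ[A] MvPowerSeries ℕ+ A where
  toFun f := fun d => ∑ e ∈ weightFinset j, shiftFactor ε d e • MvPowerSeries.coeff (d + e) f
  map_add' f g := by
    ext d
    change (∑ e ∈ weightFinset j, shiftFactor ε d e • MvPowerSeries.coeff (d + e) (f + g)) =
      (∑ e ∈ weightFinset j, shiftFactor ε d e • MvPowerSeries.coeff (d + e) f) +
      (∑ e ∈ weightFinset j, shiftFactor ε d e • MvPowerSeries.coeff (d + e) g)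
    rw [← Finset.sum_add_distrib]
    refine Finset.sum_congr rfl fun e _ => ?_
    rw [map_add, smul_add]
  map_smul' r f := by
    ext d
    change (∑ e ∈ weightFinset j, shiftFactor ε d e • MvPowerSeries.coeff (d + e) (r • f)) =
      r * (∑ e ∈ weightFinset j, shiftFactor ε d e • MvPowerSeries.coeff (d + e) f)
    rw [Finset.mul_sum]
    refine Finset.sum_congr rfl fun e _ => ?_
    rw [map_smul, smul_eq_mul, mul_smul_comm]

theorem coeff_schur (ε : ℚ) (j : ℕ) (f : MvPowerSeries ℕ+ A) (d : ℕ+ →₀ ℕ) :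
    MvPowerSeries.coeff d (schur ε j f)
      = ∑ e ∈ weightFinset j, shiftFactor ε d e • MvPowerSeries.coeff (d + e) f := rfl

theorem coeff_shift (ε : ℚ) (f : MvPowerSeries ℕ+ A) (d : ℕ+ →₀ ℕ) :
    MvPowerSeries.coeff d (shift ε f) = HahnSeries.ofPowerSeries ℤ A
      (PowerSeries.mk fun j => MvPowerSeries.coeff d (schur ε j f)) := by
  change HahnSeries.ofPowerSeries ℤ A _ = _
  congr 2
  funext j
  rw [coeff_schur]
  have := finsum_mem_eq_finite_toFinset_sum
    (fun e => shiftFactor ε d e • MvPowerSeries.coeff (d + e) f) (finite_weight_eq j)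
  exact this

theorem schur_zero (ε : ℚ) (f : MvPowerSeries ℕ+ A) : schur ε 0 f = f := by
  ext d
  rw [coeff_schur]
  have h : weightFinset 0 = {0} := by
    ext e
    rw [mem_weightFinset, Finset.mem_singleton]
    constructor
    · intro h
      ext l
      have := le_weight e l
      rw [h, Nat.le_zero, mul_eq_zero] at this
      exact this.resolve_left l.ne_zero
    · rintro rfl
      exact Finsupp.sum_zero_index
  rw [h, Finset.sum_singleton, shiftFactor, Finsupp.prod_zero_index, one_smul, add_zero]

/-- Absorption of binomials, `(e+1) binom(d+e+1, e+1) = (d+e+1) binom(d+e, e)`, together with `(ε/l)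
l = ε`. This is the coefficient form of differentiating `f(t + ε [λ⁻¹])`. -/
theorem shiftFactor_add_single (ε : ℚ) (d e : ℕ+ →₀ ℕ) (l : ℕ+) :
    shiftFactor ε d (e + Finsupp.single l 1) * ((l : ℕ) * (e l + 1))
      = ε * (shiftFactor ε d e * ((d + e) l + 1)) := by
  obtain ⟨P, h1, h2⟩ := prod_add_single
    (fun (l : ℕ+) (k : ℕ) => ((d l + k).choose k : ℚ) * (ε / (l : ℕ)) ^ k)
    (fun l => by simp) e l
  rw [shiftFactor, shiftFactor, h1, h2]
  have h3 : ((d l + (e l + 1)).choose (e l + 1) : ℚ) * (e l + 1)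
      = (d l + e l + 1) * ((d l + e l).choose (e l) : ℚ) := by
    exact_mod_cast (Nat.add_one_mul_choose_eq (d l + e l) (e l)).symm
  have hl : ((l : ℕ) : ℚ) ≠ 0 := by exact_mod_cast l.ne_zero
  have h4 : (ε / (l : ℕ)) ^ (e l + 1) * (l : ℕ) = ε * (ε / (l : ℕ)) ^ (e l) := by
    rw [pow_succ]; field_simp
  rw [Finsupp.add_apply]
  push_cast
  linear_combination (P * (ε / (l : ℕ)) ^ (e l + 1) * (l : ℕ)) * h3 +
    P * (d l + e l + 1) * ((d l + e l).choose (e l) : ℚ) * h4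

theorem coeff_rat_smul (q : ℚ) (f : MvPowerSeries ℕ+ A) (d : ℕ+ →₀ ℕ) :
    MvPowerSeries.coeff d (q • f) = q • MvPowerSeries.coeff d f := rfl

/-- Formally the shift is `exp(ε ∑_l λ^{-l} ∂_l / l)`; applying `-λ d/dλ` and comparing coefficients
gives this recursion. All later facts on `schur` come from it by induction on `j`. -/
theorem schur_succ (ε : ℚ) (j : ℕ) (f : MvPowerSeries ℕ+ A) :
    ((j : ℚ) + 1) • schur ε (j + 1) f
      = ε • ∑ p ∈ antidiagonal j, schur ε p.2 (MvPowerSeries.pderiv A (Nat.succPNat p.1) f) := by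
  classical
  ext d
  rw [coeff_rat_smul, coeff_rat_smul, map_sum, coeff_schur, Finset.smul_sum, Finset.smul_sum]
  simp_rw [coeff_schur, Finset.smul_sum]
  have hL : ∀ e ∈ weightFinset (j + 1), ((j : ℚ) + 1) • shiftFactor ε d e •
      MvPowerSeries.coeff (d + e) f = ∑ l ∈ e.support, (((l : ℕ) * e l : ℕ) : ℚ) •
        shiftFactor ε d e • MvPowerSeries.coeff (d + e) f := by
    intro e he
    rw [← Finset.sum_smul, ← Nat.cast_sum]
    rw [mem_weightFinset] at he
    have : ∑ l ∈ e.support, (l : ℕ) * e l = j + 1 := he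
    rw [this]; push_cast; rfl
  rw [Finset.sum_congr rfl hL, Finset.sum_sigma', Finset.sum_sigma']
  symm
  -- The factor `j+1` is written as the weight `∑ l e_l`, so that each exponent comes with a chosen
  -- `l` in its support; the bijection removes one unit at that `l`.
  refine Finset.sum_bij' (fun x _ => ⟨x.2 + Finsupp.single (Nat.succPNat x.1.1) 1, Nat.succPNat x.1.1⟩)
    (fun y _ => ⟨((y.2 : ℕ) - 1, j + 1 - y.2), y.1 - Finsupp.single y.2 1⟩) ?_ ?_ ?_ ?_ ?_
  · rintro ⟨⟨k, q⟩, e⟩ hx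
    simp only [mem_sigma, HasAntidiagonal.mem_antidiagonal, mem_weightFinset] at hx ⊢
    rw [weight_add, weight_single, Nat.succPNat_coe]
    refine ⟨by omega, ?_⟩
    simp
  · rintro ⟨e, l⟩ hy
    simp only [mem_sigma, HasAntidiagonal.mem_antidiagonal, mem_weightFinset] at hy ⊢
    have hl : e l ≠ 0 := Finsupp.mem_support_iff.mp hy.2
    have hle : Finsupp.single l 1 ≤ e := by
      rw [Finsupp.single_le_iff]; omega
    have h1 := weight_add (e - Finsupp.single l 1) (Finsupp.single l 1)
    rw [tsub_add_cancel_of_le hle, weight_single, hy.1] at h1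
    have := l.pos
    omega
  · rintro ⟨⟨k, q⟩, e⟩ hx
    simp only [mem_sigma, HasAntidiagonal.mem_antidiagonal] at hx
    have h1 : (Nat.succPNat k : ℕ) = k + 1 := rfl
    simp only [h1, add_tsub_cancel_right]
    have : j + 1 - (k + 1) = q := by omega
    rw [this]
  · rintro ⟨e, l⟩ hy
    simp only [mem_sigma] at hy
    have hl : e l ≠ 0 := Finsupp.mem_support_iff.mp hy.2
    have hle : Finsupp.single l 1 ≤ e := by
      rw [Finsupp.single_le_iff]; omega
    have h1 : Nat.succPNat ((l : ℕ) - 1) = l := by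
      apply PNat.coe_injective
      rw [Nat.succPNat_coe]
      have := l.pos
      change (l : ℕ) - 1 + 1 = l
      omega
    simp only [h1, tsub_add_cancel_of_le hle]
  · rintro ⟨⟨k, q⟩, e⟩ hx
    have h := shiftFactor_add_single ε d e (Nat.succPNat k)
    simp only [MvPowerSeries.coeff_pderiv]
    have h4 : ((((d + e) (Nat.succPNat k) : ℕ) : A) + 1)
        = (((d + e) (Nat.succPNat k) : ℚ) + 1) • (1 : A) := by
      rw [Algebra.smul_def, mul_one, map_add, map_natCast, map_one]
    rw [h4, mul_smul_comm, mul_one, smul_smul, smul_smul, smul_smul, add_assoc]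
    congr 1
    rw [mul_assoc, ← h, Finsupp.add_apply, Finsupp.single_eq_same]
    push_cast
    ring

theorem rat_smul_cancel (j : ℕ) {x y : MvPowerSeries ℕ+ A}
    (h : ((j : ℚ) + 1) • x = ((j : ℚ) + 1) • y) : x = y := by
  have h3 : ((j : ℚ) + 1) ≠ 0 := by positivity
  rw [← one_smul ℚ x, ← one_smul ℚ y, ← inv_mul_cancel₀ h3, ← smul_smul, h, smul_smul]

/-- A shift of the variables is multiplicative. The induction uses `j + 1 = p.1 + p.2` to split the
weighted sum into a part where the derivative falls on `f` and one where it falls on `g`; the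
Leibniz rule joins them. -/
theorem schur_mul (ε : ℚ) (j : ℕ) (f g : MvPowerSeries ℕ+ A) :
    schur ε j (f * g) = ∑ p ∈ antidiagonal j, schur ε p.1 f * schur ε p.2 g := by
  induction j using Nat.strong_induction_on generalizing f g with
  | _ j ih =>
    cases j with
    | zero => simp [schur_zero]
    | succ j =>
      have key : ∀ f g : MvPowerSeries ℕ+ A, ∑ p ∈ antidiagonal (j + 1),
          (p.1 : ℚ) • (schur ε p.1 f * schur ε p.2 g) = ε • ∑ p ∈ antidiagonal j,
            schur ε p.2 (MvPowerSeries.pderiv A (Nat.succPNat p.1) f * g) := by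
        intro f g
        rw [Finset.Nat.sum_antidiagonal_succ]
        simp only [Nat.cast_zero, zero_smul, zero_add]
        have h1 : ∀ p ∈ antidiagonal j, ((p.1 + 1 : ℕ) : ℚ) • (schur ε (p.1 + 1) f * schur ε p.2 g)
            = ε • ∑ q ∈ antidiagonal p.1,
              schur ε q.2 (MvPowerSeries.pderiv A (Nat.succPNat q.1) f) * schur ε p.2 g := by
          intro p _
          rw [← smul_mul_assoc, Nat.cast_succ, schur_succ, smul_mul_assoc, Finset.sum_mul]
        rw [Finset.sum_congr rfl h1, ← Finset.smul_sum]
        have h2 : ∀ p ∈ antidiagonal j,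
            schur ε p.2 (MvPowerSeries.pderiv A (Nat.succPNat p.1) f * g) =
              ∑ q ∈ antidiagonal p.2,
                schur ε q.1 (MvPowerSeries.pderiv A (Nat.succPNat p.1) f) * schur ε q.2 g := by
          intro p hp
          rw [HasAntidiagonal.mem_antidiagonal] at hp
          rw [ih p.2 (by omega)]
        rw [Finset.sum_congr rfl h2, Finset.sum_sigma', Finset.sum_sigma']
        congr 1
        refine Finset.sum_bij' (fun x _ => ⟨(x.2.1, x.2.2 + x.1.2), (x.2.2, x.1.2)⟩)
          (fun y _ => ⟨(y.1.1 + y.2.1, y.2.2), (y.1.1, y.2.1)⟩) ?_ ?_ ?_ ?_ ?_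
        all_goals rintro ⟨⟨a, b⟩, ⟨u, v⟩⟩ hx
        all_goals simp only [mem_sigma, HasAntidiagonal.mem_antidiagonal] at hx ⊢
        · exact ⟨by omega, trivial⟩
        · exact ⟨by omega, trivial⟩
        · obtain ⟨h1, h2⟩ := hx; subst h2; rfl
        · obtain ⟨h1, h2⟩ := hx; subst h2; rfl
      refine rat_smul_cancel j ?_
      rw [schur_succ]
      have h3 : ∀ p ∈ antidiagonal (j + 1), ((j : ℚ) + 1) • (schur ε p.1 f * schur ε p.2 g)
          = (p.1 : ℚ) • (schur ε p.1 f * schur ε p.2 g) +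
            (p.2 : ℚ) • (schur ε p.1 f * schur ε p.2 g) := by
        intro p hp
        rw [HasAntidiagonal.mem_antidiagonal] at hp
        rw [← add_smul]
        congr 1
        exact_mod_cast hp.symm
      rw [Finset.smul_sum (s := antidiagonal (j + 1)), Finset.sum_congr rfl h3, Finset.sum_add_distrib, key f g,
        ← Finset.Nat.sum_antidiagonal_swap (n := j + 1)]
      have h4 := key g f
      simp only [Prod.fst_swap, Prod.snd_swap] at h4 ⊢
      have h5 : ∀ p ∈ antidiagonal (j + 1), (p.1 : ℚ) • (schur ε p.2 f * schur ε p.1 g)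
          = (p.1 : ℚ) • (schur ε p.1 g * schur ε p.2 f) := by
        intro p _
        rw [mul_comm]
      rw [Finset.sum_congr rfl h5, h4, ← smul_add, ← Finset.sum_add_distrib]
      congr 1
      refine Finset.sum_congr rfl fun p _ => ?_
      rw [← map_add, Derivation.leibniz]
      congr 1
      simp only [smul_eq_mul]
      ring

theorem schur_C_mul (ε : ℚ) (j : ℕ) (r : A) (f : MvPowerSeries ℕ+ A) :
    schur ε j (MvPowerSeries.C r * f) = MvPowerSeries.C r * schur ε j f := by
  rw [← MvPowerSeries.smul_eq_C_mul, map_smul, MvPowerSeries.smul_eq_C_mul]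

/-- On such an exponential the shift acts as `exp(∑_l (x/λ)^l / l) = (1 - x/λ)⁻¹`, because `ε δ =
1`. -/
theorem schur_eq_of_pderiv {ε δ : ℚ} (h : ε * δ = 1) (x : A) (X : MvPowerSeries ℕ+ A)
    (hX : ∀ i : ℕ+, MvPowerSeries.pderiv A i X = MvPowerSeries.C (δ • x ^ (i : ℕ)) * X) (j : ℕ) :
    schur ε j X = MvPowerSeries.C (x ^ j) * X := by
  induction j using Nat.strong_induction_on with
  | _ j ih =>
    cases j with
    | zero => rw [schur_zero, pow_zero, map_one, one_mul]
    | succ j =>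
      refine rat_smul_cancel j ?_
      rw [schur_succ]
      have h1 : ∀ p ∈ antidiagonal j, schur ε p.2 (MvPowerSeries.pderiv A
          (Nat.succPNat p.1) X) = δ • (MvPowerSeries.C (x ^ (j + 1)) * X) := by
        intro p hp
        rw [HasAntidiagonal.mem_antidiagonal] at hp
        rw [hX, schur_C_mul, ih p.2 (by omega), ← mul_assoc, ← map_mul, smul_mul_assoc,
          ← pow_add, Nat.succPNat_coe]
        have : p.1.succ + p.2 = j + 1 := by omega
        rw [this]
        ext d
        rw [coeff_rat_smul, MvPowerSeries.coeff_C_mul, MvPowerSeries.coeff_C_mul, smul_mul_assoc]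
      rw [Finset.sum_congr rfl h1, Finset.sum_const, Finset.Nat.card_antidiagonal,
        ← Nat.cast_smul_eq_nsmul ℚ, smul_smul, smul_smul]
      congr 1
      push_cast
      linear_combination ((j : ℚ) + 1) * h

end Schur

theorem schur_expXi {R : Type*} [CommRing R] [Algebra ℚ R] {ε δ : ℚ} (h : ε * δ = 1) (j : ℕ) :
    schur ε j (expXi (R := R) δ) = MvPowerSeries.C (lam (R := R) ^ j) * expXi δ :=
  schur_eq_of_pderiv h lam _ (fun i => by
    rw [pderiv_expXi]
    congr 2
    -- Two `ℚ`-module structures on Laurent series meet here; they agree because the identity, being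
    -- additive, commutes with rational scalars.
    exact map_rat_smul (_instM₂ := Algebra.toModule) (AddMonoidHom.id (LaurentSeries R)) δ
      (lam ^ (i : ℕ))) j

/-! ### Evaluation of residues at shifted times -/

/-- If a family of series and a family of functions solve the same linear system and are related
by an additive map, then the same holds for all their derivatives that enter into the shift of
times. -/
theorem map_schur_of_linear_system {A B I : Type*} [CommRing A] [Algebra ℚ A] [CommRing B]
    [Algebra ℚ B] (ε : ℚ) {φ : B →+* A} {T : MvPowerSeries ℕ+ A →+ MvPowerSeries ℕ+ B}
    (hT : ∀ g X, T (MvPowerSeries.map φ g * X) = g * T X) {a : I → MvPowerSeries ℕ+ A}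
    {f : I → MvPowerSeries ℕ+ B} {s : ℕ+ → I → Finset I} {c : ℕ+ → I → I → MvPowerSeries ℕ+ B}
    (ha : ∀ i m, MvPowerSeries.pderiv _ i (a m)
      = ∑ m' ∈ s i m, MvPowerSeries.map φ (c i m m') * a m')
    (hf : ∀ i m, MvPowerSeries.pderiv _ i (f m) = ∑ m' ∈ s i m, c i m m' * f m')
    (hab : ∀ m, T (a m) = f m) (j : ℕ) (m : I) :
    T (schur ε j (a m)) = schur ε j (f m) := by
  -- The pairs generated by `(g a_m, g f_m)` are closed under simultaneous differentiation, thanks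
  -- to the common linear system, and `T` carries first components to second ones. The recursion for
  -- `schur` then never leaves `V`.
  let V : AddSubmonoid (MvPowerSeries ℕ+ A × MvPowerSeries ℕ+ B) :=
    AddSubmonoid.closure {x | ∃ g m, x = (MvPowerSeries.map φ g * a m, g * f m)}
  have hV : ∀ g m, (MvPowerSeries.map φ g * a m, g * f m) ∈ V := fun g m =>
    AddSubmonoid.subset_closure ⟨g, m, rfl⟩
  have hpd : ∀ (i : ℕ+) (x) (_ : x ∈ V),
      (MvPowerSeries.pderiv _ i x.1, MvPowerSeries.pderiv _ i x.2) ∈ V := by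
    intro i x hx
    induction hx using AddSubmonoid.closure_induction with
    | mem x hx =>
      obtain ⟨g, m, rfl⟩ := hx
      have e : ((MvPowerSeries.pderiv A i (MvPowerSeries.map φ g * a m),
          MvPowerSeries.pderiv B i (g * f m)) : MvPowerSeries ℕ+ A × MvPowerSeries ℕ+ B) =
          ∑ m' ∈ s i m, (MvPowerSeries.map φ (g * c i m m') * a m', g * c i m m' * f m')
          + (MvPowerSeries.map φ (MvPowerSeries.pderiv B i g) * a m,
            MvPowerSeries.pderiv B i g * f m) := by
        rw [Prod.ext_iff]
        simp only [Prod.fst_add, Prod.snd_add, Prod.fst_sum, Prod.snd_sum, Derivation.leibniz,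
          pderiv_map, ha, hf, smul_eq_mul, Finset.mul_sum, map_mul, mul_assoc]
        constructor
        · rw [mul_comm (a m)]
        · rw [mul_comm (f m)]
      rw [e]
      exact V.add_mem (V.sum_mem fun m' _ => hV _ _) (hV _ _)
    | zero =>
      rw [Prod.fst_zero, Prod.snd_zero, map_zero, map_zero]
      exact V.zero_mem
    | add x y _ _ hx hy =>
      rw [Prod.fst_add, Prod.snd_add, map_add, map_add]
      exact V.add_mem hx hy
  have key : ∀ (j : ℕ) (x) (_ : x ∈ V), T (schur ε j x.1) = schur ε j x.2 := by
    intro j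
    induction j using Nat.strong_induction_on with
    | _ j ih =>
      intro x hx
      cases j with
      | zero =>
        rw [schur_zero, schur_zero]
        induction hx using AddSubmonoid.closure_induction with
        | mem x hx =>
          obtain ⟨g, m, rfl⟩ := hx
          rw [hT, hab]
        | zero => simp
        | add x y _ _ hx hy => rw [Prod.fst_add, Prod.snd_add, map_add, hx, hy]
      | succ j =>
        refine rat_smul_cancel j ?_
        rw [← map_rat_smul T, schur_succ, schur_succ, map_rat_smul T, map_sum]
        congr 1
        refine Finset.sum_congr rfl fun p hp => ?_
        rw [HasAntidiagonal.mem_antidiagonal] at hp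
        exact ih p.2 (by omega) _ (hpd _ x hx)
  have h := key j _ (hV 1 m)
  rwa [map_one, one_mul, one_mul] at h

/-- The vanishing of coefficients is inherited by the coefficients of the shifted series. -/
theorem map_coeff_schur_eq_zero {A B : Type*} [CommRing A] [Algebra ℚ A] [AddCommGroup B]
    [Module ℚ B] (T : A →+ B) {X : MvPowerSeries ℕ+ A}
    (hX : ∀ d, T (MvPowerSeries.coeff d X) = 0) (ε : ℚ) (j : ℕ) (d : ℕ+ →₀ ℕ) :
    T (MvPowerSeries.coeff d (schur ε j X)) = 0 := by
  rw [coeff_schur, map_sum]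
  refine Finset.sum_eq_zero fun e _ => ?_
  rw [map_rat_smul T, hX, smul_zero]

/-! ### The time shift as multiplication by a universal factor -/

section Shift

variable {F : Type*} [Field F]

/-- The series `∑_q λ^{-q} A_q`. -/
def convolution (A : ℕ → MvPowerSeries ℕ+ (LaurentSeries F)) :
    MvPowerSeries ℕ+ (LaurentSeries F) :=
  fun d => HahnSeries.ofPowerSeries ℤ F (PowerSeries.mk fun k => ∑ q ∈ range (k + 1),
    (MvPowerSeries.coeff d (A q)).coeff ((k : ℤ) - q))

theorem coeff_convolution (A : ℕ → MvPowerSeries ℕ+ (LaurentSeries F)) (d : ℕ+ →₀ ℕ) :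
    MvPowerSeries.coeff d (convolution A) =
      HahnSeries.ofPowerSeries ℤ F (PowerSeries.mk fun k => ∑ q ∈ range (k + 1),
        (MvPowerSeries.coeff d (A q)).coeff ((k : ℤ) - q)) := rfl

/-- As `B` starts at `λ⁻¹`, only the terms `λ^{-q} A_q` with `q ≤ j` reach the coefficient of
`λ^{-j-1}`; there `λ^{-q} A_q B` contributes its coefficient of index `1 + (j - q)` without the
factor. -/
theorem coeff_convolution_mul {A : ℕ → LaurentSeries F} {B : LaurentSeries F}
    (hA : ∀ q, ∀ k < 0, (A q).coeff k = 0) (hB : ∀ k < 1, B.coeff k = 0) (j : ℕ) :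
    (HahnSeries.ofPowerSeries ℤ F (PowerSeries.mk fun k => ∑ q ∈ range (k + 1),
      (A q).coeff ((k : ℤ) - q)) * B).coeff ((j : ℤ) + 1)
      = ∑ p ∈ antidiagonal j, (A p.2 * B).coeff (1 + p.1) := by
  set Θ := HahnSeries.ofPowerSeries ℤ F (PowerSeries.mk fun k => ∑ q ∈ range (k + 1),
      (A q).coeff ((k : ℤ) - q)) with hΘ
  have hs : ∀ (q : ℕ) (x : LaurentSeries F) (k : ℤ),
      (HahnSeries.single (q : ℤ) (1 : F) * x).coeff k = x.coeff (k - q) := by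
    intro q x k
    have := HahnSeries.coeff_single_mul_add (r := (1 : F)) (x := x) (a := k - q) (b := (q : ℤ))
    rwa [sub_add_cancel, one_mul] at this
  have h1 : ((Θ - ∑ q ∈ range (j + 1), HahnSeries.single (q : ℤ) 1 * A q) * B).coeff
      ((j : ℤ) + 1) = 0 := by
    refine coeff_mul_eq_zero_of_lt (a := (j : ℤ) + 1) (b := 1) (fun k hk => ?_) hB (by omega)
    rw [HahnSeries.coeff_sub, HahnSeries.coeff_sum]
    simp only [hs]
    by_cases h : k < 0
    · rw [hΘ, coeff_ofPowerSeries_of_neg _ h, Finset.sum_eq_zero, sub_zero]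
      intro q _
      exact hA q _ (by omega)
    · lift k to ℕ using not_lt.mp h
      rw [hΘ, coeff_ofPowerSeries_natCast, PowerSeries.coeff_mk, sub_eq_zero]
      refine Finset.sum_subset (Finset.range_subset_range.mpr (by omega)) fun q _ hq => ?_
      rw [Finset.mem_range] at hq
      exact hA q _ (by omega)
  rw [sub_mul, HahnSeries.coeff_sub, sub_eq_zero] at h1
  rw [h1, Finset.sum_mul, HahnSeries.coeff_sum,
    ← Finset.Nat.sum_antidiagonal_swap,
    Finset.Nat.sum_antidiagonal_eq_sum_range_succ_mk]
  refine Finset.sum_congr rfl fun q hq => ?_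
  rw [Finset.mem_range] at hq
  rw [mul_assoc, hs]
  simp only [Prod.snd_swap, Prod.fst_swap]
  congr 1
  push_cast [Nat.cast_sub (Nat.lt_succ_iff.mp hq)]
  ring

variable [Algebra ℚ F]

theorem resL_schur_mul {I : Type*} (ε : ℚ) {a : I → MvPowerSeries ℕ+ (LaurentSeries F)}
    {f : I → MvPowerSeries ℕ+ F} {s : ℕ+ → I → Finset I} {c : ℕ+ → I → I → MvPowerSeries ℕ+ F}
    (ha : ∀ i m, MvPowerSeries.pderiv _ i (a m)
      = ∑ m' ∈ s i m, MvPowerSeries.map HahnSeries.C (c i m m') * a m')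
    (hf : ∀ i m, MvPowerSeries.pderiv _ i (f m) = ∑ m' ∈ s i m, c i m m' * f m')
    {b : MvPowerSeries ℕ+ (LaurentSeries F)} (hab : ∀ m, resL (a m * b) = f m) (j : ℕ) (m : I) :
    resL (schur ε j (a m) * b) = schur ε j (f m) :=
  map_schur_of_linear_system (T := (resL (F := F)).toAddMonoidHom.comp (AddMonoidHom.mulRight b))
    ε (fun _ X => (congrArg resL (mul_assoc _ X b)).trans (mapLin_map_C_mul _ _ _)) ha hf hab j m

/-- The expansion of `f(t + ε [λ⁻¹])` for a function with a spectral representation: the factor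
`Θ` depends neither on the function nor on its spectral transform. -/
theorem exists_shift_eq_mul {I : Type*} {ε : ℚ} (hε : ε * ε = 1)
    {a : I → MvPowerSeries ℕ+ (LaurentSeries F)}
    {s : ℕ+ → I → Finset I} {c : ℕ+ → I → I → MvPowerSeries ℕ+ F}
    (ha : ∀ i m, MvPowerSeries.pderiv _ i (a m)
      = ∑ m' ∈ s i m, MvPowerSeries.map HahnSeries.C (c i m m') * a m') (m : I) (N : ℤ)
    (hdeg : ∀ d, ∀ k < 0, (MvPowerSeries.coeff d
      (a m * expXi (-ε) * MvPowerSeries.C (zeta ^ N))).coeff k = 0) :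
    ∃ Θ : MvPowerSeries ℕ+ (LaurentSeries F), ∀ (f : I → MvPowerSeries ℕ+ F)
      (b : MvPowerSeries ℕ+ (LaurentSeries F)),
      (∀ i m, MvPowerSeries.pderiv _ i (f m) = ∑ m' ∈ s i m, c i m m' * f m') →
      (∀ m, resL (a m * b) = f m) →
      (∀ d, ∀ k < 1, (MvPowerSeries.coeff d
        (b * expXi ε * MvPowerSeries.C (zeta ^ (-N)))).coeff k = 0) →
      MvPowerSeries.C (HahnSeries.single 1 1) * shift ε (f m)
        = Θ * (b * expXi ε * MvPowerSeries.C (zeta ^ (-N))) := by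
  classical
  set a' := a m * expXi (-ε) * MvPowerSeries.C (zeta ^ N) with ha'
  have hS : ∀ q d, ∀ k < 0, (MvPowerSeries.coeff d (schur ε q a')).coeff k = 0 := by
    intro q d k hk
    exact map_coeff_schur_eq_zero (HahnSeries.coeff.addMonoidHom k : LaurentSeries F →+ F)
      (fun d => hdeg d k hk) ε q d
  refine ⟨convolution fun q => schur ε q a', fun f b hf hab hb => ?_⟩
  set b' := b * expXi ε * MvPowerSeries.C (zeta ^ (-N)) with hb'
  have hz : (MvPowerSeries.C (zeta ^ (-N)) : MvPowerSeries ℕ+ (LaurentSeries F)) *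
      MvPowerSeries.C (zeta ^ N) = 1 := by
    rw [← map_mul, ← zpow_add₀ zeta_ne_zero, neg_add_cancel, zpow_zero, map_one]
  have he := expXi_mul_expXi_neg (R := F) ε
  have ham : a m = MvPowerSeries.C (zeta ^ (-N)) * (expXi ε * a') := by
    rw [ha']
    linear_combination -(a m * expXi ε * expXi (-ε)) * hz - a m * he
  ext1 d
  ext k
  have hs : ∀ (x : LaurentSeries F) (k : ℤ),
      (HahnSeries.single (1 : ℤ) (1 : F) * x).coeff k = x.coeff (k - 1) := by
    intro x k
    have := HahnSeries.coeff_single_mul_add (r := (1 : F)) (x := x) (a := k - 1) (b := (1 : ℤ))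
    rwa [sub_add_cancel, one_mul] at this
  rw [MvPowerSeries.coeff_C_mul, coeff_shift, hs, MvPowerSeries.coeff_mul, HahnSeries.coeff_sum]
  by_cases hk : k < 1
  · rw [coeff_ofPowerSeries_of_neg _ (by omega), Finset.sum_eq_zero]
    intro p _
    refine coeff_mul_eq_zero_of_lt (a := 0) (b := 1) (fun k hk => ?_) (hb p.2) (by omega)
    rw [coeff_convolution]
    exact coeff_ofPowerSeries_of_neg _ hk
  · obtain ⟨j, rfl⟩ : ∃ j : ℕ, k = (j : ℤ) + 1 := ⟨(k - 1).toNat, by omega⟩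
    rw [add_sub_cancel_right, coeff_ofPowerSeries_natCast, PowerSeries.coeff_mk,
      ← resL_schur_mul ε ha hf hab j m, ham, schur_C_mul, schur_mul, coeff_resL]
    -- The exponential contained in `a m` is multiplied by `λ^p` under `schur`, and is then absorbed
    -- into `b'`. The residue of `∑ λ^p (schur_q a') b'` over `p + q = j` is the coefficient of
    -- `λ^{-j-1}` in `Θ b'`; this accounts for the extra `λ⁻¹` on the left.
    have h1 : MvPowerSeries.C (zeta ^ (-N)) * (∑ p ∈ antidiagonal j,
        schur ε p.1 (expXi (R := F) ε) * schur ε p.2 a') * b =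
        ∑ p ∈ antidiagonal j, MvPowerSeries.C (lam ^ p.1) * (schur ε p.2 a' * b') := by
      rw [Finset.mul_sum, Finset.sum_mul]
      refine Finset.sum_congr rfl fun p _ => ?_
      rw [schur_expXi hε, hb']
      ring
    have h2 : ∀ p ∈ antidiagonal d, ((MvPowerSeries.coeff p.1
        (convolution fun q => schur ε q a')) * MvPowerSeries.coeff p.2 b').coeff ((j : ℤ) + 1)
        = ∑ q ∈ antidiagonal j, (MvPowerSeries.coeff p.1 (schur ε q.2 a') *
            MvPowerSeries.coeff p.2 b').coeff (1 + q.1) := by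
      intro p _
      rw [coeff_convolution]
      exact coeff_convolution_mul (A := fun q => MvPowerSeries.coeff p.1 (schur ε q a'))
        (fun q => hS q p.1) (hb p.2) j
    rw [Finset.sum_congr rfl h2, Finset.sum_comm, h1, map_sum, HahnSeries.coeff_sum]
    refine Finset.sum_congr rfl fun p _ => ?_
    rw [MvPowerSeries.coeff_C_mul, ← zpow_natCast, coeff_lam_zpow_mul, MvPowerSeries.coeff_mul,
      HahnSeries.coeff_sum]

end Shift

/-! ### Sums over bands -/

section Band

variable {S : Type*} [AddCommGroup S]

/-- Brings band sums with different index ranges to a common square window, where identities between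
them reduce to identities of indicator functions. -/
theorem sum_eq_window {s W : Finset ℤ} {t : ℤ → Finset ℤ} {G H : ℤ → ℤ → S} (hs : s ⊆ W)
    (ht : ∀ l ∈ s, t l ⊆ W) (h1 : ∀ l ∈ s, ∀ p ∈ t l, G l p = H l p)
    (h0 : ∀ l ∈ W, ∀ p ∈ W, ¬(l ∈ s ∧ p ∈ t l) → H l p = 0) :
    ∑ l ∈ s, ∑ p ∈ t l, G l p = ∑ l ∈ W, ∑ p ∈ W, H l p := by
  rw [← Finset.sum_subset hs (f := fun l => ∑ p ∈ W, H l p)]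
  · refine Finset.sum_congr rfl fun l hl => ?_
    rw [← Finset.sum_subset (ht l hl)]
    · exact Finset.sum_congr rfl fun p hp => h1 l hl p hp
    · intro p hp hp'
      exact h0 l (hs hl) p hp fun h => hp' h.2
  · intro l hl hl'
    exact Finset.sum_eq_zero fun p hp => h0 l hl p hp fun h => hl' h.1

/-- Cutting a banded sum at `n`, for a sum that is finite to the left. -/
theorem band_cut_left {G : ℤ → ℤ → S} {i : ℕ} {M n : ℤ} (hl : ∀ l m, m < l → G l m = 0)
    (hu : ∀ l m : ℤ, l + i < m → G l m = 0) (hM : ∀ l m, l < M → G l m = 0) :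
    (∑ l ∈ Ico M n, ∑ m ∈ Icc l (l + i), G l m) - ∑ m ∈ Ico M n, ∑ l ∈ Icc (m - i) m, G l m
      = ∑ l ∈ Ico (n - i) n, ∑ m ∈ Ico n (n + i), G l m := by
  set W := Ico (min (M - i) (n - i)) (n + i) with hW
  have e1 := sum_eq_window (s := Ico M n) (W := W) (t := fun l => Icc l (l + i)) (G := G)
    (H := fun l m => if l < n then G l m else 0)
    (fun l hl => by simp only [hW, mem_Ico] at *; omega)
    (fun l hl p hp => by simp only [hW, mem_Ico, mem_Icc] at *; omega)
    (fun l hl p hp => by rw [if_pos]; simp only [mem_Ico] at *; omega)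
    (fun l _ p _ h => by
      simp only [mem_Ico, mem_Icc] at h
      split_ifs with hln
      · by_cases h1 : p < l
        · exact hl l p h1
        · by_cases h2 : l + i < p
          · exact hu l p h2
          · exact hM l p (by omega)
      · rfl)
  have e2 := sum_eq_window (s := Ico M n) (W := W) (t := fun m => Icc (m - i) m)
    (G := fun m l => G l m)
    (H := fun m l => if m < n then G l m else 0)
    (fun l hl => by simp only [hW, mem_Ico] at *; omega)
    (fun l hl p hp => by simp only [hW, mem_Ico, mem_Icc] at *; omega)
    (fun l hl p hp => by rw [if_pos]; simp only [mem_Ico] at *; omega)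
    (fun p _ l _ h => by
      simp only [mem_Ico, mem_Icc] at h
      split_ifs with hln
      · by_cases h1 : p < l
        · exact hl l p h1
        · by_cases h2 : l + i < p
          · exact hu l p h2
          · exact hM l p (by omega)
      · rfl)
  have e3 := sum_eq_window (s := Ico (n - i) n) (W := W) (t := fun _ => Ico n (n + i)) (G := G)
    (H := fun l m => if l < n ∧ n ≤ m then G l m else 0)
    (fun l hl => by simp only [hW, mem_Ico] at *; omega)
    (fun l hl p hp => by simp only [hW, mem_Ico] at *; omega)
    (fun l hl p hp => by rw [if_pos]; simp only [mem_Ico] at *; omega)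
    (fun l _ p _ h => by
      simp only [mem_Ico] at h
      split_ifs with hln
      · exact hu l p (by omega)
      · rfl)
  rw [e1, e2, e3, Finset.sum_comm (f := fun m l => if m < n then G l m else 0),
    ← Finset.sum_sub_distrib]
  refine Finset.sum_congr rfl fun l _ => ?_
  rw [← Finset.sum_sub_distrib]
  refine Finset.sum_congr rfl fun m _ => ?_
  -- For `l ≤ m` the indicators satisfy `[l < n] - [m < n] = [l < n ≤ m]`.
  by_cases h : m < l
  · simp [hl l m h]
  · split_ifs with h1 h2 h3 h4 h5
    all_goals first | (exfalso; omega) | simp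

/-- Cutting a banded sum at `n`, for a sum that is finite to the right. -/
theorem band_cut_right {G : ℤ → ℤ → S} {i : ℕ} {P n : ℤ} (hl : ∀ l m, m < l → G l m = 0)
    (hu : ∀ l m : ℤ, l + i < m → G l m = 0) (hP : ∀ l m : ℤ, P < l + i → G l m = 0) :
    (∑ m ∈ Icc n P, ∑ l ∈ Icc (m - i) m, G l m) - ∑ l ∈ Icc n P, ∑ m ∈ Icc l (l + i), G l m
      = ∑ l ∈ Ico (n - i) n, ∑ m ∈ Ico n (n + i), G l m := by
  set W := Icc (n - i) (max (P + i) (n + i)) with hW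
  have e1 := sum_eq_window (s := Icc n P) (W := W) (t := fun l => Icc l (l + i)) (G := G)
    (H := fun l m => if n ≤ l then G l m else 0)
    (fun l hl => by simp only [hW, mem_Icc] at *; omega)
    (fun l hl p hp => by simp only [hW, mem_Icc] at *; omega)
    (fun l hl p hp => by rw [if_pos]; simp only [mem_Icc] at *; omega)
    (fun l _ p _ h => by
      simp only [mem_Icc] at h
      split_ifs with hln
      · by_cases h1 : p < l
        · exact hl l p h1
        · by_cases h2 : l + i < p
          · exact hu l p h2
          · exact hP l p (by omega)
      · rfl)
  have e2 := sum_eq_window (s := Icc n P) (W := W) (t := fun m => Icc (m - i) m)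
    (G := fun m l => G l m)
    (H := fun m l => if n ≤ m then G l m else 0)
    (fun l hl => by simp only [hW, mem_Icc] at *; omega)
    (fun l hl p hp => by simp only [hW, mem_Icc] at *; omega)
    (fun l hl p hp => by rw [if_pos]; simp only [mem_Icc] at *; omega)
    (fun p _ l _ h => by
      simp only [mem_Icc] at h
      split_ifs with hln
      · by_cases h1 : p < l
        · exact hl l p h1
        · by_cases h2 : l + i < p
          · exact hu l p h2
          · exact hP l p (by omega)
      · rfl)
  have e3 := sum_eq_window (s := Ico (n - i) n) (W := W) (t := fun _ => Ico n (n + i)) (G := G)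
    (H := fun l m => if l < n ∧ n ≤ m then G l m else 0)
    (fun l hl => by simp only [hW, mem_Icc, mem_Ico] at *; omega)
    (fun l hl p hp => by simp only [hW, mem_Icc, mem_Ico] at *; omega)
    (fun l hl p hp => by rw [if_pos]; simp only [mem_Ico] at *; omega)
    (fun l _ p _ h => by
      simp only [mem_Ico] at h
      split_ifs with hln
      · exact hu l p (by omega)
      · rfl)
  rw [e1, e2, e3, Finset.sum_comm (f := fun m l => if n ≤ m then G l m else 0),
    ← Finset.sum_sub_distrib]
  refine Finset.sum_congr rfl fun l _ => ?_
  rw [← Finset.sum_sub_distrib]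
  refine Finset.sum_congr rfl fun m _ => ?_
  by_cases h : m < l
  · simp [hl l m h]
  · split_ifs with h1 h2 h3 h4 h5
    all_goals first | (exfalso; omega) | simp

/-- The difference of the cuts of a banded sum at `n + 1` and at `n`. -/
theorem band_cut_succ_sub {G : ℤ → ℤ → S} {i : ℕ} {n : ℤ} (hl : ∀ l m, m < l → G l m = 0)
    (hu : ∀ l m : ℤ, l + i < m → G l m = 0) :
    (∑ l ∈ Ico (n + 1 - i) (n + 1), ∑ m ∈ Ico (n + 1) (n + 1 + i), G l m) -
      ∑ l ∈ Ico (n - i) n, ∑ m ∈ Ico n (n + i), G l m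
      = (∑ m ∈ Icc n (n + i), G n m) - ∑ l ∈ Icc (n - i) n, G l n := by
  set W := Icc (n - i) (n + i + 1) with hW
  have e3 : ∀ k, k = n ∨ k = n + 1 → ∑ l ∈ Ico (k - i) k, ∑ m ∈ Ico k (k + i), G l m
      = ∑ l ∈ W, ∑ m ∈ W, if l < k ∧ k ≤ m then G l m else 0 := fun k hk =>
    sum_eq_window (s := Ico (k - i) k) (W := W) (t := fun _ => Ico k (k + i)) (G := G)
      (H := fun l m => if l < k ∧ k ≤ m then G l m else 0)
      (fun l hl => by simp only [hW, mem_Icc, mem_Ico] at *; omega)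
      (fun l hl p hp => by simp only [hW, mem_Icc, mem_Ico] at *; omega)
      (fun l hl p hp => by rw [if_pos]; simp only [mem_Ico] at *; omega)
      (fun l _ p _ h => by
        simp only [mem_Ico] at h
        split_ifs with hln
        · exact hu l p (by omega)
        · rfl)
  have e1 : ∑ m ∈ Icc n (n + i), G n m = ∑ l ∈ W, ∑ m ∈ W, if l = n then G l m else 0 := by
    rw [← sum_eq_window (s := {n}) (W := W) (t := fun l => Icc l (l + i)) (G := G)
      (H := fun l m => if l = n then G l m else 0), Finset.sum_singleton]
    · intro l hl; simp only [hW, mem_Icc, mem_singleton] at *; omega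
    · intro l hl p hp; simp only [hW, mem_Icc, mem_singleton] at *; omega
    · intro l hl p hp; rw [if_pos (mem_singleton.mp hl)]
    · intro l _ p _ h
      simp only [mem_Icc, mem_singleton] at h
      split_ifs with hln
      · by_cases h1 : p < l
        · exact hl l p h1
        · exact hu l p (by omega)
      · rfl
  have e2 : ∑ l ∈ Icc (n - i) n, G l n = ∑ l ∈ W, ∑ m ∈ W, if m = n then G l m else 0 := by
    rw [Finset.sum_comm, ← sum_eq_window (s := {n}) (W := W) (t := fun m => Icc (m - i) m)
      (G := fun m l => G l m) (H := fun m l => if m = n then G l m else 0), Finset.sum_singleton]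
    · intro l hl; simp only [hW, mem_Icc, mem_singleton] at *; omega
    · intro l hl p hp; simp only [hW, mem_Icc, mem_singleton] at *; omega
    · intro l hl p hp; rw [if_pos (mem_singleton.mp hl)]
    · intro p _ l _ h
      simp only [mem_Icc, mem_singleton] at h
      split_ifs with hln
      · by_cases h1 : p < l
        · exact hl l p h1
        · exact hu l p (by omega)
      · rfl
  rw [e3 n (Or.inl rfl), e3 (n + 1) (Or.inr rfl), e1, e2, ← Finset.sum_sub_distrib,
    ← Finset.sum_sub_distrib]
  refine Finset.sum_congr rfl fun l _ => ?_
  rw [← Finset.sum_sub_distrib, ← Finset.sum_sub_distrib]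
  refine Finset.sum_congr rfl fun m _ => ?_
  -- For `l ≤ m`: `[l < n+1 ≤ m] - [l < n ≤ m] = [l = n] - [m = n]`.
  by_cases h : m < l
  · simp [hl l m h]
  · split_ifs with h1 h2 h3 h4 h5 h6 h7 h8 h9
    all_goals first | (exfalso; omega) | simp

end Band

/-- Summation by parts; at the ends `a` and `b` only one of the two terms is present, hence the
conditions. It turns flows written in `Δψ` into linear systems for `ψ`. -/
theorem sum_mul_forward_diff {S : Type*} [CommRing S] (B f : ℤ → S) {a b : ℤ} (hab : a ≤ b) :
    ∑ q ∈ Ico a b, B q * (f (q + 1) - f q)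
      = ∑ q ∈ Icc a b, ((if a < q then B (q - 1) else 0) - (if q < b then B q else 0)) * f q := by
  induction b, hab using Int.leInduction with
  | base => simp
  | succ b hab ih =>
    rw [← Finset.insert_Ico_right_eq_Ico_add_one hab, Finset.sum_insert (by simp), ih,
      ← Finset.insert_Icc_right_eq_Icc_add_one (by omega), Finset.sum_insert (by simp),
      ← Finset.Ico_insert_right hab, Finset.sum_insert (by simp), Finset.sum_insert (by simp)]
    have h : ∀ q ∈ Ico a b, ((if a < q then B (q - 1) else 0) - (if q < b + 1 then B q else 0)) * f q
        = ((if a < q then B (q - 1) else 0) - (if q < b then B q else 0)) * f q := by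
      intro q hq
      rw [mem_Ico] at hq
      rw [if_pos (show q < b + 1 by omega), if_pos hq.2]
    rw [Finset.sum_congr rfl h, if_neg (lt_irrefl _), if_neg (lt_irrefl _),
      if_pos (show b < b + 1 by omega), if_pos (show a < b + 1 by omega), add_sub_cancel_right]
    ring

/-! ### Dressing matrices -/

/-- The flow of a squared eigenfunction potential: the sum of `χ(l) A(l, m) φ(m)` over
`l < n ≤ m`, for a matrix `A` that is supported on `l ≤ m ≤ l + i`. -/
def potFlow {S : Type*} [CommRing S] (i : ℕ) (A : ℤ → ℤ → S) (χ φ : ℤ → S) (n : ℤ) : S :=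
  ∑ l ∈ Ico (n - i) n, ∑ m ∈ Ico n (n + i), χ l * A l m * φ m

/-- The matrices, in powers of the shift, of a dressing operator, of its inverse and of the
operators that generate the flows. -/
structure MatrixDressing {R : Type*} [CommRing R] (Z Y : ℤ → ℤ → MvPowerSeries ℕ+ R)
    (A : ℕ+ → ℤ → ℤ → MvPowerSeries ℕ+ R) : Prop where
  lower : ∀ n m, n < m → Z n m = 0
  inv_lower : ∀ n m, n < m → Y n m = 0
  mul_inv : ∀ n l, ∑ m ∈ Icc l n, Z n m * Y m l = if n = l then 1 else 0
  upper : ∀ i l m, m < l → A i l m = 0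
  band : ∀ (i : ℕ+) (l m : ℤ), l + (i : ℕ) < m → A i l m = 0
  row_sum : ∀ (i : ℕ+) (n : ℤ), ∑ m ∈ Icc n (n + (i : ℕ)), A i n m = 0
  pderiv_row : ∀ (i : ℕ+) (n m : ℤ), MvPowerSeries.pderiv R i (Z n m)
    = (∑ l ∈ Icc n (n + (i : ℕ)), A i n l * Z l m) - (DlStar^[(i : ℕ)] (Z n)) m
  pderiv_col : ∀ (i : ℕ+) (n m : ℤ), MvPowerSeries.pderiv R i (Y m n)
    = (Dl^[(i : ℕ)] (fun p => Y p n)) m - ∑ l ∈ Icc (n - (i : ℕ)) n, Y m l * A i l n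

/-- Eigenfunctions, in terms of matrices. -/
def IsEig {R : Type*} [CommRing R] (A : ℕ+ → ℤ → ℤ → MvPowerSeries ℕ+ R) (φ : Fn R) : Prop :=
  ∀ (i : ℕ+) (n : ℤ), MvPowerSeries.pderiv R i (φ n) = ∑ m ∈ Icc n (n + (i : ℕ)), A i n m * φ m

/-- Adjoint eigenfunctions, in terms of matrices. -/
def IsAdjEig {R : Type*} [CommRing R] (A : ℕ+ → ℤ → ℤ → MvPowerSeries ℕ+ R) (ψ : Fn R) : Prop :=
  ∀ (i : ℕ+) (n : ℤ), MvPowerSeries.pderiv R i (ψ n) = potFlow i (A i) (Dl ψ) 1 n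

/-- Extension of scalars for a matrix. -/
abbrev mapMat {R R' : Type*} [CommRing R] [CommRing R'] (ι : R →+* R')
    (A : ℕ+ → ℤ → ℤ → MvPowerSeries ℕ+ R) : ℕ+ → ℤ → ℤ → MvPowerSeries ℕ+ R' :=
  fun i n m => MvPowerSeries.map ι (A i n m)

section Generic

variable {R : Type*} [CommRing R] {Z Y : ℤ → ℤ → MvPowerSeries ℕ+ R}
  {A : ℕ+ → ℤ → ℤ → MvPowerSeries ℕ+ R}

theorem iterate_Dl_comp_map {R' : Type*} [CommRing R'] (ι : R →+* R') (f : Fn R) (i : ℕ) :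
    Dl^[i] (fun n => MvPowerSeries.map ι (f n)) = fun n => MvPowerSeries.map ι ((Dl^[i] f) n) := by
  induction i with
  | zero => rfl
  | succ i ih =>
    rw [Function.iterate_succ_apply', ih, Function.iterate_succ_apply']
    funext n
    simp [Dl]

theorem iterate_DlStar_comp_map {R' : Type*} [CommRing R'] (ι : R →+* R') (f : Fn R) (i : ℕ) :
    DlStar^[i] (fun n => MvPowerSeries.map ι (f n))
      = fun n => MvPowerSeries.map ι ((DlStar^[i] f) n) := by
  induction i with
  | zero => rfl
  | succ i ih =>
    rw [Function.iterate_succ_apply', ih, Function.iterate_succ_apply']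
    funext n
    simp [DlStar]

theorem MatrixDressing.map {R' : Type*} [CommRing R'] (ι : R →+* R') (h : MatrixDressing Z Y A) :
    MatrixDressing (fun n m => MvPowerSeries.map ι (Z n m)) (fun n m => MvPowerSeries.map ι (Y n m))
      (mapMat ι A) where
  lower n m hnm := by rw [h.lower n m hnm, map_zero]
  inv_lower n m hnm := by rw [h.inv_lower n m hnm, map_zero]
  mul_inv n l := by
    simp_rw [← map_mul]
    rw [← map_sum, h.mul_inv, apply_ite (MvPowerSeries.map ι), map_one, map_zero]
  upper i l m hlm := by rw [mapMat, h.upper i l m hlm, map_zero]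
  band i l m hlm := by rw [mapMat, h.band i l m hlm, map_zero]
  row_sum i n := by rw [← map_sum, h.row_sum, map_zero]
  pderiv_row i n m := by
    simp_rw [mapMat, ← map_mul]
    rw [pderiv_map, h.pderiv_row, map_sub, map_sum]
    have := iterate_DlStar_comp_map ι (Z n) i
    rw [this]
  pderiv_col i n m := by
    simp_rw [mapMat, ← map_mul]
    rw [pderiv_map, h.pderiv_col, map_sub, map_sum]
    have := iterate_Dl_comp_map ι (fun p => Y p n) i
    rw [this]

theorem map_potFlow {S S' : Type*} [CommRing S] [CommRing S'] (ι : S →+* S') (i : ℕ)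
    (A : ℤ → ℤ → S) (χ φ : ℤ → S) (n : ℤ) :
    ι (potFlow i A χ φ n) = potFlow i (fun l m => ι (A l m)) (fun l => ι (χ l))
      (fun m => ι (φ m)) n := by
  simp [potFlow]

theorem IsAdjEig.map {R' : Type*} [CommRing R'] (ι : R →+* R') {ψ : Fn R} (h : IsAdjEig A ψ) :
    IsAdjEig (mapMat ι A) (Fn.map ι ψ) := by
  intro i n
  rw [Fn.map, pderiv_map, h, map_potFlow]
  simp [potFlow, Dl, Fn.map]

/-- The flows of potentials are compatible with `Δ S = χ φ`. -/
theorem MatrixDressing.potFlow_succ_sub (h : MatrixDressing Z Y A) (i : ℕ+)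
    (χ φ : ℤ → MvPowerSeries ℕ+ R) (n : ℤ) :
    potFlow i (A i) χ φ (n + 1) - potFlow i (A i) χ φ n
      = χ n * (∑ m ∈ Icc n (n + (i : ℕ)), A i n m * φ m)
        - (∑ l ∈ Icc (n - (i : ℕ)) n, χ l * A i l n) * φ n := by
  rw [potFlow, potFlow, band_cut_succ_sub (G := fun l m => χ l * A i l m * φ m), Finset.mul_sum,
    Finset.sum_mul]
  · simp only [mul_assoc]
  · intro l m hlm
    rw [h.upper i l m hlm, mul_zero, zero_mul]
  · intro l m hlm
    rw [h.band i l m hlm, mul_zero, zero_mul]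

/-- Constants are eigenfunctions because rows of `A` sum to zero. This normalises everything later:
`w^*` is the transform of `φ = 1`. -/
theorem MatrixDressing.isEig_one (h : MatrixDressing Z Y A) : IsEig A 1 := by
  intro i n
  simp only [Pi.one_apply, mul_one, h.row_sum, MvPowerSeries.pderiv_one]

theorem Dl_one : Dl (1 : Fn R) = 0 := by
  funext n
  simp [Dl]

theorem isAdjEig_one : IsAdjEig A (1 : Fn R) := by
  intro i n
  rw [Dl_one, Pi.one_apply, MvPowerSeries.pderiv_one]
  simp [potFlow]

/-- The case `φ = 1` of the compatibility identity, in which the row sums drop out. -/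
theorem MatrixDressing.pderiv_Dl (h : MatrixDressing Z Y A) {ψ : Fn R} (hψ : IsAdjEig A ψ) (i : ℕ+)
    (n : ℤ) : MvPowerSeries.pderiv R i (Dl ψ n)
      = -∑ l ∈ Icc (n - (i : ℕ)) n, Dl ψ l * A i l n := by
  have h1 := h.potFlow_succ_sub i (Dl ψ) 1 n
  simp only [Pi.one_apply, mul_one, h.row_sum, mul_zero, zero_sub] at h1
  rw [← h1, ← hψ, ← hψ, ← map_sub]
  rfl

theorem MatrixDressing.pderiv_mul_Dl (h : MatrixDressing Z Y A) {φ ψ : Fn R} (hφ : IsEig A φ)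
    (hψ : IsAdjEig A ψ) (i : ℕ+) (n : ℤ) : MvPowerSeries.pderiv R i (φ n * Dl ψ n)
      = potFlow i (A i) (Dl ψ) φ (n + 1) - potFlow i (A i) (Dl ψ) φ n := by
  rw [Derivation.leibniz, h.pderiv_Dl hψ, hφ, h.potFlow_succ_sub]
  simp only [smul_eq_mul]
  ring

/-- The flow of `φ ψ - S`. -/
theorem MatrixDressing.pderiv_mul_sub_potFlow (h : MatrixDressing Z Y A) {φ ψ : Fn R}
    (hψ : IsAdjEig A ψ) (i : ℕ+) (n : ℤ) :
    ψ n * (∑ m ∈ Icc n (n + (i : ℕ)), A i n m * φ m) + φ n * MvPowerSeries.pderiv R i (ψ n)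
      - potFlow i (A i) (Dl ψ) φ n
      = ∑ m ∈ Icc n (n + (i : ℕ)), (ψ n * A i n m
        - ∑ l ∈ Ico (n - (i : ℕ)) n, Dl ψ l * A i l m) * (φ m - φ n) := by
  set B : ℤ → MvPowerSeries ℕ+ R := fun m => ∑ l ∈ Ico (n - (i : ℕ)) n, Dl ψ l * A i l m with hB
  -- A row `l < n` ends at `l + i < n + i`, so the column `n + i` may be added to the range at no
  -- cost.
  have e : ∀ φ : ℤ → MvPowerSeries ℕ+ R, potFlow i (A i) (Dl ψ) φ n
      = ∑ m ∈ Icc n (n + (i : ℕ)), B m * φ m := by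
    intro φ
    rw [potFlow, Finset.sum_comm, ← Finset.sum_subset Finset.Ico_subset_Icc_self]
    · exact Finset.sum_congr rfl fun m _ => (Finset.sum_mul _ _ _).symm
    · intro m hm hm'
      rw [hB]
      beta_reduce
      rw [Finset.sum_eq_zero, zero_mul]
      intro l hl
      rw [h.band i l m, mul_zero]
      simp only [mem_Icc, mem_Ico] at *
      omega
  have e1 := e 1
  simp only [Pi.one_apply, mul_one] at e1
  rw [hψ, e1, e φ]
  change _ = ∑ m ∈ Icc n (n + (i : ℕ)), (ψ n * A i n m - B m) * (φ m - φ n)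
  clear_value B
  simp only [mul_sub, sub_mul, Finset.sum_sub_distrib, Finset.mul_sum, ← Finset.sum_mul, mul_assoc]
  -- The zero row sums allow `φ m` to be replaced by `φ m - φ n`.
  have e2 : ∑ m ∈ Icc n (n + (i : ℕ)), ψ n * (A i n m * φ n) = 0 := by
    rw [← Finset.mul_sum, ← Finset.sum_mul, h.row_sum, zero_mul, mul_zero]
  rw [e2]
  have e3 : ∑ m ∈ Icc n (n + (i : ℕ)), φ n * B m = φ n * ∑ m ∈ Icc n (n + (i : ℕ)), B m :=
    (Finset.mul_sum _ _ _).symm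
  rw [e3]
  ring

end Generic

/-! ### Eigenfunctions as solutions of linear systems on half-lines -/

section Uniqueness

variable {R : Type*} [CommRing R] {A : ℕ+ → ℤ → ℤ → MvPowerSeries ℕ+ R}

/-- The linear system of eigenfunctions on `m ≥ n`. -/
theorem IsEig.system {φ : Fn R} (hφ : IsEig A φ) (n : ℤ) (i : ℕ+) (m : ℤ) :
    MvPowerSeries.pderiv R i (if n ≤ m then φ m else 0)
      = ∑ m' ∈ if n ≤ m then Icc m (m + (i : ℕ)) else ∅, A i m m' * if n ≤ m' then φ m' else 0 := by
  split_ifs with h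
  · rw [hφ]
    refine Finset.sum_congr rfl fun m' hm' => ?_
    rw [mem_Icc] at hm'
    rw [if_pos (by omega)]
  · simp

/-- The coefficients of the linear system of adjoint eigenfunctions. -/
def adjSystem (A : ℕ+ → ℤ → ℤ → MvPowerSeries ℕ+ R) (i : ℕ+) (l q : ℤ) : MvPowerSeries ℕ+ R :=
  (if l - (i : ℕ) < q then ∑ m ∈ Ico l (l + (i : ℕ)), A i (q - 1) m else 0)
    - (if q < l then ∑ m ∈ Ico l (l + (i : ℕ)), A i q m else 0)

theorem potFlow_Dl_one (ψ : Fn R) (i : ℕ+) (l : ℤ) : potFlow i (A i) (Dl ψ) 1 l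
    = ∑ q ∈ Icc (l - (i : ℕ)) l, adjSystem A i l q * ψ q := by
  have h := sum_mul_forward_diff (fun q => ∑ m ∈ Ico l (l + (i : ℕ)), A i q m) ψ
    (a := l - (i : ℕ)) (b := l) (by omega)
  rw [potFlow]
  simp only [Pi.one_apply, mul_one, ← Finset.mul_sum]
  refine Eq.trans (Finset.sum_congr rfl fun q _ => ?_) h
  rw [mul_comm]
  rfl

/-- The linear system of adjoint eigenfunctions on `l ≤ n`. -/
theorem IsAdjEig.system {ψ : Fn R} (hψ : IsAdjEig A ψ) (n : ℤ) (i : ℕ+) (l : ℤ) :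
    MvPowerSeries.pderiv R i (if l ≤ n then ψ l else 0)
      = ∑ q ∈ if l ≤ n then Icc (l - (i : ℕ)) l else ∅,
        adjSystem A i l q * if q ≤ n then ψ q else 0 := by
  split_ifs with h
  · rw [hψ, potFlow_Dl_one]
    refine Finset.sum_congr rfl fun m' hm' => ?_
    rw [mem_Icc] at hm'
    rw [if_pos (by omega)]
  · simp

variable [Algebra ℚ R]

/-- Eigenfunctions are determined by their initial values. -/
theorem IsEig.eq_of_constantCoeff_eq {φ φ' : Fn R} (hφ : IsEig A φ) (hφ' : IsEig A φ') {n : ℤ}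
    (h : ∀ m, n ≤ m → MvPowerSeries.constantCoeff (φ m) = MvPowerSeries.constantCoeff (φ' m))
    {m : ℤ} (hm : n ≤ m) : φ m = φ' m := by
  have key := eq_zero_of_linear_system
    (fun m : ℤ => (if n ≤ m then φ m else 0) - (if n ≤ m then φ' m else 0))
    (fun i m => if n ≤ m then Icc m (m + (i : ℕ)) else ∅) (fun i m m' => A i m m')
    (fun i m => by
      rw [map_sub, hφ.system, hφ'.system, ← Finset.sum_sub_distrib]
      simp only [mul_sub])
    (fun m => by
      rw [map_sub]
      split_ifs with hm
      · rw [h m hm, sub_self]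
      · simp) m
  simp only [if_pos hm] at key
  exact sub_eq_zero.mp key

/-- Adjoint eigenfunctions are determined by their initial values. -/
theorem IsAdjEig.eq_of_constantCoeff_eq {ψ ψ' : Fn R} (hψ : IsAdjEig A ψ) (hψ' : IsAdjEig A ψ')
    {n : ℤ}
    (h : ∀ l, l ≤ n → MvPowerSeries.constantCoeff (ψ l) = MvPowerSeries.constantCoeff (ψ' l))
    {l : ℤ} (hl : l ≤ n) : ψ l = ψ' l := by
  have key := eq_zero_of_linear_system
    (fun m : ℤ => (if m ≤ n then ψ m else 0) - (if m ≤ n then ψ' m else 0))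
    (fun i m => if m ≤ n then Icc (m - (i : ℕ)) m else ∅) (fun i m m' => adjSystem A i m m')
    (fun i m => by
      rw [map_sub, hψ.system, hψ'.system, ← Finset.sum_sub_distrib]
      simp only [mul_sub])
    (fun m => by
      rw [map_sub]
      split_ifs with hm
      · rw [h m hm, sub_self]
      · simp) l
  simp only [if_pos hl] at key
  exact sub_eq_zero.mp key

end Uniqueness

/-! ### Expansions of wave functions in powers of `1 + λ` -/

section Expansion

variable {F : Type*} [Field F]

/-- The series is `∑_{m ≥ M} b(m) (1+λ)^{-m-1}`. It makes sense because the summand starts at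
`λ^{-m-1}`, so the coefficient of `λ^{-(M+1+j)}` involves only `m ≤ M + j`. -/
theorem exists_coeff_zeta (b : ℤ → F) (M : ℤ) (hb : ∀ m, m < M → b m = 0) :
    ∃ x : LaurentSeries F, ∀ m, (x * zeta ^ m).coeff 1 = b m := by
  let f : PowerSeries F := PowerSeries.mk fun j : ℕ =>
    ∑ m ∈ Icc M (M + j), b m * ((zeta : LaurentSeries F) ^ (-m - 1)).coeff (M + 1 + j)
  have hs : ∀ k : ℤ, (HahnSeries.single (M + 1) (1 : F) * HahnSeries.ofPowerSeries ℤ F f).coeff k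
      = (HahnSeries.ofPowerSeries ℤ F f).coeff (k - (M + 1)) := by
    intro k
    have := HahnSeries.coeff_single_mul_add (r := (1 : F)) (x := HahnSeries.ofPowerSeries ℤ F f)
      (a := k - (M + 1)) (b := M + 1)
    rwa [sub_add_cancel, one_mul] at this
  refine ⟨HahnSeries.single (M + 1) 1 * HahnSeries.ofPowerSeries ℤ F f, fun p => ?_⟩
  set x := HahnSeries.single (M + 1) (1 : F) * HahnSeries.ofPowerSeries ℤ F f with hx
  -- The terms with `m > max M p` are `O(λ^{-p-2})`, so after multiplication by `(1+λ)^p` they have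
  -- no residue.
  have h1 : ((x - ∑ m ∈ Icc M (max M p), HahnSeries.C (b m) * zeta ^ (-m - 1)) *
      zeta ^ p).coeff 1 = 0 := by
    refine coeff_mul_eq_zero_of_lt (a := max M p + 2) (b := -p) (fun k hk => ?_)
      (zeta_zpow_lead p).1 (by omega)
    rw [HahnSeries.coeff_sub, HahnSeries.coeff_sum]
    simp only [HahnSeries.C_mul_eq_smul, HahnSeries.coeff_smul, smul_eq_mul]
    rw [hs]
    by_cases h : k < M + 1
    · rw [coeff_ofPowerSeries_of_neg _ (by omega), Finset.sum_eq_zero, sub_zero]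
      intro m hm
      rw [mem_Icc] at hm
      rw [(zeta_zpow_lead (-m - 1)).1 _ (by omega), mul_zero]
    · obtain ⟨j, rfl⟩ : ∃ j : ℕ, k = M + 1 + j := ⟨(k - (M + 1)).toNat, by omega⟩
      rw [add_sub_cancel_left, coeff_ofPowerSeries_natCast, PowerSeries.coeff_mk, sub_eq_zero]
      refine Finset.sum_subset (Finset.Icc_subset_Icc le_rfl (by omega)) fun m hm hm' => ?_
      rw [mem_Icc] at hm hm'
      rw [(zeta_zpow_lead (-m - 1)).1 _ (by omega), mul_zero]
  rw [sub_mul, HahnSeries.coeff_sub, sub_eq_zero] at h1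
  rw [h1, Finset.sum_mul, HahnSeries.coeff_sum]
  have h2 : ∀ m ∈ Icc M (max M p), (HahnSeries.C (b m) * zeta ^ (-m - 1) * zeta ^ p).coeff 1
      = if m = p then b p else 0 := by
    intro m _
    rw [mul_assoc, ← zpow_add₀ zeta_ne_zero, HahnSeries.C_mul_eq_smul, HahnSeries.coeff_smul,
      coeff_zeta_zpow_one]
    by_cases h : m = p
    · rw [if_pos (by omega), if_pos h, h, smul_eq_mul, mul_one]
    · rw [if_neg (by omega), if_neg h, smul_zero]
  rw [Finset.sum_congr rfl h2, Finset.sum_ite_eq']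
  split_ifs with h
  · rfl
  · rw [hb p (by rw [mem_Icc] at h; omega)]

/-- Since `λ = (1+λ) - 1`, multiplication by `λ` acts as `Δ` on the index of the expansion. -/
theorem resL_mul_lam_pow_mul_zeta (X : MvPowerSeries ℕ+ (LaurentSeries F)) (i : ℕ) (m : ℤ) :
    resL (X * MvPowerSeries.C (lam ^ i) * MvPowerSeries.C (zeta ^ m))
      = (Dl^[i] (fun m => resL (X * MvPowerSeries.C (zeta ^ m)))) m := by
  induction i generalizing m with
  | zero => rw [pow_zero, map_one, mul_one]; rfl
  | succ i ih =>
    rw [Function.iterate_succ_apply', Dl, ← ih, ← ih, ← map_sub]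
    congr 1
    have h : (lam : LaurentSeries F) = zeta - 1 := by rw [zeta]; ring
    rw [zpow_add_one₀ zeta_ne_zero, pow_succ]
    nth_rw 2 [h]
    simp only [map_mul, map_sub, map_one]
    ring

variable [Algebra ℚ F]

/-- The coefficients of `e^{-ξ} X` in powers of `1 + λ`. -/
def rowCoef (m : ℤ) : MvPowerSeries ℕ+ (LaurentSeries F) →+ MvPowerSeries ℕ+ F :=
  (resL (F := F)).toAddMonoidHom.comp
    (AddMonoidHom.mulRight (expXi (-1) * MvPowerSeries.C (zeta ^ (-m - 1))))

/-- The coefficients of `e^{ξ} X` in powers of `1 + λ`. -/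
def colCoef (m : ℤ) : MvPowerSeries ℕ+ (LaurentSeries F) →+ MvPowerSeries ℕ+ F :=
  (resL (F := F)).toAddMonoidHom.comp
    (AddMonoidHom.mulRight (expXi 1 * MvPowerSeries.C (zeta ^ m)))

theorem rowCoef_apply (m : ℤ) (X : MvPowerSeries ℕ+ (LaurentSeries F)) :
    rowCoef m X = resL (X * (expXi (-1) * MvPowerSeries.C (zeta ^ (-m - 1)))) := rfl

theorem colCoef_apply (m : ℤ) (X : MvPowerSeries ℕ+ (LaurentSeries F)) :
    colCoef m X = resL (X * (expXi 1 * MvPowerSeries.C (zeta ^ m))) := rfl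

theorem rowCoef_map_C_mul (m : ℤ) (f : MvPowerSeries ℕ+ F)
    (X : MvPowerSeries ℕ+ (LaurentSeries F)) :
    rowCoef m (MvPowerSeries.map HahnSeries.C f * X) = f * rowCoef m X := by
  rw [rowCoef_apply, mul_assoc]
  exact mapLin_map_C_mul _ _ _

theorem colCoef_map_C_mul (m : ℤ) (f : MvPowerSeries ℕ+ F)
    (X : MvPowerSeries ℕ+ (LaurentSeries F)) :
    colCoef m (MvPowerSeries.map HahnSeries.C f * X) = f * colCoef m X := by
  rw [colCoef_apply, mul_assoc]
  exact mapLin_map_C_mul _ _ _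

theorem expXi_neg_mul_expXi : expXi (R := F) (-1) * expXi 1 = 1 := by
  rw [mul_comm]
  exact expXi_mul_expXi_neg 1

theorem eq_of_rowCoef {X X' : MvPowerSeries ℕ+ (LaurentSeries F)}
    (h : ∀ m, rowCoef m X = rowCoef m X') : X = X' := by
  have h1 : X * expXi (-1) = X' * expXi (-1) := by
    refine eq_of_resL_zeta fun m => ?_
    have := h (-m - 1)
    rw [rowCoef_apply, rowCoef_apply, ← mul_assoc, ← mul_assoc] at this
    rwa [show -(-m - 1) - 1 = m by ring] at this
  calc X = X * expXi (-1) * expXi 1 := by rw [mul_assoc, expXi_neg_mul_expXi, mul_one]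
    _ = X' := by rw [h1, mul_assoc, expXi_neg_mul_expXi, mul_one]

theorem eq_of_colCoef {X X' : MvPowerSeries ℕ+ (LaurentSeries F)}
    (h : ∀ m, colCoef m X = colCoef m X') : X = X' := by
  have h1 : X * expXi 1 = X' * expXi 1 := by
    refine eq_of_resL_zeta fun m => ?_
    have := h m
    rwa [colCoef_apply, colCoef_apply, ← mul_assoc, ← mul_assoc] at this
  calc X = X * expXi 1 * expXi (-1) := by
        rw [mul_assoc, mul_comm (expXi 1), expXi_neg_mul_expXi, mul_one]
    _ = X' := by rw [h1, mul_assoc, mul_comm (expXi 1), expXi_neg_mul_expXi, mul_one]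

theorem exists_colCoef (b : ℤ → MvPowerSeries ℕ+ F) (M : ℤ) (hb : ∀ m, m < M → b m = 0) :
    ∃ X : MvPowerSeries ℕ+ (LaurentSeries F), ∀ m, colCoef m X = b m := by
  choose x hx using fun d : ℕ+ →₀ ℕ => exists_coeff_zeta (fun m => MvPowerSeries.coeff d (b m)) M
    (fun m hm => by rw [hb m hm, map_zero])
  let X : MvPowerSeries ℕ+ (LaurentSeries F) := x
  refine ⟨X * expXi (-1), fun m => ?_⟩
  rw [colCoef_apply, mul_assoc, ← mul_assoc (expXi (-1)), expXi_neg_mul_expXi, one_mul]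
  ext d
  rw [coeff_resL, MvPowerSeries.coeff_mul_C]
  exact hx d m

theorem exists_rowCoef (a : ℤ → MvPowerSeries ℕ+ F) (N : ℤ) (ha : ∀ m, N < m → a m = 0) :
    ∃ X : MvPowerSeries ℕ+ (LaurentSeries F), ∀ m, rowCoef m X = a m := by
  obtain ⟨X, hX⟩ := exists_colCoef (fun m => a (-m - 1)) (-N - 1) (fun m hm => ha _ (by omega))
  -- `X` is built for `colCoef`, which multiplies by `e^ξ`, whereas `rowCoef` multiplies by
  -- `e^{-ξ}`; the factor `e^{2ξ}` makes up the difference.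
  refine ⟨X * expXi 1 * expXi 1, fun m => ?_⟩
  have h := hX (-m - 1)
  rw [show -(-m - 1) - 1 = m by ring] at h
  rw [← h, colCoef_apply, rowCoef_apply]
  congr 1
  linear_combination (X * expXi 1 * MvPowerSeries.C (zeta ^ (-m - 1))) * expXi_neg_mul_expXi (F := F)

/-- The correction is the derivative of `e^ξ`, that is a factor `λ^i`, which becomes `Δ^i` on the
index. -/
theorem colCoef_pderiv (i : ℕ+) (m : ℤ) (X : MvPowerSeries ℕ+ (LaurentSeries F)) :
    colCoef m (MvPowerSeries.pderiv _ i X) = MvPowerSeries.pderiv F i (colCoef m X)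
      - (Dl^[(i : ℕ)] (fun p => colCoef p X)) m := by
  have h := resL_mul_lam_pow_mul_zeta (X * expXi 1) i m
  have h2 : (fun m => resL (X * expXi 1 * MvPowerSeries.C (zeta ^ m))) = fun p => colCoef p X := by
    funext p
    rw [colCoef_apply, mul_assoc]
  rw [h2] at h
  rw [← h, colCoef_apply, colCoef_apply, resL, ← mapLin_pderiv, ← map_sub]
  congr 1
  rw [Derivation.leibniz, Derivation.leibniz, pderiv_expXi, MvPowerSeries.pderiv_C, one_smul]
  simp only [smul_eq_mul]
  ring

theorem iterate_DlStar_reflect {R : Type*} [CommRing R] (a : Fn R) (i : ℕ) (m c : ℤ) :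
    (DlStar^[i] a) (c - m) = (Dl^[i] (fun p => a (c - p))) m := by
  induction i generalizing m with
  | zero => rfl
  | succ i ih =>
    rw [Function.iterate_succ_apply', Function.iterate_succ_apply', Dl, DlStar, ← ih, ← ih,
      show c - (m + 1) = c - m - 1 by ring]

/-- Here the expansion is indexed through `(1+λ)^{-m-1}`; the reflection `m ↦ -m-1` turns `Δ` into
`Δ^*`, and the sign comes from `e^{-ξ}`. -/
theorem rowCoef_pderiv (i : ℕ+) (m : ℤ) (X : MvPowerSeries ℕ+ (LaurentSeries F)) :
    rowCoef m (MvPowerSeries.pderiv _ i X) = MvPowerSeries.pderiv F i (rowCoef m X)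
      + (DlStar^[(i : ℕ)] (fun p => rowCoef p X)) m := by
  have h := resL_mul_lam_pow_mul_zeta (X * expXi (-1)) i (-m - 1)
  have h2 : (fun m => resL (X * expXi (-1) * MvPowerSeries.C (zeta ^ m)))
      = fun p => rowCoef (-1 - p) X := by
    funext p
    rw [rowCoef_apply, mul_assoc, show -(-1 - p) - 1 = p by ring]
  rw [h2, ← iterate_DlStar_reflect (fun p => rowCoef p X), show -1 - (-m - 1) = m by ring] at h
  rw [← h, rowCoef_apply, rowCoef_apply, resL, ← mapLin_pderiv, ← map_add]
  congr 1
  rw [Derivation.leibniz, Derivation.leibniz, pderiv_expXi, MvPowerSeries.pderiv_C, neg_smul,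
    one_smul, map_neg]
  simp only [smul_eq_mul]
  ring

/-- The exponentials `e^{-ξ}` and `e^{ξ}` cancel, so the dual expansions in powers of `1+λ` can be
paired; the vanishing assumptions make the pairing finite. -/
theorem resL_mul_eq_sum {X X' : MvPowerSeries ℕ+ (LaurentSeries F)} {M N : ℤ}
    (ha : ∀ m, N < m → rowCoef m X = 0) (hb : ∀ m, m < M → colCoef m X' = 0) :
    resL (X * X') = ∑ m ∈ Icc M N, rowCoef m X * colCoef m X' := by
  have h : X * X' = (X * expXi (-1)) * (X' * expXi 1) := by
    linear_combination -(X * X') * expXi_neg_mul_expXi (F := F)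
  rw [h]
  refine resL_mul (fun m => ?_) (fun m => ?_) ha hb
  · rw [rowCoef_apply, mul_assoc]
  · rw [colCoef_apply, mul_assoc]

/-- The order in `λ` of `e^{-ξ} X`. -/
theorem coeff_eq_zero_of_rowCoef {X : MvPowerSeries ℕ+ (LaurentSeries F)} {n : ℤ} (N : ℤ)
    (h : ∀ m, n < m → rowCoef m X = 0) (d : ℕ+ →₀ ℕ) {k : ℤ} (hk : k < -N - n) :
    (MvPowerSeries.coeff d (X * expXi (-1) * MvPowerSeries.C (zeta ^ N))).coeff k = 0 := by
  refine coeff_eq_zero_of_res_zeta (M := n + N + 1) (fun m hm => ?_) k (by omega)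
  have h1 := congrArg (MvPowerSeries.coeff d) (h (m - N) (by omega))
  rw [rowCoef_apply, coeff_resL, ← mul_assoc, MvPowerSeries.coeff_mul_C, map_zero] at h1
  rw [MvPowerSeries.coeff_mul_C, mul_assoc, ← zpow_add₀ zeta_ne_zero,
    show N + (-m - 1) = -(m - N) - 1 by ring]
  exact h1

/-- The order in `λ` of `e^{ξ} X`. -/
theorem coeff_eq_zero_of_colCoef {X : MvPowerSeries ℕ+ (LaurentSeries F)} {n : ℤ} (N : ℤ)
    (h : ∀ m, m < n → colCoef m X = 0) (d : ℕ+ →₀ ℕ) {k : ℤ} (hk : k < n + 1 - N) :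
    (MvPowerSeries.coeff d (X * expXi 1 * MvPowerSeries.C (zeta ^ N))).coeff k = 0 := by
  refine coeff_eq_zero_of_res_zeta (M := N - n) (fun m hm => ?_) k (by omega)
  have h1 := congrArg (MvPowerSeries.coeff d) (h (N - m - 1) (by omega))
  rw [colCoef_apply, coeff_resL, ← mul_assoc, MvPowerSeries.coeff_mul_C, map_zero] at h1
  rw [MvPowerSeries.coeff_mul_C, mul_assoc, ← zpow_add₀ zeta_ne_zero,
    show N + (-m - 1) = N - m - 1 by ring]
  exact h1

end Expansion

/-! ### Wave functions and potentials, in terms of matrices -/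

section Iterate

variable {R : Type*} [CommRing R]

theorem iterate_Dl_congr {f g : Fn R} (i : ℕ) {m : ℤ}
    (h : ∀ p, m ≤ p → p ≤ m + i → f p = g p) : (Dl^[i] f) m = (Dl^[i] g) m := by
  induction i generalizing m with
  | zero => exact h m le_rfl (by simp)
  | succ i ih =>
    rw [Function.iterate_succ_apply', Function.iterate_succ_apply', Dl, Dl,
      ih fun p h1 h2 => h p (by omega) (by push_cast; omega),
      ih fun p h1 h2 => h p (by omega) (by push_cast; omega)]

theorem iterate_DlStar_congr {f g : Fn R} (i : ℕ) {m : ℤ}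
    (h : ∀ p, p ≤ m → m - i ≤ p → f p = g p) : (DlStar^[i] f) m = (DlStar^[i] g) m := by
  induction i generalizing m with
  | zero => exact h m le_rfl (by simp)
  | succ i ih =>
    rw [Function.iterate_succ_apply', Function.iterate_succ_apply', DlStar, DlStar,
      ih fun p h1 h2 => h p (by omega) (by push_cast; omega),
      ih fun p h1 h2 => h p (by omega) (by push_cast; omega)]

theorem iterate_Dl_sum {ι : Type*} (s : Finset ι) (f : ι → Fn R) (c : ι → MvPowerSeries ℕ+ R)
    (i : ℕ) (m : ℤ) : (Dl^[i] (fun p => ∑ l ∈ s, f l p * c l)) m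
      = ∑ l ∈ s, (Dl^[i] (f l)) m * c l := by
  induction i generalizing m with
  | zero => rfl
  | succ i ih =>
    simp only [Function.iterate_succ_apply', Dl, ih, ← Finset.sum_sub_distrib, sub_mul]

theorem iterate_DlStar_sum {ι : Type*} (s : Finset ι) (f : ι → Fn R) (c : ι → MvPowerSeries ℕ+ R)
    (i : ℕ) (m : ℤ) : (DlStar^[i] (fun p => ∑ l ∈ s, c l * f l p)) m
      = ∑ l ∈ s, c l * (DlStar^[i] (f l)) m := by
  induction i generalizing m with
  | zero => rfl
  | succ i ih =>
    simp only [Function.iterate_succ_apply', DlStar, ih, ← Finset.sum_sub_distrib, mul_sub]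

end Iterate

section Waves

variable {F : Type*} [Field F] [Algebra ℚ F] {Z Y : ℤ → ℤ → MvPowerSeries ℕ+ F}
  {A : ℕ+ → ℤ → ℤ → MvPowerSeries ℕ+ F}

/-- The wave function of a dressing matrix. -/
def IsWave (Z : ℤ → ℤ → MvPowerSeries ℕ+ F) (w : Fn (LaurentSeries F)) : Prop :=
  ∀ n m, rowCoef m (w n) = Z n m

/-- The potential of `φ` and of the adjoint wave function; for `φ = 1` this is the adjoint wave
function. -/
def IsEigTransform (Y : ℤ → ℤ → MvPowerSeries ℕ+ F) (φ : Fn F) (σ : Fn (LaurentSeries F)) : Prop :=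
  ∀ n m, colCoef m (σ n) = ∑ l ∈ Icc n m, Y m l * φ l

/-- The potential of the wave function and of `ψ`. -/
def IsAdjTransform (Z : ℤ → ℤ → MvPowerSeries ℕ+ F) (ψ : Fn F) (s : Fn (LaurentSeries F)) : Prop :=
  ∀ n m, rowCoef m (s n) = ∑ l ∈ Ico m n, Dl ψ l * Z l m

/-- The row equation `∂_i Z = A_i Z - Z Δ^i`, in which differentiating `e^ξ` cancels the last term.
-/
theorem IsWave.isEig {w : Fn (LaurentSeries F)} (hw : IsWave Z w) (h : MatrixDressing Z Y A) :
    IsEig (mapMat HahnSeries.C A) w := by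
  intro i n
  refine eq_of_rowCoef fun m => ?_
  simp only [map_sum, mapMat, rowCoef_map_C_mul]
  rw [rowCoef_pderiv]
  simp only [hw n, hw _ m]
  rw [h.pderiv_row]
  exact sub_add_cancel _ _

theorem IsEigTransform.colCoef_Dl {φ : Fn F} {σ : Fn (LaurentSeries F)}
    (hσ : IsEigTransform Y φ σ) (h : MatrixDressing Z Y A) (n m : ℤ) :
    colCoef m (Dl σ n) = -(Y m n * φ n) := by
  rw [Dl, map_sub, hσ, hσ]
  by_cases hn : n ≤ m
  · rw [← Finset.insert_Icc_add_one_left_eq_Icc hn, Finset.sum_insert (by simp)]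
    ring
  · rw [Finset.Icc_eq_empty hn, Finset.Icc_eq_empty (by omega), h.inv_lower m n (by omega)]
    simp

theorem IsEigTransform.Dl_eq {φ : Fn F} {σ wst : Fn (LaurentSeries F)} (hσ : IsEigTransform Y φ σ)
    (hwst : IsEigTransform Y 1 wst) (h : MatrixDressing Z Y A) :
    Dl σ = Fn.map HahnSeries.C φ * Dl wst := by
  funext n
  refine eq_of_colCoef fun m => ?_
  rw [Pi.mul_apply, Fn.map, colCoef_map_C_mul, hσ.colCoef_Dl h, hwst.colCoef_Dl h, Pi.one_apply]
  ring

/-- In `∂_i ∑ Y φ` the term `Δ^i Y` cancels against the derivative of `e^{-ξ}`. There remains `Y (A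
φ) - (Y A) φ`, summed over `l ≥ n`, and `band_cut_right` evaluates it as minus the sum over the
rectangle `l < n ≤ m`. The sign matches because `Δw^*` has coefficients `-Y`. -/
theorem IsEigTransform.pderiv_eq {φ : Fn F} {σ wst : Fn (LaurentSeries F)}
    (hσ : IsEigTransform Y φ σ) (hwst : IsEigTransform Y 1 wst) (h : MatrixDressing Z Y A)
    (hφ : IsEig A φ) (i : ℕ+) (n : ℤ) : MvPowerSeries.pderiv _ i (σ n)
      = potFlow i (mapMat HahnSeries.C A i) (Dl wst) (Fn.map HahnSeries.C φ) n := by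
  refine eq_of_colCoef fun m => ?_
  -- Triangularity of `Y` allows one summation range for all indices that `Δ^i` touches, so that
  -- `Δ^i` passes through the sum.
  have hp : ∀ p, p ≤ m + (i : ℕ) →
      colCoef p (σ n) = ∑ l ∈ Icc n (m + (i : ℕ)), Y p l * φ l := by
    intro p hp
    rw [hσ]
    refine Finset.sum_subset (Finset.Icc_subset_Icc le_rfl hp) fun l hl hl' => ?_
    rw [h.inv_lower p l, zero_mul]
    simp only [mem_Icc] at *
    omega
  rw [colCoef_pderiv, hp m (by simp), iterate_Dl_congr _ fun p _ h2 => hp p h2,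
    iterate_Dl_sum (Icc n (m + (i : ℕ))) (fun l p => Y p l) φ, map_sum, ← Finset.sum_sub_distrib]
  have hc := band_cut_right (G := fun l m' => Y m l * A i l m' * φ m') (i := i)
    (P := m + (i : ℕ)) (n := n)
    (fun l m' hl => by rw [h.upper i l m' hl, mul_zero, zero_mul])
    (fun l m' hl => by rw [h.band i l m' hl, mul_zero, zero_mul])
    (fun l m' hl => by rw [h.inv_lower m l (by omega), zero_mul, zero_mul])
  have h1 : colCoef m (potFlow i (mapMat HahnSeries.C A i) (Dl wst) (Fn.map HahnSeries.C φ) n)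
      = -∑ l ∈ Ico (n - (i : ℕ)) n, ∑ m' ∈ Ico n (n + (i : ℕ)), Y m l * A i l m' * φ m' := by
    simp only [potFlow, map_sum, ← Finset.sum_neg_distrib]
    refine Finset.sum_congr rfl fun l _ => Finset.sum_congr rfl fun m' _ => ?_
    rw [mapMat, Fn.map, show Dl wst l * MvPowerSeries.map HahnSeries.C (A i l m')
      * MvPowerSeries.map HahnSeries.C (φ m') = MvPowerSeries.map HahnSeries.C (A i l m')
      * (MvPowerSeries.map HahnSeries.C (φ m') * Dl wst l) by ring, colCoef_map_C_mul,
      colCoef_map_C_mul, hwst.colCoef_Dl h, Pi.one_apply]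
    ring
  rw [h1, ← hc, neg_sub, ← Finset.sum_sub_distrib]
  refine Finset.sum_congr rfl fun l _ => ?_
  rw [Derivation.leibniz, h.pderiv_col, hφ, smul_eq_mul, smul_eq_mul, Finset.mul_sum,
    ← Finset.sum_mul]
  simp only [mul_assoc]
  ring

/-- With `φ = 1` the adjoint wave function is its own potential, and the flow of the potential is
then the adjoint eigenfunction equation. -/
theorem IsEigTransform.isAdjEig {wst : Fn (LaurentSeries F)} (hwst : IsEigTransform Y 1 wst)
    (h : MatrixDressing Z Y A) : IsAdjEig (mapMat HahnSeries.C A) wst := by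
  intro i n
  rw [hwst.pderiv_eq hwst h h.isEig_one]
  congr 1
  funext n
  simp [Fn.map]

theorem IsAdjTransform.Dl_eq {ψ : Fn F} {w s : Fn (LaurentSeries F)} (hs : IsAdjTransform Z ψ s)
    (hw : IsWave Z w) (h : MatrixDressing Z Y A) :
    Dl s = w * Dl (Fn.map HahnSeries.C ψ) := by
  funext n
  refine eq_of_rowCoef fun m => ?_
  have h1 : Dl (Fn.map (HahnSeries.C : F →+* LaurentSeries F) ψ) n
      = MvPowerSeries.map HahnSeries.C (Dl ψ n) := by
    simp [Dl, Fn.map]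
  rw [Pi.mul_apply, h1, mul_comm, rowCoef_map_C_mul, hw, Dl, map_sub, hs, hs]
  by_cases hn : m ≤ n
  · rw [← Finset.insert_Ico_right_eq_Ico_add_one hn, Finset.sum_insert (by simp)]
    ring
  · rw [Finset.Ico_eq_empty (by omega), Finset.Ico_eq_empty (by omega), h.lower n m (by omega)]
    simp

/-- Dual to the previous computation: `Z Δ^i` cancels against the derivative of `e^ξ`, and the sums
over `l < n`, finite to the left because `Z` is triangular, leave the rectangle by `band_cut_left`.
-/
theorem IsAdjTransform.pderiv_eq {ψ : Fn F} {w s : Fn (LaurentSeries F)}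
    (hs : IsAdjTransform Z ψ s) (hw : IsWave Z w) (h : MatrixDressing Z Y A)
    (hψ : IsAdjEig A ψ) (i : ℕ+) (n : ℤ) : MvPowerSeries.pderiv _ i (s n)
      = potFlow i (mapMat HahnSeries.C A i) (Dl (Fn.map HahnSeries.C ψ)) w n := by
  refine eq_of_rowCoef fun m => ?_
  have hp : ∀ p, m - (i : ℕ) ≤ p →
      rowCoef p (s n) = ∑ l ∈ Ico (m - (i : ℕ)) n, Dl ψ l * Z l p := by
    intro p hp
    rw [hs]
    refine Finset.sum_subset (Finset.Ico_subset_Ico hp le_rfl) fun l hl hl' => ?_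
    rw [h.lower l p, mul_zero]
    simp only [mem_Ico] at *
    omega
  rw [rowCoef_pderiv, hp m (by simp), iterate_DlStar_congr _ fun p _ h2 => hp p h2,
    iterate_DlStar_sum (Ico (m - (i : ℕ)) n) (fun l p => Z l p) (Dl ψ), map_sum,
    ← Finset.sum_add_distrib]
  have hc := band_cut_left (G := fun l m' => Dl ψ l * A i l m' * Z m' m) (i := i)
    (M := m - (i : ℕ)) (n := n)
    (fun l m' hl => by rw [h.upper i l m' hl, mul_zero, zero_mul])
    (fun l m' hl => by rw [h.band i l m' hl, mul_zero, zero_mul])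
    (fun l m' hl => by
      by_cases hm : m' < m
      · rw [h.lower m' m hm, mul_zero]
      · rw [h.band i l m' (by omega), mul_zero, zero_mul])
  have h1 : rowCoef m (potFlow i (mapMat HahnSeries.C A i) (Dl (Fn.map HahnSeries.C ψ)) w n)
      = ∑ l ∈ Ico (n - (i : ℕ)) n, ∑ m' ∈ Ico n (n + (i : ℕ)), Dl ψ l * A i l m' * Z m' m := by
    simp only [potFlow, map_sum]
    refine Finset.sum_congr rfl fun l _ => Finset.sum_congr rfl fun m' _ => ?_
    rw [mapMat, Dl, Fn.map, Fn.map, ← map_sub, mul_assoc, rowCoef_map_C_mul, rowCoef_map_C_mul, hw]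
    exact (mul_assoc _ _ _).symm
  rw [h1, ← hc, ← Finset.sum_sub_distrib]
  refine Finset.sum_congr rfl fun l _ => ?_
  rw [Derivation.leibniz, h.pderiv_Dl hψ, h.pderiv_row, smul_eq_mul, smul_eq_mul,
    ← Finset.sum_mul]
  simp only [mul_assoc, ← Finset.mul_sum]
  ring

/-! #### Pairings -/

omit [Algebra ℚ F] in
-- After exchanging the sums, `ZY = 1` leaves the diagonal term, provided that `m` is in the range.
theorem MatrixDressing.sum_mul_transform (h : MatrixDressing Z Y A) (φ : Fn F) (n m : ℤ) :
    ∑ p ∈ Icc n m, Z m p * ∑ l ∈ Icc n p, Y p l * φ l = if n ≤ m then φ m else 0 := by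
  have h1 : ∑ p ∈ Icc n m, Z m p * ∑ l ∈ Icc n p, Y p l * φ l
      = ∑ l ∈ Icc n m, (∑ p ∈ Icc l m, Z m p * Y p l) * φ l := by
    simp only [Finset.mul_sum, Finset.sum_mul]
    rw [Finset.sum_comm' (t' := Icc n m) (s' := fun l => Icc l m)]
    · exact Finset.sum_congr rfl fun l _ => Finset.sum_congr rfl fun p _ => (mul_assoc _ _ _).symm
    · intro p l
      simp only [mem_Icc]
      omega
  rw [h1]
  simp only [h.mul_inv, ite_mul, one_mul, zero_mul, Finset.sum_ite_eq, mem_Icc, le_refl, and_true]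

theorem IsEigTransform.colCoef_eq_zero {φ : Fn F} {σ : Fn (LaurentSeries F)}
    (hσ : IsEigTransform Y φ σ) {n m : ℤ} (hm : m < n) : colCoef m (σ n) = 0 := by
  rw [hσ, Finset.Icc_eq_empty (by omega), Finset.sum_empty]

theorem IsWave.rowCoef_eq_zero {w : Fn (LaurentSeries F)} (hw : IsWave Z w)
    (h : MatrixDressing Z Y A) {n m : ℤ} (hm : n < m) : rowCoef m (w n) = 0 := by
  rw [hw, h.lower n m hm]

/-- The spectral representation of `φ`: all eigenfunctions are superpositions of the wave function,
and on `m ≥ n` the density is `σ(n)`, the same for all `m`. -/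
theorem IsWave.resL_mul {φ : Fn F} {w σ : Fn (LaurentSeries F)} (hw : IsWave Z w)
    (hσ : IsEigTransform Y φ σ) (h : MatrixDressing Z Y A) (n m : ℤ) :
    resL (w m * σ n) = if n ≤ m then φ m else 0 := by
  rw [resL_mul_eq_sum (fun _ => hw.rowCoef_eq_zero h) fun _ => hσ.colCoef_eq_zero,
    ← h.sum_mul_transform]
  simp only [hw m, hσ n]

theorem IsAdjTransform.resL_mul {φ ψ : Fn F} {s σ : Fn (LaurentSeries F)}
    (hs : IsAdjTransform Z ψ s) (hσ : IsEigTransform Y φ σ) (h : MatrixDressing Z Y A) (l n : ℤ) :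
    resL (s n * σ l) = ∑ q ∈ Ico l n, Dl ψ q * φ q := by
  rw [resL_mul_eq_sum (N := n - 1) (fun m hm => by
    rw [hs, Finset.Ico_eq_empty (by omega), Finset.sum_empty]) fun _ => hσ.colCoef_eq_zero]
  simp only [hs n, hσ l, Finset.sum_mul]
  rw [Finset.sum_comm' (t' := Ico l n) (s' := fun q => Icc l q)]
  · refine Finset.sum_congr rfl fun q hq => ?_
    rw [mem_Ico] at hq
    have := h.sum_mul_transform φ l q
    rw [if_pos hq.1] at this
    rw [← this, Finset.mul_sum]
    exact Finset.sum_congr rfl fun p _ => mul_assoc _ _ _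
  · intro p l
    simp only [mem_Icc, mem_Ico]
    omega

/-- The complementary potential `ψ w - s`. -/
def hatTransform (w : Fn (LaurentSeries F)) (ψ : Fn F) (s : Fn (LaurentSeries F)) :
    Fn (LaurentSeries F) :=
  fun n => MvPowerSeries.map HahnSeries.C (ψ n) * w n - s n

theorem IsAdjTransform.rowCoef_hat_eq_zero {ψ : Fn F} {w s : Fn (LaurentSeries F)}
    (hs : IsAdjTransform Z ψ s) (hw : IsWave Z w) (h : MatrixDressing Z Y A) {n m : ℤ}
    (hm : n < m) : rowCoef m (hatTransform w ψ s n) = 0 := by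
  rw [hatTransform, map_sub, rowCoef_map_C_mul, hw.rowCoef_eq_zero h hm, hs,
    Finset.Ico_eq_empty (by omega), Finset.sum_empty, mul_zero, sub_zero]

theorem IsAdjTransform.resL_hat_mul {φ ψ : Fn F} {w s σ : Fn (LaurentSeries F)}
    (hs : IsAdjTransform Z ψ s) (hw : IsWave Z w) (hσ : IsEigTransform Y φ σ)
    (h : MatrixDressing Z Y A) {l n : ℤ} (hl : l ≤ n) :
    resL (hatTransform w ψ s n * σ l) = ψ n * φ n - ∑ q ∈ Ico l n, Dl ψ q * φ q := by
  rw [hatTransform, sub_mul, map_sub, hs.resL_mul hσ h, mul_assoc]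
  congr 1
  refine (mapLin_map_C_mul _ _ _).trans ?_
  have := hw.resL_mul hσ h l n
  rw [if_pos hl] at this
  rw [← this]
  rfl

omit [Algebra ℚ F] in
theorem sum_Ico_Dl (ψ : Fn F) {l n : ℤ} (hl : l ≤ n) : ∑ q ∈ Ico l n, Dl ψ q = ψ n - ψ l := by
  induction n, hl using Int.leInduction with
  | base => simp
  | succ n hl ih =>
    rw [← Finset.insert_Ico_right_eq_Ico_add_one hl, Finset.sum_insert (by simp), ih, Dl]
    ring

/-- For `φ = 1` the sum telescopes, which gives the dual representation of `ψ` on `l ≤ n`. -/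
theorem IsAdjTransform.resL_hat_mul_adjWave {ψ : Fn F} {w s wst : Fn (LaurentSeries F)}
    (hs : IsAdjTransform Z ψ s) (hw : IsWave Z w) (hwst : IsEigTransform Y 1 wst)
    (h : MatrixDressing Z Y A) {l n : ℤ} (hl : l ≤ n) :
    resL (hatTransform w ψ s n * wst l) = ψ l := by
  rw [hs.resL_hat_mul hw hwst h hl]
  simp only [Pi.one_apply, mul_one, sum_Ico_Dl ψ hl]
  ring

/-! #### Closed forms -/

theorem schur_one_of_ne_zero (ε : ℚ) {j : ℕ} (hj : j ≠ 0) :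
    schur ε j (1 : MvPowerSeries ℕ+ F) = 0 := by
  obtain ⟨j, rfl⟩ := Nat.exists_eq_succ_of_ne_zero hj
  refine rat_smul_cancel j ?_
  rw [Nat.succ_eq_add_one, schur_succ, Finset.sum_eq_zero, smul_zero, smul_zero]
  intro p _
  rw [MvPowerSeries.pderiv_one, map_zero]

theorem shift_one (ε : ℚ) : shift ε (1 : MvPowerSeries ℕ+ F) = 1 := by
  classical
  ext1 d
  have h : (PowerSeries.mk fun j => MvPowerSeries.coeff d (schur ε j (1 : MvPowerSeries ℕ+ F)))
      = PowerSeries.C (MvPowerSeries.coeff d (1 : MvPowerSeries ℕ+ F)) := by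
    ext j
    rw [PowerSeries.coeff_mk, PowerSeries.coeff_C]
    split_ifs with hj
    · rw [hj, schur_zero]
    · rw [schur_one_of_ne_zero ε hj, map_zero]
  rw [coeff_shift, h, HahnSeries.ofPowerSeries_C, MvPowerSeries.coeff_one, MvPowerSeries.coeff_one,
    apply_ite HahnSeries.C, map_one, map_zero]

omit [Algebra ℚ F] in
theorem C_single_mul_cancel {X X' : MvPowerSeries ℕ+ (LaurentSeries F)}
    (h : MvPowerSeries.C (HahnSeries.single 1 1) * X
      = MvPowerSeries.C (HahnSeries.single 1 1) * X') : X = X' := by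
  have h1 : (MvPowerSeries.C (HahnSeries.single (-1) 1) : MvPowerSeries ℕ+ (LaurentSeries F))
      * MvPowerSeries.C (HahnSeries.single 1 1) = 1 := by
    rw [← map_mul, HahnSeries.single_mul_single]
    simp
  calc X = MvPowerSeries.C (HahnSeries.single (-1) 1)
        * (MvPowerSeries.C (HahnSeries.single 1 1) * X) := by rw [← mul_assoc, h1, one_mul]
    _ = X' := by rw [h, ← mul_assoc, h1, one_mul]

/-- The potential of `φ` and of the adjoint wave function is `φ(n, t + [λ⁻¹]) w^*(n, t, λ)`. -/
theorem IsEigTransform.eq_shift_mul {φ : Fn F} {w σ wst : Fn (LaurentSeries F)}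
    (hσ : IsEigTransform Y φ σ) (hwst : IsEigTransform Y 1 wst) (hw : IsWave Z w)
    (h : MatrixDressing Z Y A) (hφ : IsEig A φ) (n : ℤ) : σ n = shift 1 (φ n) * wst n := by
  -- The eigenfunction system closes up on `m ≥ n`, so both families are cut off there. The exponent
  -- `-n` makes `e^{-ξ} w(n) (1+λ)^{-n}` of degree at most `0`, and the dual factor `O(λ⁻¹)`.
  obtain ⟨Θ, hΘ⟩ := exists_shift_eq_mul (ε := 1) (by norm_num)
    (a := fun m => if n ≤ m then w m else 0)
    (s := fun i m => if n ≤ m then Icc m (m + (i : ℕ)) else ∅) (c := fun i m m' => A i m m')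
    (fun i m => (hw.isEig h).system n i m) n (-n) (fun d k hk => by
      rw [if_pos le_rfl]
      exact coeff_eq_zero_of_rowCoef (n := n) (-n) (fun m => hw.rowCoef_eq_zero h) d (by omega))
  have key : ∀ (φ : Fn F) (σ : Fn (LaurentSeries F)), IsEig A φ → IsEigTransform Y φ σ →
      MvPowerSeries.C (HahnSeries.single 1 1) * shift 1 (φ n)
        = Θ * (σ n * expXi 1 * MvPowerSeries.C (zeta ^ (-(-n)))) := by
    intro φ σ hφ hσ
    have := hΘ (fun m => if n ≤ m then φ m else 0) (σ n) (fun i m => hφ.system n i m)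
      (fun m => by
        have := hw.resL_mul hσ h n m
        by_cases hm : n ≤ m
        · rw [if_pos hm] at this ⊢
          rw [this, if_pos hm]
        · rw [if_neg hm, if_neg hm, zero_mul, map_zero])
      (fun d k hk => coeff_eq_zero_of_colCoef (n := n) (-(-n)) (fun m => hσ.colCoef_eq_zero) d
        (by omega))
    rwa [if_pos le_rfl] at this
  have h1 := key φ σ hφ hσ
  -- For `φ = 1` the shift is trivial and `σ = w^*`, which identifies `λ⁻¹` with `Θ` times the
  -- factor of `w^*`.
  have h2 := key 1 wst h.isEig_one hwst
  rw [Pi.one_apply, shift_one, mul_one] at h2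
  refine C_single_mul_cancel ?_
  rw [← mul_assoc, h1, h2]
  ring

theorem adjSystem_map {R R' : Type*} [CommRing R] [CommRing R'] (ι : R →+* R')
    (A : ℕ+ → ℤ → ℤ → MvPowerSeries ℕ+ R) (i : ℕ+) (l q : ℤ) :
    adjSystem (mapMat ι A) i l q = MvPowerSeries.map ι (adjSystem A i l q) := by
  simp only [adjSystem, mapMat, map_sub, apply_ite (MvPowerSeries.map ι), map_sum, map_zero]

/-- The potential complementary to that of the wave function and of `ψ` is
`w(n, t, λ) ψ(n, t - [λ⁻¹])`. -/
theorem IsAdjTransform.eq_mul_shift {ψ : Fn F} {w s wst : Fn (LaurentSeries F)}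
    (hs : IsAdjTransform Z ψ s) (hwst : IsEigTransform Y 1 wst) (hw : IsWave Z w)
    (h : MatrixDressing Z Y A) (hψ : IsAdjEig A ψ) (n : ℤ) :
    hatTransform w ψ s n = w n * shift (-1) (ψ n) := by
  -- Now `w^*(l)`, `l ≤ n`, is the spectral family and the complementary potential is the density.
  -- As `e^{ξ} w^*(n)` starts at `λ^{-n-1}`, the normalising exponent is `n + 1`.
  obtain ⟨Θ, hΘ⟩ := exists_shift_eq_mul (ε := -1) (by norm_num)
    (a := fun l => if l ≤ n then wst l else 0)
    (s := fun i l => if l ≤ n then Icc (l - (i : ℕ)) l else ∅) (c := fun i l q => adjSystem A i l q)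
    (fun i l => by
      have := (hwst.isAdjEig h).system n i l
      simp only [adjSystem_map] at this
      exact this) n (n + 1) (fun d k hk => by
      rw [if_pos le_rfl, neg_neg]
      exact coeff_eq_zero_of_colCoef (n := n) (n + 1) (fun m => hwst.colCoef_eq_zero) d (by omega))
  have key : ∀ (ψ : Fn F) (s : Fn (LaurentSeries F)), IsAdjEig A ψ → IsAdjTransform Z ψ s →
      MvPowerSeries.C (HahnSeries.single 1 1) * shift (-1) (ψ n)
        = Θ * (hatTransform w ψ s n * expXi (-1) * MvPowerSeries.C (zeta ^ (-(n + 1)))) := by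
    intro ψ s hψ hs
    have := hΘ (fun m => if m ≤ n then ψ m else 0) (hatTransform w ψ s n)
      (fun i m => hψ.system n i m)
      (fun m => by
        by_cases hm : m ≤ n
        · have := hs.resL_hat_mul_adjWave hw hwst h hm
          rw [if_pos hm, if_pos hm, mul_comm, this]
        · rw [if_neg hm, if_neg hm, zero_mul, map_zero])
      (fun d k hk => coeff_eq_zero_of_rowCoef (n := n) (-(n + 1))
        (fun m => hs.rowCoef_hat_eq_zero hw h) d (by omega))
    rwa [if_pos le_rfl] at this
  -- For `ψ = 1` the transform is `0` and the complementary potential is `w` itself; this eliminates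
  -- `Θ`.
  have hs0 : IsAdjTransform Z 1 (0 : Fn (LaurentSeries F)) := by
    intro n m
    rw [Dl_one, Pi.zero_apply, map_zero]
    simp
  have h1 := key ψ s hψ hs
  have h2 := key 1 0 isAdjEig_one hs0
  rw [Pi.one_apply, shift_one, mul_one, show hatTransform w 1 0 n = w n by
    simp [hatTransform]] at h2
  refine C_single_mul_cancel ?_
  rw [mul_left_comm, h1, h2]
  ring

end Waves

/-! ### Residues at two sets of times -/

section TwoTimes

variable {F : Type*} [Field F] {Z Y : ℤ → ℤ → MvPowerSeries ℕ+ F}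
  {A : ℕ+ → ℤ → ℤ → MvPowerSeries ℕ+ F}

/-- The functional `y ↦ res (x y)`. -/
def resMul (x : LaurentSeries F) : LaurentSeries F →ₗ[F] F where
  toFun y := (x * y).coeff 1
  map_add' y y' := by rw [mul_add, HahnSeries.coeff_add]
  map_smul' r y := by
    rw [← HahnSeries.C_mul_eq_smul, mul_left_comm, HahnSeries.C_mul_eq_smul, HahnSeries.coeff_smul,
      RingHom.id_apply]

theorem coeff_mapLin_resMul (x : LaurentSeries F) (X : MvPowerSeries ℕ+ (LaurentSeries F))
    (d : ℕ+ →₀ ℕ) : MvPowerSeries.coeff d (mapLin (resMul x) X)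
      = (x * MvPowerSeries.coeff d X).coeff 1 := rfl

/-- The coefficients of the system do not involve `λ`, so a linear functional in `λ` maps solutions
to solutions. -/
theorem IsEig.mapLin_comp {w : Fn (LaurentSeries F)} (hw : IsEig (mapMat HahnSeries.C A) w)
    (ℓ : LaurentSeries F →ₗ[F] F) : IsEig A (fun n => mapLin ℓ (w n)) := by
  intro i n
  rw [← mapLin_pderiv, hw, map_sum]
  exact Finset.sum_congr rfl fun m _ => mapLin_map_C_mul _ _ _

theorem mapLin_potFlow_left (ℓ : LaurentSeries F →ₗ[F] F) (i : ℕ) (A : ℤ → ℤ → MvPowerSeries ℕ+ F)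
    (χ : Fn (LaurentSeries F)) (φ : Fn F) (n : ℤ) :
    mapLin ℓ (potFlow i (fun l m => MvPowerSeries.map HahnSeries.C (A l m)) χ
      (Fn.map HahnSeries.C φ) n) = potFlow i A (fun l => mapLin ℓ (χ l)) φ n := by
  simp only [potFlow, map_sum]
  refine Finset.sum_congr rfl fun l _ => Finset.sum_congr rfl fun m _ => ?_
  rw [Fn.map, mul_assoc, mul_comm, ← map_mul, mapLin_map_C_mul]
  ring

theorem mapLin_Dl (ℓ : LaurentSeries F →ₗ[F] F) (f : Fn (LaurentSeries F)) :
    (fun l => mapLin ℓ (Dl f l)) = Dl (fun l => mapLin ℓ (f l)) := by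
  funext l
  rw [Dl, map_sub]
  rfl

theorem IsAdjEig.mapLin_comp {w : Fn (LaurentSeries F)} (hw : IsAdjEig (mapMat HahnSeries.C A) w)
    (ℓ : LaurentSeries F →ₗ[F] F) : IsAdjEig A (fun n => mapLin ℓ (w n)) := by
  intro i n
  have h1 : (1 : ℤ → MvPowerSeries ℕ+ (LaurentSeries F))
      = Fn.map (HahnSeries.C : F →+* LaurentSeries F) 1 := by
    funext n
    exact (map_one _).symm
  rw [← mapLin_pderiv, hw i n, h1, mapLin_potFlow_left, mapLin_Dl]

theorem potFlow_congr {S : Type*} [CommRing S] (i : ℕ) (A : ℤ → ℤ → S) {χ χ' φ φ' : ℤ → S} {n : ℤ}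
    (hχ : ∀ l < n, χ l = χ' l) (hφ : ∀ m, n ≤ m → φ m = φ' m) :
    potFlow i A χ φ n = potFlow i A χ' φ' n := by
  refine Finset.sum_congr rfl fun l hl => Finset.sum_congr rfl fun m hm => ?_
  rw [mem_Ico] at hl hm
  rw [hχ l hl.2, hφ m hm.1]

variable [Algebra ℚ F]

theorem eq_of_pderiv_eq {X X' : MvPowerSeries ℕ+ F}
    (h : ∀ i, MvPowerSeries.pderiv F i X = MvPowerSeries.pderiv F i X')
    (h0 : MvPowerSeries.constantCoeff X = MvPowerSeries.constantCoeff X') : X = X' := by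
  have := isAddTorsionFree_of_rat F
  exact MvPowerSeries.pderiv.ext h h0

omit [Algebra ℚ F] in
theorem coeff_C_eq_ite (d : ℕ+ →₀ ℕ) (x : F) :
    MvPowerSeries.coeff d (MvPowerSeries.C x) = if d = 0 then x else 0 := by
  classical
  exact MvPowerSeries.coeff_C d x

/-- With `w(m)` frozen at `t = 0`, the residue against `w^*(l, t)` is an adjoint eigenfunction equal
to `1` at `t = 0` for `l ≤ m`; by uniqueness it stays `1`. -/
theorem IsWave.mapLin_adjWave {w wst : Fn (LaurentSeries F)} (hw : IsWave Z w)
    (hwst : IsEigTransform Y 1 wst) (h : MatrixDressing Z Y A) {l m : ℤ} (hl : l ≤ m) :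
    mapLin (resMul (MvPowerSeries.constantCoeff (w m))) (wst l) = 1 := by
  refine ((hwst.isAdjEig h).mapLin_comp _).eq_of_constantCoeff_eq isAdjEig_one (n := m)
    (fun l hl => ?_) hl
  have h1 := congrArg MvPowerSeries.constantCoeff (hw.resL_mul hwst h l m)
  rw [if_pos hl, Pi.one_apply] at h1
  rw [Pi.one_apply, ← h1, ← MvPowerSeries.coeff_zero_eq_constantCoeff_apply, coeff_mapLin_resMul,
    ← MvPowerSeries.coeff_zero_eq_constantCoeff_apply (resL _), coeff_resL]
  simp

/-- A functional that sends `w^*` to `ψ` sends the potential with `w^*` to a function with the flow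
of the potential with `ψ`. Only `l ≤ n` is needed, since the flow sees `Δψ` at `l < n` only. -/
theorem IsEigTransform.pderiv_mapLin {φ : Fn F} {σ wst : Fn (LaurentSeries F)}
    (hσ : IsEigTransform Y φ σ) (hwst : IsEigTransform Y 1 wst) (h : MatrixDressing Z Y A)
    (hφ : IsEig A φ) (ℓ : LaurentSeries F →ₗ[F] F) {ψ : Fn F} {n : ℤ}
    (hℓ : ∀ l ≤ n, mapLin ℓ (wst l) = ψ l) (i : ℕ+) :
    MvPowerSeries.pderiv F i (mapLin ℓ (σ n)) = potFlow i (A i) (Dl ψ) φ n := by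
  rw [← mapLin_pderiv, hσ.pderiv_eq hwst h hφ, mapLin_potFlow_left, mapLin_Dl]
  refine potFlow_congr _ _ (fun l hl => ?_) fun _ _ => rfl
  rw [Dl, Dl, hℓ l hl.le, hℓ (l + 1) (by omega)]

/-- The residue of `σ(n, t') w(m, t)` is `φ(m, t)` for `m ≥ n`. -/
theorem IsEigTransform.res_mul_wave {φ : Fn F} {σ w wst : Fn (LaurentSeries F)}
    (hσ : IsEigTransform Y φ σ) (hw : IsWave Z w) (hwst : IsEigTransform Y 1 wst)
    (h : MatrixDressing Z Y A) (hφ : IsEig A φ) {n m : ℤ} (hn : n ≤ m) (d' : ℕ+ →₀ ℕ) :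
    mapLin (resMul (MvPowerSeries.coeff d' (σ n))) (w m) = if d' = 0 then φ m else 0 := by
  -- With `t = 0` in the wave function, the dependence on `t'` has the flow of a potential with `ψ =
  -- 1`, hence is constant.
  have h1 : ∀ m, n ≤ m → mapLin (resMul (MvPowerSeries.constantCoeff (w m))) (σ n)
      = MvPowerSeries.C (MvPowerSeries.constantCoeff (φ m)) := by
    intro m hn
    refine eq_of_pderiv_eq (fun i => ?_) ?_
    · rw [hσ.pderiv_mapLin hwst h hφ _ (ψ := 1)
        fun l hl => hw.mapLin_adjWave hwst h (hl.trans hn), MvPowerSeries.pderiv_C, Dl_one]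
      simp [potFlow]
    · have h1 := congrArg MvPowerSeries.constantCoeff (hw.resL_mul hσ h n m)
      rw [if_pos hn] at h1
      rw [MvPowerSeries.constantCoeff_C, ← h1, ← MvPowerSeries.coeff_zero_eq_constantCoeff_apply,
        coeff_mapLin_resMul, ← MvPowerSeries.coeff_zero_eq_constantCoeff_apply (resL _), coeff_resL]
      simp
  -- For a fixed coefficient in `t'`, both sides are eigenfunctions in `t`, and `h1` provides equal
  -- initial values for `m ≥ n`.
  have h2 : IsEig A (fun m => if d' = 0 then φ m else 0) := by
    by_cases hd : d' = 0
    · simpa only [if_pos hd] using hφ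
    · intro i n
      simp [hd]
  refine ((hw.isEig h).mapLin_comp _).eq_of_constantCoeff_eq h2 (n := n) (fun m hm => ?_) hn
  have h3 := congrArg (MvPowerSeries.coeff d') (h1 m hm)
  rw [coeff_mapLin_resMul, coeff_C_eq_ite, mul_comm] at h3
  rw [← MvPowerSeries.coeff_zero_eq_constantCoeff_apply, coeff_mapLin_resMul,
    MvPowerSeries.coeff_zero_eq_constantCoeff_apply, h3, apply_ite MvPowerSeries.constantCoeff,
    map_zero]

/-- The flow of the complementary potential involves `w(m)` for `m ≥ n` only, through the
differences `w(m) - w(n)`; those are the indices at which the functional is known. -/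
theorem IsAdjTransform.pderiv_mapLin_hat {φ ψ : Fn F} {w s : Fn (LaurentSeries F)}
    (hs : IsAdjTransform Z ψ s) (hw : IsWave Z w) (h : MatrixDressing Z Y A)
    (hψ : IsAdjEig A ψ) (ℓ : LaurentSeries F →ₗ[F] F) {n : ℤ}
    (hℓ : ∀ m, n ≤ m → mapLin ℓ (w m) = φ m) (i : ℕ+) :
    MvPowerSeries.pderiv F i (mapLin ℓ (hatTransform w ψ s n))
      = ∑ m ∈ Icc n (n + (i : ℕ)), (ψ n * A i n m
        - ∑ l ∈ Ico (n - (i : ℕ)) n, Dl ψ l * A i l m) * (φ m - φ n) := by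
  have hm := h.map (HahnSeries.C : F →+* LaurentSeries F)
  have hψ' := hψ.map (HahnSeries.C : F →+* LaurentSeries F)
  have h1 := hm.pderiv_mul_sub_potFlow (φ := w) hψ' i n
  have h3 : ∀ m, ((Fn.map HahnSeries.C ψ n) * MvPowerSeries.map HahnSeries.C (A i n m)
        - ∑ l ∈ Ico (n - (i : ℕ)) n, Dl (Fn.map HahnSeries.C ψ) l
          * MvPowerSeries.map (HahnSeries.C : F →+* LaurentSeries F) (A i l m))
      = MvPowerSeries.map HahnSeries.C (ψ n * A i n m
        - ∑ l ∈ Ico (n - (i : ℕ)) n, Dl ψ l * A i l m) := by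
    intro m
    simp only [Fn.map, Dl, map_sub, map_mul, map_sum]
  simp only [h3] at h1
  have h2 : MvPowerSeries.pderiv _ i (hatTransform w ψ s n)
      = ∑ m ∈ Icc n (n + (i : ℕ)), MvPowerSeries.map HahnSeries.C (ψ n * A i n m
        - ∑ l ∈ Ico (n - (i : ℕ)) n, Dl ψ l * A i l m) * (w m - w n) := by
    rw [hatTransform, map_sub, Derivation.leibniz, hs.pderiv_eq hw h hψ, hw.isEig h i n,
      smul_eq_mul, smul_eq_mul]
    exact h1
  rw [← mapLin_pderiv, h2, map_sum]
  refine Finset.sum_congr rfl fun m hm => ?_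
  rw [mem_Icc] at hm
  rw [mapLin_map_C_mul, map_sub, hℓ m hm.1, hℓ n le_rfl]

/-- The residue of `w(n, t') ψ(n, t' - [λ⁻¹]) w^*(l, t)` is `ψ(l, t)` for `l ≤ n`. -/
theorem IsAdjTransform.res_mul_adjWave {ψ : Fn F} {s w wst : Fn (LaurentSeries F)}
    (hs : IsAdjTransform Z ψ s) (hw : IsWave Z w) (hwst : IsEigTransform Y 1 wst)
    (h : MatrixDressing Z Y A) (hψ : IsAdjEig A ψ) {n l : ℤ} (hl : l ≤ n) (d' : ℕ+ →₀ ℕ) :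
    mapLin (resMul (MvPowerSeries.coeff d' (hatTransform w ψ s n))) (wst l)
      = if d' = 0 then ψ l else 0 := by
  -- Pairing with `w^*(l)` at time `0` sends `w(m)` to `1` for `m ≥ n`, so all the differences in
  -- the flow vanish.
  have h1 : ∀ l ≤ n, mapLin (resMul (MvPowerSeries.constantCoeff (wst l))) (hatTransform w ψ s n)
      = MvPowerSeries.C (MvPowerSeries.constantCoeff (ψ l)) := by
    intro l hl
    refine eq_of_pderiv_eq (fun i => ?_) ?_
    · rw [hs.pderiv_mapLin_hat hw h hψ _ (φ := 1) fun m hm => by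
        have := hwst.res_mul_wave hw hwst h h.isEig_one (hl.trans hm) 0
        rwa [if_pos rfl] at this, MvPowerSeries.pderiv_C]
      simp
    · have h1 := congrArg MvPowerSeries.constantCoeff (hs.resL_hat_mul_adjWave hw hwst h hl)
      rw [MvPowerSeries.constantCoeff_C, ← h1, ← MvPowerSeries.coeff_zero_eq_constantCoeff_apply,
        coeff_mapLin_resMul, ← MvPowerSeries.coeff_zero_eq_constantCoeff_apply (resL _), coeff_resL,
        mul_comm]
      simp
  have h2 : IsAdjEig A (fun m => if d' = 0 then ψ m else 0) := by
    by_cases hd : d' = 0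
    · simpa only [if_pos hd] using hψ
    · intro i n
      simp [hd, potFlow, Dl]
  refine ((hwst.isAdjEig h).mapLin_comp _).eq_of_constantCoeff_eq h2 (n := n) (fun m hm => ?_) hl
  have h3 := congrArg (MvPowerSeries.coeff d') (h1 m hm)
  rw [coeff_mapLin_resMul, coeff_C_eq_ite, mul_comm] at h3
  rw [← MvPowerSeries.coeff_zero_eq_constantCoeff_apply, coeff_mapLin_resMul,
    MvPowerSeries.coeff_zero_eq_constantCoeff_apply, h3, apply_ite MvPowerSeries.constantCoeff,
    map_zero]

/-- The residue of `σ(n, t) h(n, t')` is `S(n, t) + Ŝ(n, t')`. -/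
theorem IsEigTransform.res_mul_hat {φ ψ : Fn F} {σ s w wst : Fn (LaurentSeries F)}
    (hσ : IsEigTransform Y φ σ) (hs : IsAdjTransform Z ψ s) (hw : IsWave Z w)
    (hwst : IsEigTransform Y 1 wst) (h : MatrixDressing Z Y A) (hφ : IsEig A φ)
    (hψ : IsAdjEig A ψ) {n : ℤ} {S : MvPowerSeries ℕ+ F}
    (hS : ∀ i : ℕ+, MvPowerSeries.pderiv F i S = potFlow i (A i) (Dl ψ) φ n) (d d' : ℕ+ →₀ ℕ) :
    (MvPowerSeries.coeff d (σ n) * MvPowerSeries.coeff d' (hatTransform w ψ s n)).coeff 1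
      = (if d' = 0 then MvPowerSeries.coeff d S else 0)
        + (if d = 0 then MvPowerSeries.coeff d' (φ n * ψ n - S) else 0) := by
  -- Freezing `σ` at time `0` leaves a function of `t'` with the flow and the initial value of `φ ψ
  -- - S`, up to the constant `S(n, 0)`.
  have h1 : mapLin (resMul (MvPowerSeries.constantCoeff (σ n))) (hatTransform w ψ s n)
      = φ n * ψ n - S + MvPowerSeries.C (MvPowerSeries.constantCoeff S) := by
    refine eq_of_pderiv_eq (fun i => ?_) ?_
    · rw [hs.pderiv_mapLin_hat hw h hψ _ (φ := φ) fun m hm => by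
        have := hσ.res_mul_wave hw hwst h hφ hm 0
        rwa [if_pos rfl] at this, ← h.pderiv_mul_sub_potFlow hψ, map_add, map_sub,
        MvPowerSeries.pderiv_C, Derivation.leibniz, hS, hφ, smul_eq_mul, smul_eq_mul]
      ring
    · have h1 := congrArg MvPowerSeries.constantCoeff (hs.resL_hat_mul hw hσ h (le_refl n))
      rw [Finset.Ico_self, Finset.sum_empty, sub_zero] at h1
      rw [map_add, map_sub, MvPowerSeries.constantCoeff_C, sub_add_cancel, mul_comm (φ n), ← h1,
        ← MvPowerSeries.coeff_zero_eq_constantCoeff_apply,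
        coeff_mapLin_resMul, ← MvPowerSeries.coeff_zero_eq_constantCoeff_apply (resL _), coeff_resL,
        mul_comm]
      simp
  -- Now `t` varies with the power of `t'` fixed: the flow is that of `S` when `d' = 0` and zero
  -- otherwise, and the initial values are supplied by `h1`.
  have h2 : mapLin (resMul (MvPowerSeries.coeff d' (hatTransform w ψ s n))) (σ n)
      = (if d' = 0 then S else 0)
        + MvPowerSeries.C (MvPowerSeries.coeff d' (φ n * ψ n - S)) := by
    refine eq_of_pderiv_eq (fun i => ?_) ?_
    · rw [hσ.pderiv_mapLin hwst h hφ _ (ψ := fun l => if d' = 0 then ψ l else 0)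
        fun l hl => hs.res_mul_adjWave hw hwst h hψ hl d', map_add, MvPowerSeries.pderiv_C,
        add_zero]
      by_cases hd : d' = 0
      · simp only [if_pos hd]
        exact (hS i).symm
      · simp [hd, potFlow, Dl]
    · have h3 := congrArg (MvPowerSeries.coeff d') h1
      rw [coeff_mapLin_resMul, map_add, coeff_C_eq_ite, mul_comm, add_comm] at h3
      rw [← MvPowerSeries.coeff_zero_eq_constantCoeff_apply, coeff_mapLin_resMul,
        MvPowerSeries.coeff_zero_eq_constantCoeff_apply, h3, map_add,
        MvPowerSeries.constantCoeff_C, apply_ite MvPowerSeries.constantCoeff, map_zero]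
  have h4 := congrArg (MvPowerSeries.coeff d) h2
  rw [coeff_mapLin_resMul, map_add, coeff_C_eq_ite, mul_comm,
    apply_ite (MvPowerSeries.coeff d), map_zero] at h4
  exact h4

/-- Potentials exist. -/
theorem MatrixDressing.exists_potential (h : MatrixDressing Z Y A) {φ ψ : Fn F}
    {σ s w wst : Fn (LaurentSeries F)}
    (hσ : IsEigTransform Y φ σ) (hs : IsAdjTransform Z ψ s) (hw : IsWave Z w)
    (hwst : IsEigTransform Y 1 wst) (hφ : IsEig A φ) (hψ : IsAdjEig A ψ) :
    ∃ S : Fn F, Dl S = φ * Dl ψ ∧ ∀ (i : ℕ+) (n : ℤ),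
      MvPowerSeries.pderiv F i (S n) = potFlow i (A i) (Dl ψ) φ n := by
  -- Pairing `σ(n, t)` with the complementary potential at time `0` gives the right flow for each
  -- `n` separately, since that pairing sends `w^*(l)` to `ψ(l)` for `l ≤ n`.
  set P : Fn F := fun n =>
    mapLin (resMul (MvPowerSeries.constantCoeff (hatTransform w ψ s n))) (σ n) with hP
  have hPd : ∀ (i : ℕ+) (n : ℤ),
      MvPowerSeries.pderiv F i (P n) = potFlow i (A i) (Dl ψ) φ n := by
    intro i n
    refine hσ.pderiv_mapLin hwst h hφ _ (fun l hl => ?_) i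
    have := hs.res_mul_adjWave hw hwst h hψ hl 0
    rwa [if_pos rfl] at this
  clear_value P
  set g : ℤ → F := fun n => MvPowerSeries.constantCoeff (φ n * Dl ψ n) with hg
  -- A discrete antiderivative of `g`, with opposite signs on the two sides of `0`. It serves as the
  -- values of `S` at time `0`, while the flows propagate `ΔS = φ Δψ` to all times.
  set c : ℤ → F := fun n => ∑ q ∈ Ico 0 n, g q - ∑ q ∈ Ico n 0, g q with hc
  have hcs : ∀ n, c (n + 1) - c n = g n := by
    intro n
    rw [hc]
    beta_reduce
    rcases le_or_gt 0 n with hn | hn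
    · rw [← Finset.insert_Ico_right_eq_Ico_add_one hn, Finset.sum_insert (by simp),
        Finset.Ico_eq_empty (a := n) (by omega), Finset.Ico_eq_empty (a := n + 1) (by omega)]
      simp
    · rw [← Finset.insert_Ico_add_one_left_eq_Ico hn, Finset.sum_insert (by simp),
        Finset.Ico_eq_empty (b := n) (by omega), Finset.Ico_eq_empty (b := n + 1) (by omega)]
      simp
  refine ⟨fun n => P n - MvPowerSeries.C (MvPowerSeries.constantCoeff (P n))
    + MvPowerSeries.C (c n), ?_, fun i n => ?_⟩
  · funext n
    refine eq_of_pderiv_eq (fun i => ?_) ?_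
    · rw [Pi.mul_apply, h.pderiv_mul_Dl hφ hψ, Dl]
      simp only [map_add, map_sub, MvPowerSeries.pderiv_C, hPd]
      ring
    · have := hcs n
      rw [Pi.mul_apply, Dl]
      simp only [map_add, map_sub, MvPowerSeries.constantCoeff_C, sub_self, zero_add]
      rw [this]
  · rw [map_add, map_sub, MvPowerSeries.pderiv_C, MvPowerSeries.pderiv_C, hPd]
    ring

end TwoTimes

/-! ### Powers of the difference operator in terms of powers of the shift -/

/-- The coefficient of `Γ^j` in the expansion of `(Γ - 1)^k` in powers of `Γ⁻¹`. -/
def shiftCoef (k j : ℤ) : ℤ :=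
  if j ≤ k then (-1) ^ (k - j).toNat * Ring.choose k (k - j).toNat else 0

theorem shiftCoef_of_lt {k j : ℤ} (h : k < j) : shiftCoef k j = 0 := if_neg (not_le.mpr h)

theorem shiftCoef_self (k : ℤ) : shiftCoef k k = 1 := by
  simp [shiftCoef]

/-- Pascal's rule, from `(Γ-1)^{k+1} = (Γ-1)^k Γ - (Γ-1)^k`, for all integers `k`. -/
theorem shiftCoef_succ (k j : ℤ) :
    shiftCoef (k + 1) j = shiftCoef k (j - 1) - shiftCoef k j := by
  rcases lt_trichotomy j (k + 1) with h | h | h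
  · obtain ⟨r, rfl⟩ : ∃ r : ℕ, j = k - r := ⟨(k - j).toNat, by omega⟩
    rw [shiftCoef, shiftCoef, shiftCoef, if_pos (by omega), if_pos (by omega), if_pos (by omega),
      show (k + 1 - (k - r)).toNat = r + 1 by omega, show (k - (k - r - 1)).toNat = r + 1 by omega,
      show (k - (k - r)).toNat = r by omega, Ring.choose_succ_succ]
    ring
  · rw [h, shiftCoef_self, add_sub_cancel_right, shiftCoef_self, shiftCoef_of_lt (by omega), sub_zero]
  · rw [shiftCoef_of_lt h, shiftCoef_of_lt (by omega), shiftCoef_of_lt (by omega), sub_zero]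

theorem shiftCoef_natCast_of_neg (k : ℕ) {j : ℤ} (h : j < 0) : shiftCoef k j = 0 := by
  rw [shiftCoef, if_pos (by omega), Ring.choose_natCast, Nat.choose_eq_zero_of_lt (by omega)]
  simp

theorem shiftCoef_zero_left (j : ℤ) : shiftCoef 0 j = if j = 0 then 1 else 0 := by
  rcases lt_trichotomy j 0 with h | h | h
  · rw [if_neg (by omega)]
    exact_mod_cast shiftCoef_natCast_of_neg 0 h
  · rw [if_pos h, h, shiftCoef_self]
  · rw [if_neg (by omega), shiftCoef_of_lt h]

/-- The expansion `(Γ-1)⁻¹ = Γ⁻¹ + Γ⁻² + ⋯`. -/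
theorem shiftCoef_neg_one {j : ℤ} (h : j ≤ -1) : shiftCoef (-1) j = 1 := by
  induction j, h using Int.leInductionDown with
  | base => exact shiftCoef_self _
  | pred j h ih =>
    have h1 := shiftCoef_succ (-1) j
    rw [neg_add_cancel, shiftCoef_zero_left, if_neg (by omega), ih] at h1
    omega

/-- Solutions of `X_{k+1} = Δ X_k` that vanish for `n → -∞` are determined by `X_0`. -/
theorem eq_zero_of_pascal {M : Type*} [AddCommGroup M] {X : ℤ → ℤ → M} {T : ℤ}
    (hX : ∀ k n, k + n + 1 < T → X (k + 1) n = X k (n + 1) - X k n) (h0 : ∀ n < T, X 0 n = 0)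
    (hB : ∀ k, ∃ B, ∀ n < B, X k n = 0) {k n : ℤ} (h : k + n < T) : X k n = 0 := by
  induction k using Int.induction_on generalizing n with
  | zero => exact h0 n (by omega)
  | succ k ih => rw [hX _ _ (by omega), ih (by omega), ih (by omega), sub_zero]
  -- Downwards in `k` the recursion gives only a difference in `n`; the value is propagated from the
  -- far left, where `X` vanishes.
  | pred k ih =>
    obtain ⟨B, hB⟩ := hB (-(k : ℤ) - 1)
    by_cases hn : n < B
    · exact hB n hn
    · rw [not_lt] at hn
      obtain ⟨r, rfl⟩ : ∃ r : ℕ, n = B - 1 + r := ⟨(n - (B - 1)).toNat, by omega⟩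
      clear hn
      induction r with
      | zero => exact hB _ (by push_cast; omega)
      | succ r ihr =>
        have h1 := hX (-(k : ℤ) - 1) (B - 1 + r) (by push_cast at h; omega)
        rw [sub_add_cancel, ih (by push_cast at h; omega), ihr (by push_cast at h; omega),
          sub_zero] at h1
        rw [h1]
        congr 1
        push_cast
        ring

section Leibniz

variable {R : Type*} [CommRing R]

/-- The left-hand side of the Leibniz rule satisfies `X_{k+1} = Δ X_k`: the term with `Δ^{i+1} g`
joins the next one by Pascal's rule, and the bound on `I` removes the leftover at the end. -/
theorem sum_zsmul_shiftCoef_succ (g : Fn R) (p j k n : ℤ) {I : ℕ} (h : k + n + 1 + p - j < I) :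
    ∑ i ∈ range I, (Ring.choose (k + 1) i * shiftCoef (k + 1 + p - i) (j - n)) •
        (Dl^[i] g) (n + (k + 1) - i)
      = ∑ i ∈ range I, (Ring.choose k i * shiftCoef (k + p - i) (j - (n + 1))) •
          (Dl^[i] g) (n + 1 + k - i)
        - ∑ i ∈ range I, (Ring.choose k i * shiftCoef (k + p - i) (j - n)) •
          (Dl^[i] g) (n + k - i) := by
  have h1 : ∀ i : ℕ, (Ring.choose k i * shiftCoef (k + p - i) (j - (n + 1))) •
      (Dl^[i] g) (n + 1 + k - i) - (Ring.choose k i * shiftCoef (k + p - i) (j - n)) •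
      (Dl^[i] g) (n + k - i) = (Ring.choose k i * shiftCoef (k + 1 + p - i) (j - n)) •
      (Dl^[i] g) (n + (k + 1) - i) + (Ring.choose k i * shiftCoef (k + p - i) (j - n)) •
      (Dl^[i + 1] g) (n + k - i) := by
    intro i
    have e := shiftCoef_succ (k + p - i) (j - n)
    rw [show k + p - i + 1 = k + 1 + p - i by ring, show j - n - 1 = j - (n + 1) by ring] at e
    rw [Function.iterate_succ_apply', Dl, show n + k - (i : ℤ) + 1 = n + (k + 1) - i by ring,
      show n + 1 + k - (i : ℤ) = n + (k + 1) - i by ring, smul_sub, e, mul_sub, sub_smul]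
    abel
  rw [← Finset.sum_sub_distrib, Finset.sum_congr rfl fun i _ => h1 i, Finset.sum_add_distrib]
  cases I with
  | zero => simp
  | succ I =>
    have h2 : ∀ i : ℕ, (Ring.choose (k + 1) (i + 1) * shiftCoef (k + 1 + p - (i + 1 : ℕ)) (j - n)) •
        (Dl^[i + 1] g) (n + (k + 1) - (i + 1 : ℕ))
        = (Ring.choose k (i + 1) * shiftCoef (k + 1 + p - (i + 1 : ℕ)) (j - n)) •
        (Dl^[i + 1] g) (n + (k + 1) - (i + 1 : ℕ))
        + (Ring.choose k i * shiftCoef (k + p - i) (j - n)) • (Dl^[i + 1] g) (n + k - i) := by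
      intro i
      rw [Ring.choose_succ_succ, show k + 1 + p - ((i + 1 : ℕ) : ℤ) = k + p - i by push_cast; ring,
        show n + (k + 1) - ((i + 1 : ℕ) : ℤ) = n + k - i by push_cast; ring, add_mul, add_smul]
      abel
    rw [Finset.sum_range_succ' _ I, Finset.sum_range_succ' _ I, Finset.sum_range_succ _ I,
      Finset.sum_congr rfl fun i _ => h2 i, Finset.sum_add_distrib,
      shiftCoef_of_lt (k := k + p - I) (by push_cast at h; omega), Ring.choose_zero_right,
      Ring.choose_zero_right]
    simp only [mul_zero, zero_smul, add_zero]
    abel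

theorem sum_shiftCoef_mul_succ (g : Fn R) (p j k n : ℤ) :
    ∑ l ∈ Icc (j - p) (n + (k + 1)), (shiftCoef (k + 1) (l - n) * shiftCoef p (j - l)) • g l
      = ∑ l ∈ Icc (j - p) (n + 1 + k), (shiftCoef k (l - (n + 1)) * shiftCoef p (j - l)) • g l
        - ∑ l ∈ Icc (j - p) (n + k), (shiftCoef k (l - n) * shiftCoef p (j - l)) • g l := by
  have h1 : ∑ l ∈ Icc (j - p) (n + k), (shiftCoef k (l - n) * shiftCoef p (j - l)) • g l
      = ∑ l ∈ Icc (j - p) (n + (k + 1)), (shiftCoef k (l - n) * shiftCoef p (j - l)) • g l := by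
    refine Finset.sum_subset (Finset.Icc_subset_Icc le_rfl (by omega)) fun l hl hl' => ?_
    rw [mem_Icc] at hl hl'
    rw [shiftCoef_of_lt (k := k) (by omega), zero_mul, zero_smul]
  rw [h1, show n + 1 + k = n + (k + 1) by ring, ← Finset.sum_sub_distrib]
  refine Finset.sum_congr rfl fun l _ => ?_
  rw [← sub_smul, ← sub_mul, shiftCoef_succ, show l - n - 1 = l - (n + 1) by ring]

/-- The Leibniz rule. -/
theorem leibniz_shiftCoef (g : Fn R) (p j k n : ℤ) {I : ℕ} (h : k + n + p - j < I) :
    ∑ i ∈ range I, (Ring.choose k i * shiftCoef (k + p - i) (j - n)) • (Dl^[i] g) (n + k - i)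
      = ∑ l ∈ Icc (j - p) (n + k), (shiftCoef k (l - n) * shiftCoef p (j - l)) • g l := by
  rw [← sub_eq_zero]
  -- Both sides solve the recursion in `k`, agree for `k = 0`, where only `i = 0` counts, and vanish
  -- far to the left. The threshold `T` marks where cutting the sum at `I` loses nothing.
  refine eq_zero_of_pascal (T := I + j - p) (X := fun k n =>
    ∑ i ∈ range I, (Ring.choose k i * shiftCoef (k + p - i) (j - n)) • (Dl^[i] g) (n + k - i)
      - ∑ l ∈ Icc (j - p) (n + k), (shiftCoef k (l - n) * shiftCoef p (j - l)) • g l)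
    (fun k n hkn => ?_) (fun n hn => ?_) (fun k => ⟨j - p - k, fun n hn => ?_⟩) (by omega)
  · rw [sum_zsmul_shiftCoef_succ g p j k n (by omega), sum_shiftCoef_mul_succ]
    abel
  · rw [sub_eq_zero]
    have hl : ∑ i ∈ range I, (Ring.choose (0 : ℤ) i * shiftCoef (0 + p - i) (j - n)) •
        (Dl^[i] g) (n + 0 - i) = shiftCoef p (j - n) • g n := by
      cases I with
      | zero =>
        rw [shiftCoef_of_lt (k := p) (by push_cast at hn; omega)]
        simp
      | succ I =>
        rw [Finset.sum_range_succ', Finset.sum_eq_zero]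
        · simp
        · intro i _
          rw [Ring.choose_zero_succ, zero_mul, zero_smul]
    rw [hl]
    simp only [shiftCoef_zero_left, sub_eq_zero, ite_mul, one_mul, zero_mul, ite_smul, zero_smul,
      Finset.sum_ite_eq', mem_Icc, add_zero, le_refl, and_true]
    split_ifs with hjn
    · rfl
    · rw [shiftCoef_of_lt (k := p) (by omega), zero_smul]
  · rw [Finset.Icc_eq_empty (by omega), Finset.sum_empty, sub_zero]
    refine Finset.sum_eq_zero fun i _ => ?_
    rw [shiftCoef_of_lt (k := k + p - i) (by omega), mul_zero, zero_smul]

/-- The Leibniz rule for adjoints. -/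
theorem leibniz_adjoint_shiftCoef (g : Fn R) (k n r : ℤ) {I : ℕ} (h : k - r < I) :
    ∑ i ∈ range I, (Ring.choose k i * shiftCoef (k - i) r) • (DlStar^[i] g) (n - k + i)
      = shiftCoef k r • g (n - r) := by
  -- For the reflected function `Δ^*` becomes `Δ`; with `p = 0` only the term `l = r` is left on the
  -- right.
  have h1 := leibniz_shiftCoef (fun p => g (n - p)) 0 r k 0 (I := I) (by omega)
  simp only [← iterate_DlStar_reflect, shiftCoef_zero_left, sub_eq_zero (a := r), mul_ite, mul_one,
    mul_zero, ite_smul, zero_smul, Finset.sum_ite_eq, mem_Icc, sub_zero, add_zero, zero_add,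
    le_refl, true_and] at h1
  have h2 : (if r ≤ k then shiftCoef k r • g (n - r) else 0) = shiftCoef k r • g (n - r) := by
    split_ifs with hk
    · rfl
    · rw [shiftCoef_of_lt (by omega), zero_smul]
  rw [h2] at h1
  rw [← h1]
  refine Finset.sum_congr rfl fun i _ => ?_
  rw [show n - (k - (i : ℤ)) = n - k + i by ring]

theorem iterate_Dl_eq_sum (f : Fn R) (k : ℕ) (n : ℤ) :
    (Dl^[k] f) n = ∑ m ∈ Icc n (n + k), shiftCoef k (m - n) • f m := by
  induction k generalizing n with
  | zero => simp [shiftCoef_zero_left]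
  | succ k ih =>
    have h1 : ∑ m ∈ Icc (n + 1) (n + 1 + k), shiftCoef k (m - (n + 1)) • f m
        = ∑ m ∈ Icc n (n + (k + 1 : ℕ)), shiftCoef k (m - (n + 1)) • f m := by
      refine Finset.sum_subset (Finset.Icc_subset_Icc (by omega) (by push_cast; omega))
        fun m hm hm' => ?_
      rw [mem_Icc] at hm hm'
      rw [shiftCoef_natCast_of_neg k (by push_cast at hm; omega), zero_smul]
    have h2 : ∑ m ∈ Icc n (n + k), shiftCoef k (m - n) • f m
        = ∑ m ∈ Icc n (n + (k + 1 : ℕ)), shiftCoef k (m - n) • f m := by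
      refine Finset.sum_subset (Finset.Icc_subset_Icc le_rfl (by push_cast; omega))
        fun m hm hm' => ?_
      rw [mem_Icc] at hm hm'
      rw [shiftCoef_of_lt (by omega), zero_smul]
    rw [Function.iterate_succ_apply', Dl, ih, ih, h1, h2, ← Finset.sum_sub_distrib]
    refine Finset.sum_congr rfl fun m _ => ?_
    rw [Nat.cast_succ, shiftCoef_succ, sub_smul, show m - n - 1 = m - (n + 1) by ring]

theorem iterate_DlStar_eq_sum (f : Fn R) (k : ℕ) (n : ℤ) :
    (DlStar^[k] f) n = ∑ l ∈ Icc (n - k) n, shiftCoef k (n - l) • f l := by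
  have h := iterate_DlStar_reflect f k 0 n
  rw [sub_zero] at h
  rw [h, iterate_Dl_eq_sum]
  refine Finset.sum_bij' (fun m _ => n - m) (fun l _ => n - l) ?_ ?_ ?_ ?_ ?_
  · intro m hm
    rw [mem_Icc] at *
    omega
  · intro m hm
    rw [mem_Icc] at *
    omega
  · intro m _
    ring
  · intro m _
    ring
  · intro m _
    rw [sub_zero, sub_sub_cancel]

/-- The sums of the tails of the rows. -/
theorem sum_shiftCoef_Ico (k l : ℤ) {n P : ℤ} (hn : n ≤ P) :
    ∑ m ∈ Ico n P, shiftCoef k (m - l)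
      = shiftCoef (k - 1) (n - 1 - l) - shiftCoef (k - 1) (P - 1 - l) := by
  induction P, hn using Int.leInduction with
  | base => simp
  | succ P hn ih =>
    have h1 := shiftCoef_succ (k - 1) (P - l)
    rw [sub_add_cancel] at h1
    rw [← Finset.insert_Ico_right_eq_Ico_add_one hn, Finset.sum_insert (by simp), ih, h1,
      add_sub_cancel_right, show P - l - 1 = P - 1 - l by ring]
    ring

end Leibniz

/-- The expansion of `λ^k` in powers of `1+λ` is that of `Δ^k` in powers of `Γ`: both obey the same
recursion. It is the bridge between operators and wave functions. -/
theorem coeff_lam_zpow_mul_zeta_zpow {F : Type*} [Field F] (k j : ℤ) :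
    ((lam : LaurentSeries F) ^ k * zeta ^ (-j - 1)).coeff 1 = (shiftCoef k j : F) := by
  have h := eq_zero_of_pascal (T := k - j + 1) (k := k) (n := -j) (X := fun k n =>
    ((lam : LaurentSeries F) ^ k * zeta ^ (n - 1)).coeff 1 - (shiftCoef k (-n) : F))
    (fun k n _ => ?_) (fun n _ => ?_) (fun k => ⟨-k, fun n hn => ?_⟩) (by omega)
  · rw [sub_eq_zero, neg_neg] at h
    exact h
  · have e : (lam : LaurentSeries F) ^ (k + 1) * zeta ^ (n - 1)
        = lam ^ k * zeta ^ (n + 1 - 1) - lam ^ k * zeta ^ (n - 1) := by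
      have h : (lam : LaurentSeries F) = zeta - 1 := by rw [zeta]; ring
      rw [zpow_add_one₀ lam_ne_zero, show n + 1 - 1 = n - 1 + 1 by ring,
        zpow_add_one₀ zeta_ne_zero]
      nth_rw 2 [h]
      ring
    rw [e, HahnSeries.coeff_sub, shiftCoef_succ, show -n - 1 = -(n + 1) by ring]
    push_cast
    ring
  · rw [zpow_zero, one_mul, coeff_zeta_zpow_one, shiftCoef_zero_left]
    by_cases hn : n = 0
    · rw [if_pos (by omega), if_pos (by omega)]
      simp
    · rw [if_neg (by omega), if_neg (by omega)]
      simp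
  · rw [shiftCoef_of_lt (by omega), coeff_lam_zpow_mul, (zeta_zpow_lead (n - 1)).1 _ (by omega)]
    simp

/-! ### Matrices that are bounded above -/

section Band

variable (S : Type*) [CommRing S]

/-- The matrices `a(n, l)` that vanish for `l > n + N`, for some `N`. -/
def bandMat : AddSubgroup (ℤ → ℤ → S) where
  carrier := {a | ∃ N : ℤ, ∀ n l, n + N < l → a n l = 0}
  zero_mem' := ⟨0, fun _ _ _ => rfl⟩
  add_mem' := by
    rintro a b ⟨N, ha⟩ ⟨M, hb⟩
    refine ⟨max N M, fun n l h => ?_⟩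
    rw [Pi.add_apply, Pi.add_apply, ha n l (by omega), hb n l (by omega), add_zero]
  neg_mem' := by
    rintro a ⟨N, ha⟩
    exact ⟨N, fun n l h => by rw [Pi.neg_apply, Pi.neg_apply, ha n l h, neg_zero]⟩

variable {S}

theorem finsum_mul_eq_sum {a b : ℤ → ℤ → S} {N M : ℤ} (ha : ∀ n l, n + N < l → a n l = 0)
    (hb : ∀ n l, n + M < l → b n l = 0) (n m : ℤ) {s : Finset ℤ}
    (hs : Icc (m - M) (n + N) ⊆ s) :
    ∑ᶠ l, a n l * b l m = ∑ l ∈ s, a n l * b l m := by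
  refine finsum_eq_sum_of_support_subset _ fun l hl => ?_
  rw [Function.mem_support] at hl
  refine hs ?_
  rw [mem_Icc]
  constructor
  · by_contra h
    exact hl (by rw [hb l m (by omega), mul_zero])
  · by_contra h
    exact hl (by rw [ha n l (by omega), zero_mul])

theorem bandMat_mul_mem {a b : ℤ → ℤ → S} (ha : a ∈ bandMat S) (hb : b ∈ bandMat S) :
    (fun n m => ∑ᶠ l, a n l * b l m) ∈ bandMat S := by
  obtain ⟨N, ha⟩ := ha
  obtain ⟨M, hb⟩ := hb
  refine ⟨N + M, fun n m h => ?_⟩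
  beta_reduce
  rw [finsum_mul_eq_sum ha hb n m subset_rfl, Finset.Icc_eq_empty (by omega), Finset.sum_empty]

instance : Mul (bandMat S) := ⟨fun a b => ⟨_, bandMat_mul_mem a.2 b.2⟩⟩

instance : One (bandMat S) := ⟨⟨fun n m => if n = m then 1 else 0,
  ⟨0, fun n l h => if_neg (by omega)⟩⟩⟩

theorem bandMat_mul_apply (a b : bandMat S) (n m : ℤ) :
    (a * b).1 n m = ∑ᶠ l, a.1 n l * b.1 l m := rfl

theorem bandMat_one_apply (n m : ℤ) : (1 : bandMat S).1 n m = if n = m then 1 else 0 := rfl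

theorem bandMat_mul_eq_sum {a b : bandMat S} {N M : ℤ} (ha : ∀ n l, n + N < l → a.1 n l = 0)
    (hb : ∀ n l, n + M < l → b.1 n l = 0) (n m : ℤ) {s : Finset ℤ}
    (hs : Icc (m - M) (n + N) ⊆ s) :
    (a * b).1 n m = ∑ l ∈ s, a.1 n l * b.1 l m := finsum_mul_eq_sum ha hb n m hs

theorem bandMat_ext {a b : bandMat S} (h : ∀ n m, a.1 n m = b.1 n m) : a = b :=
  Subtype.ext (funext fun n => funext fun m => h n m)

theorem bandMat_add_apply (a b : bandMat S) (n m : ℤ) : (a + b).1 n m = a.1 n m + b.1 n m := rfl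

theorem bandMat_mul_bound {a b : bandMat S} {N M : ℤ} (ha : ∀ n l, n + N < l → a.1 n l = 0)
    (hb : ∀ n l, n + M < l → b.1 n l = 0) (n m : ℤ) (h : n + (N + M) < m) : (a * b).1 n m = 0 := by
  rw [bandMat_mul_eq_sum ha hb n m subset_rfl, Finset.Icc_eq_empty (by omega), Finset.sum_empty]

theorem bandMat_mul_assoc (a b c : bandMat S) : a * b * c = a * (b * c) := by
  obtain ⟨N, ha⟩ := a.2
  obtain ⟨M, hb⟩ := b.2
  obtain ⟨P, hc⟩ := c.2
  refine bandMat_ext fun n m => ?_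
  set W := Icc (min (m - P) (m - P - M)) (max (n + N) (n + N + M)) with hW
  rw [bandMat_mul_eq_sum (bandMat_mul_bound ha hb) hc n m (s := W),
    bandMat_mul_eq_sum ha (bandMat_mul_bound hb hc) n m (s := W)]
  · have h1 : ∀ l ∈ W, (a * b).1 n l * c.1 l m = ∑ k ∈ W, a.1 n k * b.1 k l * c.1 l m := by
      intro l hl
      by_cases h : m - P ≤ l
      · rw [bandMat_mul_eq_sum ha hb n l (s := W), Finset.sum_mul]
        rw [hW]
        exact Finset.Icc_subset_Icc (by omega) (by omega)
      · rw [hc l m (by omega)]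
        simp
    have h2 : ∀ k ∈ W, a.1 n k * (b * c).1 k m = ∑ l ∈ W, a.1 n k * b.1 k l * c.1 l m := by
      intro k hk
      by_cases h : k ≤ n + N
      · rw [bandMat_mul_eq_sum hb hc k m (s := W), Finset.mul_sum]
        · exact Finset.sum_congr rfl fun l _ => (mul_assoc _ _ _).symm
        · rw [hW]
          exact Finset.Icc_subset_Icc (by omega) (by omega)
      · rw [ha n k (by omega)]
        simp
    rw [Finset.sum_congr rfl h1, Finset.sum_congr rfl h2, Finset.sum_comm]
  · rw [hW]
    exact Finset.Icc_subset_Icc (by omega) (by omega)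
  · rw [hW]
    exact Finset.Icc_subset_Icc (by omega) (by omega)

theorem bandMat_mul_add (a b c : bandMat S) : a * (b + c) = a * b + a * c := by
  obtain ⟨N, ha⟩ := a.2
  obtain ⟨M, hb⟩ := b.2
  obtain ⟨P, hc⟩ := c.2
  refine bandMat_ext fun n m => ?_
  set W := Icc (m - max M P) (n + N) with hW
  rw [bandMat_add_apply, bandMat_mul_eq_sum ha (M := max M P) (b := b + c) (s := W) ?_ n m subset_rfl,
    bandMat_mul_eq_sum ha hb n m (s := W) ?_, bandMat_mul_eq_sum ha hc n m (s := W) ?_,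
    ← Finset.sum_add_distrib]
  · exact Finset.sum_congr rfl fun l _ => mul_add _ _ _
  · rw [hW]
    exact Finset.Icc_subset_Icc (by omega) le_rfl
  · rw [hW]
    exact Finset.Icc_subset_Icc (by omega) le_rfl
  · intro n l h
    rw [bandMat_add_apply, hb n l (by omega), hc n l (by omega), add_zero]

theorem bandMat_add_mul (a b c : bandMat S) : (a + b) * c = a * c + b * c := by
  obtain ⟨N, ha⟩ := a.2
  obtain ⟨M, hb⟩ := b.2
  obtain ⟨P, hc⟩ := c.2
  refine bandMat_ext fun n m => ?_
  set W := Icc (m - P) (n + max N M) with hW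
  rw [bandMat_add_apply, bandMat_mul_eq_sum (N := max N M) (a := a + b) (s := W) ?_ hc n m subset_rfl,
    bandMat_mul_eq_sum ha hc n m (s := W) ?_, bandMat_mul_eq_sum hb hc n m (s := W) ?_,
    ← Finset.sum_add_distrib]
  · exact Finset.sum_congr rfl fun l _ => add_mul _ _ _
  · rw [hW]
    exact Finset.Icc_subset_Icc le_rfl (by omega)
  · rw [hW]
    exact Finset.Icc_subset_Icc le_rfl (by omega)
  · intro n l h
    rw [bandMat_add_apply, ha n l (by omega), hb n l (by omega), add_zero]

/-- Every entry of a product is a finite sum, so these matrices form a ring. Associativity and the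
powers of operators are used in this ring only, never for `PDO.mul` itself. -/
instance : Ring (bandMat S) :=
  { (inferInstance : AddCommGroup (bandMat S)) with
    mul_assoc := bandMat_mul_assoc
    left_distrib := bandMat_mul_add
    right_distrib := bandMat_add_mul
    zero_mul := fun a => bandMat_ext fun n m => by
      rw [bandMat_mul_apply]
      exact (finsum_congr fun l => zero_mul _).trans finsum_zero
    mul_zero := fun a => bandMat_ext fun n m => by
      rw [bandMat_mul_apply]
      exact (finsum_congr fun l => mul_zero _).trans finsum_zero
    one_mul := fun a => bandMat_ext fun n m => by
      rw [bandMat_mul_apply, finsum_eq_single _ n]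
      · rw [bandMat_one_apply, if_pos rfl, one_mul]
      · intro l hl
        rw [bandMat_one_apply, if_neg (Ne.symm hl), zero_mul]
    mul_one := fun a => bandMat_ext fun n m => by
      rw [bandMat_mul_apply, finsum_eq_single _ m]
      · rw [bandMat_one_apply, if_pos rfl, mul_one]
      · intro l hl
        rw [bandMat_one_apply, if_neg hl, mul_zero] }

/-- The entrywise image of a matrix. -/
def bandMap {S' : Type*} [CommRing S'] (f : S →+ S') : bandMat S →+ bandMat S' where
  toFun a := ⟨fun n m => f (a.1 n m), by
    obtain ⟨N, ha⟩ := a.2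
    exact ⟨N, fun n l h => by
      beta_reduce
      rw [ha n l h, map_zero]⟩⟩
  map_zero' := bandMat_ext fun _ _ => map_zero f
  map_add' a b := bandMat_ext fun _ _ => map_add f _ _

theorem bandMap_apply {S' : Type*} [CommRing S'] (f : S →+ S') (a : bandMat S) (n m : ℤ) :
    (bandMap f a).1 n m = f (a.1 n m) := rfl

theorem bandMap_mul (f : S →+ S) (hf : ∀ x y, f (x * y) = f x * y + x * f y) (a b : bandMat S) :
    bandMap f (a * b) = bandMap f a * b + a * bandMap f b := by
  obtain ⟨N, ha⟩ := a.2
  obtain ⟨M, hb⟩ := b.2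
  refine bandMat_ext fun n m => ?_
  rw [bandMap_apply, bandMat_add_apply, bandMat_mul_eq_sum ha hb n m subset_rfl,
    bandMat_mul_eq_sum (a := bandMap f a) (N := N) ?_ hb n m subset_rfl,
    bandMat_mul_eq_sum (b := bandMap f b) (M := M) ha ?_ n m subset_rfl, map_sum,
    ← Finset.sum_add_distrib]
  · exact Finset.sum_congr rfl fun l _ => hf _ _
  · intro n l h
    rw [bandMap_apply, hb n l h, map_zero]
  · intro n l h
    rw [bandMap_apply, ha n l h, map_zero]

theorem bandMap_one (f : S →+ S) (hf : f 1 = 0) : bandMap f (1 : bandMat S) = 0 := by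
  refine bandMat_ext fun n m => ?_
  rw [bandMap_apply, bandMat_one_apply, apply_ite f, hf, map_zero, ite_self]
  rfl

end Band

/-! ### Matrices of pseudo-difference operators -/

section Operators

variable {R : Type*} [CommRing R]

/-- The coefficient of `Γ^{m - n}` in a pseudo-difference operator at `n`. -/
def PDO.mat (P : PDO R) (n m : ℤ) : MvPowerSeries ℕ+ R :=
  ∑ᶠ k, shiftCoef k (m - n) • P.coeff k n

theorem PDO.mat_eq_sum {P : PDO R} {N : ℤ} (hP : ∀ k, N < k → P.coeff k = 0) (n m : ℤ)
    {s : Finset ℤ} (hs : Icc (m - n) N ⊆ s) :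
    P.mat n m = ∑ k ∈ s, shiftCoef k (m - n) • P.coeff k n := by
  refine finsum_eq_sum_of_support_subset _ fun k hk => ?_
  rw [Function.mem_support] at hk
  refine hs ?_
  rw [mem_Icc]
  constructor
  · by_contra h
    exact hk (by rw [shiftCoef_of_lt (by omega), zero_smul])
  · by_contra h
    exact hk (by rw [hP k (by omega), Pi.zero_apply, smul_zero])

theorem PDO.mat_eq_zero {P : PDO R} {N : ℤ} (hP : ∀ k, N < k → P.coeff k = 0) (n m : ℤ)
    (h : n + N < m) : P.mat n m = 0 := by
  rw [P.mat_eq_sum hP n m subset_rfl, Finset.Icc_eq_empty (by omega), Finset.sum_empty]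

/-- The matrix of a pseudo-difference operator. -/
def PDO.toBand (P : PDO R) : bandMat (MvPowerSeries ℕ+ R) :=
  ⟨P.mat, by
    obtain ⟨N, hN⟩ := P.bdd
    exact ⟨N, fun n l h => PDO.mat_eq_zero hN n l h⟩⟩

theorem PDO.toBand_apply (P : PDO R) (n m : ℤ) : P.toBand.1 n m = P.mat n m := rfl

theorem PDO.coeff_mul_eq_sum {P Q : PDO R} {N M : ℤ} (hP : ∀ k, N < k → P.coeff k = 0)
    (hQ : ∀ k, M < k → Q.coeff k = 0) (k' n : ℤ) {s : Finset ℤ} (hs : Icc (k' - M) N ⊆ s)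
    {I : ℕ} (hI : N + M - k' < I) : (P.mul Q).coeff k' n
      = ∑ k ∈ s, ∑ i ∈ range I, Ring.choose k i •
        (P.coeff k n * (Dl^[i] (Q.coeff (k' - k + i))) (n + k - i)) := by
  rw [← Finset.sum_product']
  refine finsum_eq_sum_of_support_subset _ fun p hp => ?_
  rw [Function.mem_support] at hp
  have h1 : p.1 ≤ N := by
    by_contra h
    exact hp (by rw [hP _ (by omega), Pi.zero_apply, zero_mul, smul_zero])
  have h2 : k' - p.1 + p.2 ≤ M := by
    by_contra h
    exact hp (by rw [hQ _ (by omega), PDO.iterate_Dl_zero, Pi.zero_apply, mul_zero, smul_zero])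
  rw [mem_coe, mem_product, mem_range]
  refine ⟨hs ?_, by omega⟩
  rw [mem_Icc]
  omega

theorem sum_comp_add_eq_sum {B : Type*} [AddCommMonoid B] {f : ℤ → B} {s t : Finset ℤ} (c : ℤ)
    (hs : ∀ x, f (x + c) ≠ 0 → x ∈ s) (ht : ∀ x, f x ≠ 0 → x ∈ t) :
    ∑ x ∈ s, f (x + c) = ∑ x ∈ t, f x := by
  rw [← finsum_eq_sum_of_support_subset (fun x => f (x + c)) (s := s) hs,
    ← finsum_eq_sum_of_support_subset f (s := t) ht]
  exact finsum_comp_equiv (Equiv.addRight c)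

theorem PDO.mat_mul {P Q : PDO R} {N M : ℤ} (hP : ∀ k, N < k → P.coeff k = 0)
    (hQ : ∀ k, M < k → Q.coeff k = 0) (n m : ℤ) :
    (P.mul Q).mat n m = ∑ l ∈ Icc (m - M) (n + N), P.mat n l * Q.mat l m := by
  have hPQ : ∀ k, N + M < k → (P.mul Q).coeff k = 0 := by
    intro k hk
    funext n
    rw [PDO.coeff_mul_eq_sum hP hQ k n subset_rfl (I := 0) (by push_cast; omega)]
    simp
  obtain ⟨I, hI⟩ : ∃ I : ℕ, n + N + M - m < I := ⟨(n + N + M - m + 1).toNat, by omega⟩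
  set W := Icc (m - n - M) N with hW
  set V := Icc (m - n - N) M with hV
  have h1 : (P.mul Q).mat n m = ∑ k' ∈ Icc (m - n) (N + M), ∑ k ∈ W, ∑ i ∈ range I,
      shiftCoef k' (m - n) • Ring.choose k i •
        (P.coeff k n * (Dl^[i] (Q.coeff (k' - k + i))) (n + k - i)) := by
    rw [PDO.mat_eq_sum hPQ n m subset_rfl]
    refine Finset.sum_congr rfl fun k' hk' => ?_
    rw [mem_Icc] at hk'
    rw [PDO.coeff_mul_eq_sum hP hQ k' n (s := W) (I := I), Finset.smul_sum]
    · exact Finset.sum_congr rfl fun k _ => Finset.smul_sum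
    · exact Finset.Icc_subset_Icc (by omega) le_rfl
    · omega
  -- For fixed `k` and `i`, the substitution `p = k' - k + i` replaces the order of the product by
  -- the order of the right factor; the sum over `i` is then the Leibniz rule.
  have h2 : ∀ k ∈ W, ∀ i ∈ range I, ∑ k' ∈ Icc (m - n) (N + M),
      shiftCoef k' (m - n) • Ring.choose k i •
        (P.coeff k n * (Dl^[i] (Q.coeff (k' - k + i))) (n + k - i))
      = ∑ p ∈ V, P.coeff k n * ((Ring.choose k i * shiftCoef (k + p - i) (m - n)) •
        (Dl^[i] (Q.coeff p)) (n + k - i)) := by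
    intro k hk i hi
    rw [mem_Icc] at hk
    have h3 : ∀ p, ¬p ≤ M → P.coeff k n * ((Ring.choose k i * shiftCoef (k + p - i) (m - n)) •
        (Dl^[i] (Q.coeff p)) (n + k - i)) = 0 := by
      intro p hp
      rw [hQ p (by omega), PDO.iterate_Dl_zero, Pi.zero_apply, smul_zero, mul_zero]
    have h4 : ∀ p, k + p - i < m - n → P.coeff k n * ((Ring.choose k i *
        shiftCoef (k + p - i) (m - n)) • (Dl^[i] (Q.coeff p)) (n + k - i)) = 0 := by
      intro p hp
      rw [shiftCoef_of_lt hp, mul_zero, zero_smul, mul_zero]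
    refine Eq.trans ?_ (sum_comp_add_eq_sum (f := fun p => P.coeff k n *
      ((Ring.choose k i * shiftCoef (k + p - i) (m - n)) • (Dl^[i] (Q.coeff p)) (n + k - i)))
      (s := Icc (m - n) (N + M)) (t := V) (-k + i) ?_ ?_)
    · refine Finset.sum_congr rfl fun k' _ => ?_
      rw [smul_smul, mul_comm (shiftCoef _ _), show k' + (-k + i) = k' - k + i by ring,
        show k + (k' - k + i) - i = k' by ring, mul_smul_comm]
    · intro x hx
      rw [mem_Icc]
      by_contra h
      by_cases h5 : x + (-k + i) ≤ M
      · exact hx (h4 _ (by omega))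
      · exact hx (h3 _ h5)
    · intro x hx
      rw [hV, mem_Icc]
      by_contra h
      by_cases h5 : x ≤ M
      · exact hx (h4 _ (by omega))
      · exact hx (h3 _ h5)
  have h5 : ∀ k ∈ W, ∀ p ∈ V, ∑ i ∈ range I, P.coeff k n *
      ((Ring.choose k i * shiftCoef (k + p - i) (m - n)) • (Dl^[i] (Q.coeff p)) (n + k - i))
      = ∑ l ∈ Icc (m - M) (n + N), (shiftCoef k (l - n) • P.coeff k n)
        * (shiftCoef p (m - l) • Q.coeff p l) := by
    intro k hk p hp
    rw [mem_Icc] at hk hp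
    rw [← Finset.mul_sum, leibniz_shiftCoef (Q.coeff p) p m k n (by omega),
      Finset.sum_subset (Finset.Icc_subset_Icc (by omega) (by omega) :
        Icc (m - p) (n + k) ⊆ Icc (m - M) (n + N)), Finset.mul_sum]
    · refine Finset.sum_congr rfl fun l _ => ?_
      rw [smul_mul_smul_comm, mul_smul_comm]
    · intro l hl hl'
      rw [mem_Icc] at hl'
      by_cases h : l ≤ n + k
      · rw [shiftCoef_of_lt (k := p) (by omega), mul_zero, zero_smul]
      · rw [shiftCoef_of_lt (k := k) (by omega), zero_mul, zero_smul]
  have h6 : ∀ l ∈ Icc (m - M) (n + N), P.mat n l * Q.mat l m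
      = ∑ k ∈ W, ∑ p ∈ V, (shiftCoef k (l - n) • P.coeff k n)
        * (shiftCoef p (m - l) • Q.coeff p l) := by
    intro l hl
    rw [mem_Icc] at hl
    rw [PDO.mat_eq_sum hP n l (s := W) (Finset.Icc_subset_Icc (by omega) le_rfl),
      PDO.mat_eq_sum hQ l m (s := V) (Finset.Icc_subset_Icc (by omega) le_rfl),
      Finset.sum_mul_sum]
  rw [h1, Finset.sum_comm]
  refine Eq.trans ?_ ((Finset.sum_congr rfl h6).trans Finset.sum_comm).symm
  refine Finset.sum_congr rfl fun k hk => ?_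
  rw [Finset.sum_comm, Finset.sum_congr rfl (h2 k hk), Finset.sum_comm,
    Finset.sum_congr rfl (h5 k hk), Finset.sum_comm]

theorem PDO.toBand_mul (P Q : PDO R) : (P.mul Q).toBand = P.toBand * Q.toBand := by
  obtain ⟨N, hN⟩ := P.bdd
  obtain ⟨M, hM⟩ := Q.bdd
  refine bandMat_ext fun n m => ?_
  rw [bandMat_mul_eq_sum (a := P.toBand) (b := Q.toBand) (PDO.mat_eq_zero hN) (PDO.mat_eq_zero hM)
    n m subset_rfl]
  exact PDO.mat_mul hN hM n m

theorem PDO.mat_Dpow (k n m : ℤ) :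
    (PDO.Dpow k : PDO R).mat n m = (shiftCoef k (m - n) : MvPowerSeries ℕ+ R) := by
  rw [PDO.mat, finsum_eq_single _ k]
  · rw [PDO.Dpow]
    simp
  · intro l hl
    rw [PDO.Dpow]
    simp [hl]

theorem PDO.toBand_Dpow_zero : (PDO.Dpow 0 : PDO R).toBand = 1 := by
  refine bandMat_ext fun n m => ?_
  rw [PDO.toBand_apply, PDO.mat_Dpow, shiftCoef_zero_left, bandMat_one_apply]
  by_cases h : n = m
  · rw [if_pos (by omega), if_pos h, Int.cast_one]
  · rw [if_neg (by omega), if_neg h, Int.cast_zero]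

theorem PDO.mat_ofFn (g : Fn R) (n m : ℤ) :
    (PDO.ofFn g).mat n m = if m = n then g n else 0 := by
  rw [PDO.mat, finsum_eq_single _ 0]
  · rw [PDO.ofFn, shiftCoef_zero_left]
    simp [sub_eq_zero, ite_smul]
  · intro l hl
    rw [PDO.ofFn]
    simp [hl]

theorem PDO.mat_map {R' : Type*} [CommRing R'] (ι : R →+* R') (P : PDO R) (n m : ℤ) :
    (P.map ι).mat n m = MvPowerSeries.map ι (P.mat n m) := by
  obtain ⟨N, hN⟩ := P.bdd
  have hN' : ∀ k, N < k → (P.map ι).coeff k = 0 := fun k hk => by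
    funext n
    simp [PDO.map, Fn.map, hN k hk]
  rw [PDO.mat_eq_sum hN n m subset_rfl, PDO.mat_eq_sum hN' n m subset_rfl, map_sum]
  refine Finset.sum_congr rfl fun k _ => ?_
  rw [map_zsmul]
  rfl

/-- Nonnegative powers of `Δ` contain no `Γ⁻¹`, and those below `-1` start lower, so the coefficient
of `Γ⁻¹` is `u_{-1}`. -/
theorem PDO.res_eq_mat (P : PDO R) (n : ℤ) : P.res n = P.mat n (n - 1) := by
  rw [PDO.mat, finsum_eq_single _ (-1)]
  · rw [show n - 1 - n = -1 by ring, shiftCoef_self, one_smul]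
    rfl
  · intro k hk
    rw [show n - 1 - n = -1 by ring]
    rcases lt_or_ge k 0 with h | h
    · rw [shiftCoef_of_lt (by omega), zero_smul]
    · obtain ⟨k, rfl⟩ := Int.eq_ofNat_of_zero_le h
      rw [shiftCoef_natCast_of_neg k (by omega), zero_smul]

end Operators

/-! ### Operators without terms of order at most zero -/

section Positive

variable {R : Type*} [CommRing R]

theorem PDO.mul_order_le {P Q : PDO R} {N M : ℤ} (hP : ∀ k, N < k → P.coeff k = 0)
    (hQ : ∀ k, M < k → Q.coeff k = 0) (k : ℤ) (hk : N + M < k) : (P.mul Q).coeff k = 0 := by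
  funext n
  rw [PDO.coeff_mul_eq_sum hP hQ k n subset_rfl (I := 0) (by push_cast; omega)]
  simp

theorem PDO.mat_posPart_add_mat_nonposPart (P : PDO R) (n m : ℤ) :
    P.posPart.mat n m + P.nonposPart.mat n m = P.mat n m := by
  obtain ⟨N, hN⟩ := P.bdd
  rw [PDO.mat_eq_sum hN n m subset_rfl, PDO.mat_eq_sum (P := P.posPart) (N := N) (s := Icc (m - n) N)
    (fun k hk => by simp [PDO.posPart, hN k hk]) n m subset_rfl,
    PDO.mat_eq_sum (P := P.nonposPart) (N := N) (s := Icc (m - n) N)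
    (fun k hk => by simp [PDO.nonposPart, hN k hk]) n m subset_rfl, ← Finset.sum_add_distrib]
  refine Finset.sum_congr rfl fun k _ => ?_
  rw [← smul_add]
  congr 1
  by_cases hk : 1 ≤ k
  · simp [PDO.posPart, PDO.nonposPart, hk, show ¬k ≤ 0 by omega]
  · simp [PDO.posPart, PDO.nonposPart, hk, show k ≤ 0 by omega]

/-- The operators `∑_{1 ≤ k ≤ i} u_k Δ^k`. -/
structure PDO.IsPositive (P : PDO R) (i : ℕ) : Prop where
  low : ∀ k < 1, P.coeff k = 0
  high : ∀ k : ℤ, i < k → P.coeff k = 0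

theorem PDO.IsPositive.map {R' : Type*} [CommRing R'] (ι : R →+* R') {P : PDO R} {i : ℕ}
    (h : P.IsPositive i) : (P.map ι).IsPositive i where
  low k hk := by
    funext n
    simp [PDO.map, Fn.map, h.low k hk]
  high k hk := by
    funext n
    simp [PDO.map, Fn.map, h.high k hk]

theorem PDO.IsPositive.mat_eq {P : PDO R} {i : ℕ} (h : P.IsPositive i) (n m : ℤ) :
    P.mat n m = ∑ k ∈ range i, shiftCoef (k + 1 : ℕ) (m - n) • P.coeff (k + 1 : ℕ) n := by
  have h1 : P.mat n m = ∑ k ∈ (range i).map ((Nat.castEmbedding (R := ℤ)).trans (addRightEmbedding 1)),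
      shiftCoef k (m - n) • P.coeff k n := by
    refine finsum_eq_sum_of_support_subset _ fun k hk => ?_
    rw [Function.mem_support] at hk
    have hk1 : 1 ≤ k := by
      by_contra hk1
      exact hk (by rw [h.low k (by omega), Pi.zero_apply, smul_zero])
    have hk2 : k ≤ i := by
      by_contra hk1
      exact hk (by rw [h.high k (by omega), Pi.zero_apply, smul_zero])
    rw [mem_coe, mem_map]
    refine ⟨(k - 1).toNat, by rw [mem_range]; omega, ?_⟩
    change ((k - 1).toNat : ℤ) + 1 = k
    omega
  rw [h1, Finset.sum_map]
  exact Finset.sum_congr rfl fun k _ => by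
    rw [Nat.cast_add_one]
    rfl

theorem PDO.IsPositive.mat_upper {P : PDO R} {i : ℕ} (h : P.IsPositive i) {n m : ℤ} (hm : m < n) :
    P.mat n m = 0 := by
  rw [h.mat_eq]
  refine Finset.sum_eq_zero fun k _ => ?_
  rw [shiftCoef_natCast_of_neg _ (by omega), zero_smul]

theorem PDO.IsPositive.mat_band {P : PDO R} {i : ℕ} (h : P.IsPositive i) {n m : ℤ}
    (hm : n + i < m) : P.mat n m = 0 :=
  PDO.mat_eq_zero h.high n m hm

/-- An operator with terms of order at least `1` only annihilates constants. -/
theorem PDO.IsPositive.row_sum {P : PDO R} {i : ℕ} (h : P.IsPositive i) (n : ℤ) :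
    ∑ m ∈ Icc n (n + i), P.mat n m = 0 := by
  simp only [h.mat_eq]
  rw [Finset.sum_comm]
  refine Finset.sum_eq_zero fun k hk => ?_
  rw [mem_range] at hk
  have h1 : Icc n (n + i) = Ico n (n + i + 1) := by
    ext m
    rw [mem_Icc, mem_Ico]
    omega
  rw [← Finset.sum_smul, h1, sum_shiftCoef_Ico _ _ (by omega), Nat.cast_add_one,
    add_sub_cancel_right, shiftCoef_natCast_of_neg _ (by omega), shiftCoef_of_lt (by omega),
    sub_zero, zero_smul]

theorem PDO.IsPositive.act_eq {P : PDO R} {i : ℕ} (h : P.IsPositive i) (φ : Fn R) (n : ℤ) :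
    P.act φ n = ∑ m ∈ Icc n (n + i), P.mat n m * φ m := by
  have h1 : P.act φ n = ∑ k ∈ (range i).map (addRightEmbedding 1), P.coeff k n * (Dl^[k] φ) n := by
    refine finsum_eq_sum_of_support_subset _ fun k hk => ?_
    rw [Function.mem_support] at hk
    have hk1 : 1 ≤ k := by
      by_contra hk1
      exact hk (by rw [h.low k (by omega), Pi.zero_apply, zero_mul])
    have hk2 : k ≤ i := by
      by_contra hk1
      exact hk (by rw [h.high k (by omega), Pi.zero_apply, zero_mul])
    rw [mem_coe, mem_map]
    exact ⟨k - 1, by rw [mem_range]; omega, Nat.sub_add_cancel hk1⟩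
  rw [h1, Finset.sum_map]
  simp only [h.mat_eq, Finset.sum_mul]
  rw [Finset.sum_comm]
  refine Finset.sum_congr rfl fun k hk => ?_
  rw [mem_range] at hk
  rw [addRightEmbedding_apply, iterate_Dl_eq_sum, Finset.mul_sum]
  refine Eq.trans (Finset.sum_subset (Finset.Icc_subset_Icc le_rfl
    (by push_cast; omega : n + ((k + 1 : ℕ) : ℤ) ≤ n + i)) fun m hm hm' => ?_)
    (Finset.sum_congr rfl fun m _ => ?_)
  · rw [mem_Icc] at hm hm'
    rw [shiftCoef_of_lt (by omega), zero_smul, mul_zero]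
  · rw [mul_smul_comm, smul_mul_assoc]

/-- Cancelling one factor `Δ` amounts to summing tails of rows: the sum over `m ≥ n` of the
coefficients of `Δ^{k+1}` is a coefficient of `Δ^k` (`sum_shiftCoef_Ico`). -/
theorem PDO.IsPositive.neg_conjAdjointAct_eq {P : PDO R} {i : ℕ} (h : P.IsPositive i) (ψ : Fn R)
    (n : ℤ) : -P.conjAdjointAct ψ n = potFlow i P.mat (Dl ψ) 1 n := by
  have h1 : P.conjAdjointAct ψ n
      = ∑ k ∈ range i, -(DlStar^[k] (P.coeff (k + 1) * Dl ψ)) (n - 1) := by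
    refine finsum_eq_sum_of_support_subset _ fun k hk => ?_
    rw [Function.mem_support] at hk
    rw [mem_coe, mem_range]
    by_contra hk1
    refine hk ?_
    rw [h.high _ (by omega), zero_mul, iterate_DlStar_eq_sum]
    simp
  rw [h1, ← Finset.sum_neg_distrib]
  simp only [neg_neg, potFlow, h.mat_eq, Pi.one_apply, mul_one, Finset.mul_sum]
  rw [Finset.sum_congr rfl fun l _ => Finset.sum_comm, Finset.sum_comm]
  refine Finset.sum_congr rfl fun k hk => ?_
  rw [mem_range] at hk
  rw [iterate_DlStar_eq_sum]
  refine Eq.trans (Finset.sum_subset (s₂ := Ico (n - i) n) (fun l hl => ?_) fun l hl hl' => ?_)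
    (Finset.sum_congr rfl fun l hl => ?_)
  · rw [mem_Icc] at hl
    rw [mem_Ico]
    omega
  · rw [mem_Icc] at hl'
    rw [mem_Ico] at hl
    rw [shiftCoef_of_lt (by omega), zero_smul]
  · rw [mem_Ico] at hl
    rw [← Finset.mul_sum, ← Finset.sum_smul, sum_shiftCoef_Ico _ _ (by omega), Nat.cast_add_one,
      add_sub_cancel_right, shiftCoef_of_lt (k := k) (j := n + i - 1 - l) (by omega), sub_zero,
      mul_smul_comm, Pi.mul_apply, mul_comm (Dl ψ l)]

theorem shiftCoef_neg_one_eq_ite (j : ℤ) : shiftCoef (-1) j = if j ≤ -1 then 1 else 0 := by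
  split_ifs with h
  · exact shiftCoef_neg_one h
  · exact shiftCoef_of_lt (by omega)

/-- The residue is the entry `(n, n-1)`. As `Δ⁻¹ = Γ⁻¹ + Γ⁻² + ⋯`, the left `Δ⁻¹` selects all `l <
n` and the right one all `m ≥ n`; the band bounds both. -/
theorem PDO.IsPositive.res_eq_potFlow {P : PDO R} {i : ℕ} (h : P.IsPositive i) (χ φ : Fn R)
    (n : ℤ) : ((PDO.Dpow (-1)).mul ((PDO.ofFn χ).mul (P.mul
      ((PDO.ofFn φ).mul (PDO.Dpow (-1)))))).res n = potFlow i P.mat χ φ n := by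
  have hX : ∀ (g : Fn R) (b : bandMat (MvPowerSeries ℕ+ R)) (n m : ℤ),
      ((PDO.ofFn g).toBand * b).1 n m = g n * b.1 n m := by
    intro g b n m
    rw [bandMat_mul_apply, finsum_eq_single _ n]
    · rw [PDO.toBand_apply, PDO.mat_ofFn, if_pos rfl]
    · intro l hl
      rw [PDO.toBand_apply, PDO.mat_ofFn, if_neg hl, zero_mul]
  have h1 : ∀ l < n, (P.toBand * ((PDO.ofFn φ).toBand * (PDO.Dpow (-1)).toBand)).1 l (n - 1)
      = ∑ m ∈ Ico n (n + i), P.mat l m * φ m := by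
    intro l hl
    rw [bandMat_mul_apply]
    refine (finsum_eq_sum_of_support_subset (s := Ico n (n + i)) _ fun m hm => ?_).trans
      (Finset.sum_congr rfl fun m hm => ?_)
    · rw [Function.mem_support, hX, PDO.toBand_apply, PDO.toBand_apply, PDO.mat_Dpow,
        shiftCoef_neg_one_eq_ite] at hm
      rw [mem_coe, mem_Ico]
      constructor
      · by_contra hn
        exact hm (by rw [if_neg (by omega), Int.cast_zero, mul_zero, mul_zero])
      · by_contra hn
        exact hm (by rw [h.mat_band (by omega), zero_mul])
    · rw [mem_Ico] at hm
      rw [hX, PDO.toBand_apply, PDO.toBand_apply, PDO.mat_Dpow, shiftCoef_neg_one (by omega),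
        Int.cast_one, mul_one]
  rw [PDO.res_eq_mat, ← PDO.toBand_apply, PDO.toBand_mul, PDO.toBand_mul, PDO.toBand_mul,
    PDO.toBand_mul, bandMat_mul_apply]
  refine (finsum_eq_sum_of_support_subset (s := Ico (n - i) n) _ fun l hl => ?_).trans
    (Finset.sum_congr rfl fun l hl => ?_)
  · rw [Function.mem_support, hX, PDO.toBand_apply, PDO.mat_Dpow, shiftCoef_neg_one_eq_ite] at hl
    rw [mem_coe, mem_Ico]
    have hn : l < n := by
      by_contra hn
      exact hl (by rw [if_neg (by omega), Int.cast_zero, zero_mul])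
    refine ⟨?_, hn⟩
    by_contra hn'
    rw [h1 l hn, Finset.sum_eq_zero, mul_zero, mul_zero] at hl
    · exact hl rfl
    · intro m hm
      rw [mem_Ico] at hm
      rw [h.mat_band (by omega), zero_mul]
  · rw [mem_Ico] at hl
    rw [hX, h1 l hl.2, PDO.toBand_apply, PDO.mat_Dpow, shiftCoef_neg_one (by omega), Int.cast_one,
      one_mul, Finset.mul_sum]
    exact Finset.sum_congr rfl fun m _ => (mul_assoc _ _ _).symm

theorem toBand_Dpow_one_mul_apply (b : bandMat (MvPowerSeries ℕ+ R)) (n m : ℤ) :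
    ((PDO.Dpow 1).toBand * b).1 n m = b.1 (n + 1) m - b.1 n m := by
  have h0 : shiftCoef 1 0 = -1 := by
    have := shiftCoef_succ 0 0
    rwa [zero_add, shiftCoef_zero_left, shiftCoef_zero_left] at this
  rw [bandMat_mul_apply, finsum_eq_sum_of_support_subset (s := {n + 1, n})]
  · rw [Finset.sum_pair (by omega), PDO.toBand_apply, PDO.toBand_apply, PDO.mat_Dpow, PDO.mat_Dpow,
      add_sub_cancel_left, sub_self, h0, shiftCoef_self]
    push_cast
    ring
  · intro l hl
    rw [Function.mem_support, PDO.toBand_apply, PDO.mat_Dpow] at hl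
    rw [mem_coe, mem_insert, mem_singleton]
    by_contra hn
    refine hl ?_
    rcases lt_or_ge l n with h | h
    · have := shiftCoef_natCast_of_neg 1 (j := l - n) (by omega)
      rw [Nat.cast_one] at this
      rw [this, Int.cast_zero, zero_mul]
    · rw [shiftCoef_of_lt (by omega), Int.cast_zero, zero_mul]

theorem mul_toBand_Dpow_one_apply (b : bandMat (MvPowerSeries ℕ+ R)) (n m : ℤ) :
    (b * (PDO.Dpow 1).toBand).1 n m = b.1 n (m - 1) - b.1 n m := by
  have h0 : shiftCoef 1 0 = -1 := by
    have := shiftCoef_succ 0 0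
    rwa [zero_add, shiftCoef_zero_left, shiftCoef_zero_left] at this
  rw [bandMat_mul_apply, finsum_eq_sum_of_support_subset (s := {m - 1, m})]
  · rw [Finset.sum_pair (by omega), PDO.toBand_apply, PDO.toBand_apply, PDO.mat_Dpow, PDO.mat_Dpow,
      sub_sub_cancel, sub_self, h0, shiftCoef_self]
    push_cast
    ring
  · intro l hl
    rw [Function.mem_support, PDO.toBand_apply, PDO.mat_Dpow] at hl
    rw [mem_coe, mem_insert, mem_singleton]
    by_contra hn
    refine hl ?_
    rcases lt_or_ge m l with h | h
    · have := shiftCoef_natCast_of_neg 1 (j := m - l) (by omega)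
      rw [Nat.cast_one] at this
      rw [this, Int.cast_zero, mul_zero]
    · rw [shiftCoef_of_lt (by omega), Int.cast_zero, mul_zero]

theorem toBand_Dpow_one_pow_mul_apply (b : bandMat (MvPowerSeries ℕ+ R)) (i : ℕ) (n m : ℤ) :
    ((PDO.Dpow 1).toBand ^ i * b).1 n m = (Dl^[i] (fun p => b.1 p m)) n := by
  induction i generalizing n with
  | zero => rw [pow_zero, one_mul]; rfl
  | succ i ih =>
    rw [pow_succ', mul_assoc, toBand_Dpow_one_mul_apply, ih, ih, Function.iterate_succ_apply', Dl]

theorem mul_toBand_Dpow_one_pow_apply (b : bandMat (MvPowerSeries ℕ+ R)) (i : ℕ) (n m : ℤ) :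
    (b * (PDO.Dpow 1).toBand ^ i).1 n m = (DlStar^[i] (b.1 n)) m := by
  induction i generalizing m with
  | zero => rw [pow_zero, mul_one]; rfl
  | succ i ih =>
    rw [pow_succ, ← mul_assoc, mul_toBand_Dpow_one_apply, ih, ih, Function.iterate_succ_apply',
      DlStar]

end Positive

/-! ### The matrices of a dressing operator -/

section Dressing

variable {K : Type*} [Field K] {Z Y : PDO K}

theorem IsDressing.lax_order_le (hZ : IsDressing Z Y) (k : ℤ) (hk : 1 < k) :
    (lax Z Y).coeff k = 0 := by
  have h1 : ∀ k, 1 < k → (PDO.Dpow 1 : PDO K).coeff k = 0 := fun k hk => if_neg (by omega)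
  exact PDO.mul_order_le (N := 1) (M := 0)
    (fun k hk => PDO.mul_order_le (N := 0) (M := 1) hZ.order_le h1 k (by omega))
    hZ.inv_order_le k (by omega)

theorem IsDressing.pow_order_le (hZ : IsDressing Z Y) (i : ℕ) (k : ℤ) (hk : i < k) :
    ((lax Z Y).pow i).coeff k = 0 := by
  induction i generalizing k with
  | zero => exact if_neg (by push_cast at hk; omega)
  | succ i ih =>
    exact PDO.mul_order_le (N := 1) (M := i) hZ.lax_order_le ih k (by push_cast at hk; omega)

theorem IsDressing.isPositive (hZ : IsDressing Z Y) (i : ℕ+) : (laxPos Z Y i).IsPositive i where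
  low k hk := if_neg (by omega)
  high k hk := by
    change (if 1 ≤ k then ((lax Z Y).pow i).coeff k else 0) = 0
    rw [hZ.pow_order_le i k hk, ite_self]

theorem IsDressing.toBand_mul_inv (hZ : IsDressing Z Y) : Z.toBand * Y.toBand = 1 := by
  rw [← PDO.toBand_mul, hZ.mul_inv, PDO.toBand_Dpow_zero]

theorem IsDressing.toBand_inv_mul (hZ : IsDressing Z Y) : Y.toBand * Z.toBand = 1 := by
  rw [← PDO.toBand_mul, hZ.inv_mul, PDO.toBand_Dpow_zero]

theorem IsDressing.toBand_pow_mul (hZ : IsDressing Z Y) (i : ℕ) :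
    ((lax Z Y).pow i).toBand * Z.toBand = Z.toBand * (PDO.Dpow 1).toBand ^ i := by
  induction i with
  | zero => rw [PDO.pow, PDO.toBand_Dpow_zero, pow_zero, one_mul, mul_one]
  | succ i ih =>
    rw [PDO.pow, PDO.toBand_mul, mul_assoc, ih, lax, PDO.toBand_mul, PDO.toBand_mul, mul_assoc,
      ← mul_assoc Y.toBand, hZ.toBand_inv_mul, one_mul, mul_assoc, ← pow_succ']

/-- The derivation `∂/∂t_i` on matrices. -/
def bandDeriv (K : Type*) [Field K] (i : ℕ+) :
    bandMat (MvPowerSeries ℕ+ K) →+ bandMat (MvPowerSeries ℕ+ K) :=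
  bandMap (MvPowerSeries.pderiv K i : MvPowerSeries ℕ+ K →ₗ[K] MvPowerSeries ℕ+ K).toAddMonoidHom

theorem bandDeriv_mul (i : ℕ+) (a b : bandMat (MvPowerSeries ℕ+ K)) :
    bandDeriv K i (a * b) = bandDeriv K i a * b + a * bandDeriv K i b :=
  bandMap_mul _ (fun x y => by
    refine (Derivation.leibniz (MvPowerSeries.pderiv K i) x y).trans ?_
    rw [smul_eq_mul, smul_eq_mul, add_comm, mul_comm y]
    rfl) a b

theorem bandDeriv_one (i : ℕ+) : bandDeriv K i 1 = 0 :=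
  bandMap_one _ (MvPowerSeries.pderiv_one)

/-- `-(L^i)_{≤0} Z = (L^i)_{≥1} Z - L^i Z`, and `L^i Z = Z Δ^i`. -/
theorem IsDressing.bandDeriv_eq (hZ : IsDressing Z Y) (i : ℕ+) :
    bandDeriv K i Z.toBand
      = (laxPos Z Y i).toBand * Z.toBand - Z.toBand * (PDO.Dpow 1).toBand ^ (i : ℕ) := by
  have h1 : bandDeriv K i Z.toBand = -(((lax Z Y).pow i).nonposPart.toBand * Z.toBand) := by
    rw [← PDO.toBand_mul]
    refine bandMat_ext fun n m => ?_
    have h2 : ∀ k, 0 < k → (((lax Z Y).pow i).nonposPart.mul Z).coeff k = 0 := fun k hk =>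
      PDO.mul_order_le (N := 0) (M := 0) (fun k hk => if_neg (by omega)) hZ.order_le k (by omega)
    change MvPowerSeries.pderiv K i (Z.mat n m) = -(((lax Z Y).pow i).nonposPart.mul Z).mat n m
    rw [PDO.mat_eq_sum hZ.order_le n m subset_rfl, PDO.mat_eq_sum h2 n m subset_rfl, map_sum,
      ← Finset.sum_neg_distrib]
    refine Finset.sum_congr rfl fun k _ => ?_
    rw [map_zsmul, hZ.sato, smul_neg]
  have h2 : (laxPos Z Y i).toBand + ((lax Z Y).pow i).nonposPart.toBand
      = ((lax Z Y).pow i).toBand :=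
    bandMat_ext fun n m => PDO.mat_posPart_add_mat_nonposPart _ n m
  rw [h1, ← hZ.toBand_pow_mul, ← h2, add_mul]
  abel

/-- Differentiate `ZY = 1` and use the equation for `Z`. -/
theorem IsDressing.bandDeriv_inv_eq (hZ : IsDressing Z Y) (i : ℕ+) :
    bandDeriv K i Y.toBand
      = (PDO.Dpow 1).toBand ^ (i : ℕ) * Y.toBand - Y.toBand * (laxPos Z Y i).toBand := by
  have h1 : bandDeriv K i Z.toBand * Y.toBand + Z.toBand * bandDeriv K i Y.toBand = 0 := by
    rw [← bandDeriv_mul, hZ.toBand_mul_inv, bandDeriv_one]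
  have h2 : bandDeriv K i Y.toBand = -(Y.toBand * (bandDeriv K i Z.toBand * Y.toBand)) := by
    have := congrArg (Y.toBand * ·) h1
    beta_reduce at this
    rw [mul_add, ← mul_assoc Y.toBand Z.toBand, hZ.toBand_inv_mul, one_mul, mul_zero] at this
    exact eq_neg_of_add_eq_zero_right this
  rw [h2, hZ.bandDeriv_eq, sub_mul, mul_sub, mul_assoc, mul_assoc, hZ.toBand_mul_inv, mul_one,
    ← mul_assoc Y.toBand Z.toBand, hZ.toBand_inv_mul, one_mul]
  abel

theorem IsDressing.matrixDressing (hZ : IsDressing Z Y) :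
    MatrixDressing Z.mat Y.mat (fun i => (laxPos Z Y i).mat) where
  lower n m h := PDO.mat_eq_zero hZ.order_le n m (by omega)
  inv_lower n m h := PDO.mat_eq_zero hZ.inv_order_le n m (by omega)
  mul_inv n l := by
    have h := bandMat_mul_eq_sum (a := Z.toBand) (b := Y.toBand) (N := 0) (M := 0)
      (PDO.mat_eq_zero hZ.order_le) (PDO.mat_eq_zero hZ.inv_order_le) n l (s := Icc l n)
      (by rw [sub_zero, add_zero])
    rw [hZ.toBand_mul_inv] at h
    exact h.symm
  upper i l m h := (hZ.isPositive i).mat_upper h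
  band i l m h := (hZ.isPositive i).mat_band h
  row_sum i n := (hZ.isPositive i).row_sum n
  pderiv_row i n m := by
    have h := congrArg (fun a => a.1 n m) (hZ.bandDeriv_eq i)
    have h1 : ((laxPos Z Y i).toBand * Z.toBand).1 n m
        = ∑ l ∈ Icc n (n + (i : ℕ)), (laxPos Z Y i).mat n l * Z.mat l m := by
      rw [bandMat_mul_apply]
      refine finsum_eq_sum_of_support_subset _ fun l hl => ?_
      rw [mem_coe, mem_Icc]
      constructor
      · by_contra hn
        exact hl (by
          beta_reduce
          rw [PDO.toBand_apply, (hZ.isPositive i).mat_upper (by omega), zero_mul])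
      · by_contra hn
        exact hl (by
          beta_reduce
          rw [PDO.toBand_apply, (hZ.isPositive i).mat_band (by omega), zero_mul])
    have h2 := mul_toBand_Dpow_one_pow_apply Z.toBand i n m
    rw [← h1]
    exact h.trans (congrArg (_ - ·) h2)
  pderiv_col i n m := by
    have h := congrArg (fun a => a.1 m n) (hZ.bandDeriv_inv_eq i)
    have h1 : (Y.toBand * (laxPos Z Y i).toBand).1 m n
        = ∑ l ∈ Icc (n - (i : ℕ)) n, Y.mat m l * (laxPos Z Y i).mat l n := by
      rw [bandMat_mul_apply]
      refine finsum_eq_sum_of_support_subset _ fun l hl => ?_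
      rw [mem_coe, mem_Icc]
      constructor
      · by_contra hn
        exact hl (by
          beta_reduce
          rw [PDO.toBand_apply _ l, (hZ.isPositive i).mat_band (by omega), mul_zero])
      · by_contra hn
        exact hl (by
          beta_reduce
          rw [PDO.toBand_apply _ l, (hZ.isPositive i).mat_upper (by omega), mul_zero])
    have h2 := toBand_Dpow_one_pow_mul_apply Y.toBand i m n
    rw [← h1]
    exact h.trans (congrArg (· - _) h2)

theorem IsDressing.isEig (hZ : IsDressing Z Y) {φ : Fn K} (hφ : IsEigenfunction Z Y φ) :
    IsEig (fun i => (laxPos Z Y i).mat) φ := fun i n =>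
  (hφ i n).trans ((hZ.isPositive i).act_eq φ n)

theorem IsDressing.isAdjEig (hZ : IsDressing Z Y) {ψ : Fn K} (hψ : IsAdjointEigenfunction Z Y ψ) :
    IsAdjEig (fun i => (laxPos Z Y i).mat) ψ := fun i n =>
  (hψ i n).trans ((hZ.isPositive i).neg_conjAdjointAct_eq ψ n)

theorem IsDressing.isSEP_iff (hZ : IsDressing Z Y) {R : Type*} [CommRing R] (ι : K →+* R)
    (φ ψ S : Fn R) : IsSEP Z Y ι φ ψ S ↔ Dl S = φ * Dl ψ ∧ ∀ (i : ℕ+) (n : ℤ),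
      MvPowerSeries.pderiv R i (S n)
        = potFlow i (mapMat ι (fun i => (laxPos Z Y i).mat) i) (Dl ψ) φ n := by
  have h : ∀ (i : ℕ+) (n : ℤ), ((PDO.Dpow (-1)).mul ((PDO.ofFn (Dl ψ)).mul (((laxPos Z Y i).map ι).mul
      ((PDO.ofFn φ).mul (PDO.Dpow (-1)))))).res n
      = potFlow i (mapMat ι (fun i => (laxPos Z Y i).mat) i) (Dl ψ) φ n := by
    intro i n
    rw [((hZ.isPositive i).map ι).res_eq_potFlow]
    congr 1
    funext n m
    exact PDO.mat_map ι _ n m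
  constructor
  · rintro ⟨h1, h2⟩
    exact ⟨h1, fun i n => (h2 i n).trans (h i n)⟩
  · rintro ⟨h1, h2⟩
    exact ⟨h1, fun i n => (h2 i n).trans (h i n).symm⟩

end Dressing

/-! ### The wave function and the adjoint wave function -/

theorem finsum_int_eq_sum_range {B : Type*} [AddCommMonoid B] {f : ℤ → B} {c : ℤ} {J : ℕ}
    (h : ∀ k, f k ≠ 0 → k ≤ c ∧ c - k < J) : ∑ᶠ k, f k = ∑ j ∈ range J, f (c - j) := by
  rw [finsum_eq_sum_of_support_subset f
    (s := (range J).map ((Nat.castEmbedding (R := ℤ)).trans (Equiv.subLeft c).toEmbedding)),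
    Finset.sum_map]
  · rfl
  · intro k hk
    obtain ⟨h1, h2⟩ := h k hk
    rw [mem_coe, mem_map]
    refine ⟨(c - k).toNat, by rw [mem_range]; omega, ?_⟩
    change c - ((c - k).toNat : ℤ) = k
    omega

section Waves

variable {K : Type*} [Field K]

theorem resL_assemble_mul (a : ℕ → MvPowerSeries ℕ+ K) {y : LaurentSeries K} {b : ℤ} {J : ℕ}
    (hy : ∀ j < b, y.coeff j = 0) (hJ : 1 < b + J) :
    resL (assemble a * MvPowerSeries.C y) = ∑ j ∈ range J, y.coeff (1 - (j : ℤ)) • a j := by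
  ext d
  rw [coeff_resL, MvPowerSeries.coeff_mul_C, map_sum]
  refine (coeff_ofPowerSeries_mul _ hy hJ).trans (Finset.sum_congr rfl fun j _ => ?_)
  rw [PowerSeries.coeff_mk, MvPowerSeries.coeff_smul, mul_comm]

variable [CharZero K] {Z Y : PDO K}

/-- Expanding `λ^{-j} (1+λ)^n` in powers of `1+λ` produces the coefficients that convert `Δ^{-j}`
into powers of `Γ`. -/
theorem IsDressing.isWave (hZ : IsDressing Z Y) : IsWave Z.mat (wave Z) := by
  intro n m
  have h1 : rowCoef m (wave Z n) = resL (assemble (fun k : ℕ => Z.coeff (-(k : ℤ)) n)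
      * MvPowerSeries.C (zeta ^ (n - m - 1))) := by
    have hC : (MvPowerSeries.C (zeta ^ (n - m - 1)) : MvPowerSeries ℕ+ (LaurentSeries K))
        = MvPowerSeries.C (zeta ^ n) * MvPowerSeries.C (zeta ^ (-m - 1)) := by
      rw [show n - m - 1 = n + (-m - 1) by ring, zpow_add₀ zeta_ne_zero, map_mul]
    rw [rowCoef_apply, wave, hC]
    congr 1
    change _ * MvPowerSeries.C (zeta ^ n) * _ * _ = _
    linear_combination (assemble (fun k : ℕ => Z.coeff (-(k : ℤ)) n) * MvPowerSeries.C (zeta ^ n)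
      * MvPowerSeries.C (zeta ^ (-m - 1))) * expXi_neg_mul_expXi (F := K)
  rw [h1, resL_assemble_mul _ (zeta_zpow_lead (n - m - 1)).1 (J := (n - m + 1).toNat) (by omega),
    PDO.mat, finsum_int_eq_sum_range (c := 0) (J := (n - m + 1).toNat)]
  · refine Finset.sum_congr rfl fun j _ => ?_
    have h2 := coeff_lam_zpow_mul_zeta_zpow (F := K) (0 - j) (m - n)
    rw [coeff_lam_zpow_mul, show 1 + (0 - (j : ℤ)) = 1 - j by ring,
      show -(m - n) - 1 = n - m - 1 by ring] at h2
    rw [h2, Int.cast_smul_eq_zsmul, zero_sub]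
  · intro k hk
    constructor
    · by_contra h
      exact hk (by rw [hZ.order_le k (by omega), Pi.zero_apply, smul_zero])
    · by_contra h
      exact hk (by rw [shiftCoef_of_lt (by omega), zero_smul])

omit [CharZero K] in
theorem PDO.mat_shiftBack (P : PDO K) (n m : ℤ) : P.shiftBack.mat n m = P.mat (n - 1) (m - 1) := by
  rw [PDO.mat, PDO.mat, show m - 1 - (n - 1) = m - n by ring]
  rfl

omit [CharZero K] in
-- Right multiplication by `Δ⁻¹` forms partial sums of rows. The shift of `Y` to `n - 1` accounts
-- for `m + 1` on the left.
theorem IsDressing.mat_adjoint (hZ : IsDressing Z Y) (n m : ℤ) :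
    (Y.shiftBack.mul (PDO.Dpow (-1))).mat (m + 1) n = ∑ l ∈ Icc n m, Y.mat m l := by
  rw [PDO.mat_mul (N := 0) (M := -1) (fun k hk => by
    funext n
    simp [PDO.shiftBack, hZ.inv_order_le k hk]) (fun k hk => if_neg (by omega))]
  refine Finset.sum_bij' (fun l _ => l - 1) (fun l _ => l + 1) ?_ ?_ ?_ ?_ ?_
  · intro l hl
    rw [mem_Icc] at *
    omega
  · intro l hl
    rw [mem_Icc] at *
    omega
  · intro l _
    ring
  · intro l _
    ring
  · intro l hl
    rw [mem_Icc] at hl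
    rw [PDO.mat_shiftBack, PDO.mat_Dpow, shiftCoef_neg_one (by omega), Int.cast_one, mul_one,
      add_sub_cancel_right]

omit [CharZero K] in
-- The adjoint is the transpose: the coefficient of `Γ^{-r}` in `P^*` at `n` is that of `Γ^r` in `P`
-- at `n - r`, since `(u Γ^r)^* = u(n-r) Γ^{-r}`.
theorem PDO.sum_adjCoeff {P : PDO K} (hP : ∀ k, -1 < k → P.coeff k = 0) (n r : ℤ) :
    ∑ k ∈ Icc r (-1), shiftCoef k r • P.adjCoeff k n
      = ∑ k ∈ Icc r (-1), shiftCoef k r • P.coeff k (n - r) := by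
  obtain ⟨I, hI⟩ : ∃ I : ℕ, -1 - r < I := ⟨(-r).toNat, by omega⟩
  have h1 : ∀ k ∈ Icc r (-1), shiftCoef k r • P.adjCoeff k n = ∑ i ∈ range I,
      (Ring.choose (k + i) i * shiftCoef (k + i - i) r) •
        (DlStar^[i] (P.coeff (k + i))) (n - (k + i) + i) := by
    intro k hk
    rw [mem_Icc] at hk
    have h2 : P.adjCoeff k n = ∑ i ∈ range I,
        Ring.choose (k + i) i • (DlStar^[i] (P.coeff (k + i))) (n - k) := by
      refine finsum_eq_sum_of_support_subset _ fun i hi => ?_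
      rw [mem_coe, mem_range]
      by_contra h
      refine hi ?_
      beta_reduce
      rw [hP _ (by omega), iterate_DlStar_eq_sum]
      simp
    rw [h2, Finset.smul_sum]
    refine Finset.sum_congr rfl fun i _ => ?_
    rw [smul_smul, mul_comm, add_sub_cancel_right, show n - (k + (i : ℤ)) + i = n - k by ring]
  rw [Finset.sum_congr rfl h1, Finset.sum_comm]
  have h3 : ∀ i ∈ range I, ∑ k ∈ Icc r (-1), (Ring.choose (k + i) i * shiftCoef (k + i - i) r) •
        (DlStar^[i] (P.coeff (k + i))) (n - (k + i) + i)
      = ∑ q ∈ Icc r (-1), (Ring.choose q i * shiftCoef (q - i) r) •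
        (DlStar^[i] (P.coeff q)) (n - q + i) := by
    intro i _
    have h4 : ∀ q : ℤ, (Ring.choose q i * shiftCoef (q - i) r) •
        (DlStar^[i] (P.coeff q)) (n - q + i) ≠ 0 → q ≤ -1 ∧ r ≤ q - i := by
      intro q hq
      constructor
      · by_contra h
        refine hq ?_
        rw [hP _ (by omega), iterate_DlStar_eq_sum]
        simp
      · by_contra h
        exact hq (by rw [shiftCoef_of_lt (by omega), mul_zero, zero_smul])
    refine sum_comp_add_eq_sum (f := fun q : ℤ => (Ring.choose q i * shiftCoef (q - i) r) •
        (DlStar^[i] (P.coeff q)) (n - q + i)) (i : ℤ) (fun x hx => ?_) (fun x hx => ?_)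
    · have := h4 _ hx
      rw [mem_Icc]
      omega
    · have := h4 _ hx
      rw [mem_Icc]
      omega
  rw [Finset.sum_congr rfl h3, Finset.sum_comm]
  refine Finset.sum_congr rfl fun q hq => ?_
  rw [mem_Icc] at hq
  exact leibniz_adjoint_shiftCoef _ q n r (by omega)

/-- Expanding in powers of `1+λ` reads off the entry `(m+1, n)` of `Y(n-1) Δ⁻¹`, which is the
partial sum over `n ≤ l ≤ m` of row `m` of `Y`. -/
theorem IsDressing.isEigTransform_adjWave (hZ : IsDressing Z Y) :
    IsEigTransform Y.mat 1 (adjWave Y) := by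
  intro n m
  set P := Y.shiftBack.mul (PDO.Dpow (-1)) with hP
  have hP0 : ∀ k, -1 < k → P.coeff k = 0 := fun k hk =>
    PDO.mul_order_le (N := 0) (M := -1) (fun k hk => by
      funext n
      simp [PDO.shiftBack, hZ.inv_order_le k hk]) (fun k hk => if_neg (by omega)) k (by omega)
  have hA0 : ∀ k, -1 < k → P.adjCoeff k n = 0 := by
    intro k hk
    refine (finsum_congr fun i => ?_).trans finsum_zero
    rw [hP0 _ (by omega), iterate_DlStar_eq_sum]
    simp
  have h1 : colCoef m (adjWave Y n) = resL (assemble (fun k : ℕ => P.adjCoeff (-1 - (k : ℤ)) n)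
      * MvPowerSeries.C (lam⁻¹ * zeta ^ (m - n))) := by
    have hC : (MvPowerSeries.C (lam⁻¹ * zeta ^ (m - n)) : MvPowerSeries ℕ+ (LaurentSeries K))
        = MvPowerSeries.C (lam⁻¹ * zeta ^ (-n)) * MvPowerSeries.C (zeta ^ m) := by
      rw [show m - n = -n + m by ring, zpow_add₀ zeta_ne_zero, ← map_mul, mul_assoc]
    rw [colCoef_apply, adjWave, hC]
    congr 1
    change _ * MvPowerSeries.C (lam⁻¹ * zeta ^ (-n)) * _ * _ = _
    linear_combination (assemble (fun k : ℕ => P.adjCoeff (-1 - (k : ℤ)) n)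
      * MvPowerSeries.C (lam⁻¹ * zeta ^ (-n))
      * MvPowerSeries.C (zeta ^ m)) * expXi_neg_mul_expXi (F := K)
  have hy : ∀ j < n - m + 1, ((lam : LaurentSeries K)⁻¹ * zeta ^ (m - n)).coeff j = 0 := by
    intro j hj
    rw [← zpow_neg_one, coeff_lam_zpow_mul]
    exact (zeta_zpow_lead (m - n)).1 _ (by omega)
  rw [h1, resL_assemble_mul _ hy (J := (m - n + 1).toNat) (by omega)]
  simp only [Pi.one_apply, mul_one]
  rw [← hZ.mat_adjoint, ← hP, PDO.mat_eq_sum hP0 (m + 1) n subset_rfl]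
  have h2 := PDO.sum_adjCoeff hP0 n (n - (m + 1))
  rw [sub_sub_cancel] at h2
  rw [← h2, ← finsum_eq_sum_of_support_subset
    (fun k => shiftCoef k (n - (m + 1)) • P.adjCoeff k n) (s := Icc (n - (m + 1)) (-1)) (fun k hk => by
      rw [mem_coe, mem_Icc]
      constructor
      · by_contra h
        exact hk (by
          beta_reduce
          rw [shiftCoef_of_lt (by omega), zero_smul])
      · by_contra h
        exact hk (by
          beta_reduce
          rw [hA0 k (by omega), smul_zero])),
    finsum_int_eq_sum_range (c := -1) (J := (m - n + 1).toNat)]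
  · refine Finset.sum_congr rfl fun j _ => ?_
    have h3 := coeff_lam_zpow_mul_zeta_zpow (F := K) (-1 - j) (n - (m + 1))
    rw [show -1 - (j : ℤ) = -j + -1 by ring, zpow_add₀ lam_ne_zero, mul_assoc, coeff_lam_zpow_mul,
      zpow_neg_one, show -(n - (m + 1)) - 1 = m - n by ring, ← sub_eq_add_neg] at h3
    rw [h3, Int.cast_smul_eq_zsmul, show -(j : ℤ) + -1 = -1 - j by ring]
  · intro k hk
    constructor
    · by_contra h
      exact hk (by rw [hA0 k (by omega), smul_zero])
    · by_contra h
      exact hk (by rw [shiftCoef_of_lt (by omega), zero_smul])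

end Waves

/-! ### Coefficientwise maps of iterated Laurent series -/

section Inner

variable {K : Type*} [Field K]

/-- The coefficientwise inclusion of Laurent series into iterated Laurent series. -/
def innerHom (K : Type*) [Field K] : LaurentSeries K →+* LaurentSeries (LaurentSeries K) where
  toFun x := x.map (HahnSeries.C : K →+* LaurentSeries K)
  map_zero' := by ext; simp
  map_one' := HahnSeries.map_one (HahnSeries.C : K →+* LaurentSeries K).toMonoidWithZeroHom
  map_add' x y := HahnSeries.map_add ((HahnSeries.C : K →+* LaurentSeries K) : K →+ LaurentSeries K)
  map_mul' x y := HahnSeries.map_mul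
    ((HahnSeries.C : K →+* LaurentSeries K) : K →ₙ+* LaurentSeries K)

theorem coeff_innerHom (x : LaurentSeries K) (k : ℤ) :
    (innerHom K x).coeff k = HahnSeries.C (x.coeff k) := rfl

theorem liftInner_eq_map (X : MvPowerSeries ℕ+ (LaurentSeries K)) :
    liftInner X = MvPowerSeries.map (innerHom K) X := rfl

theorem innerHom_lam : innerHom K lam = lam := by
  ext1
  funext k
  rw [coeff_innerHom, lam, lam, HahnSeries.coeff_single, HahnSeries.coeff_single]
  split_ifs with h
  · exact map_one _
  · exact map_zero _

theorem innerHom_zeta_zpow (k : ℤ) : innerHom K (zeta ^ k) = zeta ^ k := by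
  rw [map_zpow₀, zeta, map_add, map_one, innerHom_lam]
  rfl

/-- A functional applied to the coefficients of an iterated Laurent series. -/
def innerMap (ℓ : LaurentSeries K →ₗ[K] K) :
    LaurentSeries (LaurentSeries K) →ₗ[K] LaurentSeries K where
  toFun x := x.map ℓ
  map_add' x y := HahnSeries.map_add ℓ.toAddMonoidHom
  map_smul' r x := by
    ext k
    exact map_smul ℓ r (x.coeff k)

theorem coeff_innerMap (ℓ : LaurentSeries K →ₗ[K] K) (x : LaurentSeries (LaurentSeries K)) (k : ℤ) :
    (innerMap ℓ x).coeff k = ℓ (x.coeff k) := rfl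

theorem innerMap_mul_innerHom (ℓ : LaurentSeries K →ₗ[K] K) (x : LaurentSeries (LaurentSeries K))
    (y : LaurentSeries K) : innerMap ℓ (x * innerHom K y) = innerMap ℓ x * y := by
  have h1 : (innerMap ℓ x).support ⊆ x.support :=
    Function.support_comp_subset (map_zero ℓ) _
  have h2 : (innerHom K y).support ⊆ y.support :=
    Function.support_comp_subset (map_zero (HahnSeries.C : K →+* LaurentSeries K)) _
  ext k
  rw [coeff_innerMap, HahnSeries.coeff_mul_left' x.isPWO_support h1,
    HahnSeries.coeff_mul_right' y.isPWO_support h2, map_sum]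
  refine Finset.sum_congr rfl fun p _ => ?_
  rw [coeff_innerHom, mul_comm, HahnSeries.C_mul_eq_smul, map_smul, smul_eq_mul, mul_comm]
  rfl

variable [Algebra ℚ K]

theorem map_innerHom_expXi [Algebra ℚ (LaurentSeries K)] (ε : ℚ) :
    MvPowerSeries.map (innerHom K) (expXi ε) = expXi ε := by
  ext1 d
  rw [MvPowerSeries.coeff_map, coeff_expXi, coeff_expXi, map_finsuppProd]
  refine Finset.prod_congr rfl fun l _ => ?_
  beta_reduce
  have h : ((lam : LaurentSeries (LaurentSeries K)) ^ (l : ℕ)) ^ d l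
      = innerHom K ((lam ^ (l : ℕ)) ^ d l) := by
    rw [map_pow, map_pow, innerHom_lam]
  rw [h]
  ext1
  funext k
  -- The rational scalars on the two coefficient rings come from independent algebra structures; any
  -- additive map respects both.
  exact map_rat_smul (_instM := Algebra.toModule) (_instM₂ := Algebra.toModule)
    (HahnSeries.C : K →+* LaurentSeries K) _ _

theorem rowCoef_liftInner [Algebra ℚ (LaurentSeries K)] (m : ℤ)
    (X : MvPowerSeries ℕ+ (LaurentSeries K)) :
    rowCoef m (liftInner X) = MvPowerSeries.map HahnSeries.C (rowCoef m X) := by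
  have h : liftInner X * (expXi (-1) * MvPowerSeries.C (zeta ^ (-m - 1)))
      = MvPowerSeries.map (innerHom K) (X * (expXi (-1) * MvPowerSeries.C (zeta ^ (-m - 1)))) := by
    rw [map_mul, map_mul, map_innerHom_expXi, MvPowerSeries.map_C, innerHom_zeta_zpow,
      liftInner_eq_map]
  rw [rowCoef_apply, h]
  rfl

theorem colCoef_liftInner [Algebra ℚ (LaurentSeries K)] (m : ℤ)
    (X : MvPowerSeries ℕ+ (LaurentSeries K)) :
    colCoef m (liftInner X) = MvPowerSeries.map HahnSeries.C (colCoef m X) := by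
  have h : liftInner X * (expXi 1 * MvPowerSeries.C (zeta ^ m))
      = MvPowerSeries.map (innerHom K) (X * (expXi 1 * MvPowerSeries.C (zeta ^ m))) := by
    rw [map_mul, map_mul, map_innerHom_expXi, MvPowerSeries.map_C, innerHom_zeta_zpow,
      liftInner_eq_map]
  rw [colCoef_apply, h]
  rfl

theorem IsWave.liftInner [Algebra ℚ (LaurentSeries K)] {Z : ℤ → ℤ → MvPowerSeries ℕ+ K}
    {w : Fn (LaurentSeries K)} (hw : IsWave Z w) :
    IsWave (fun n m => MvPowerSeries.map HahnSeries.C (Z n m)) (fun n => liftInner (w n)) := by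
  intro n m
  rw [rowCoef_liftInner, hw]

theorem IsEigTransform.liftInner [Algebra ℚ (LaurentSeries K)] {Y : ℤ → ℤ → MvPowerSeries ℕ+ K}
    {wst : Fn (LaurentSeries K)} (hwst : IsEigTransform Y 1 wst) :
    IsEigTransform (fun n m => MvPowerSeries.map HahnSeries.C (Y n m)) 1
      (fun n => liftInner (wst n)) := by
  intro n m
  rw [colCoef_liftInner, hwst, map_sum]
  simp

/-- The coefficients of a shifted series are rational combinations of the original ones, so a
functional in the inner parameter commutes with the shift by the outer one. -/
theorem innerMap_coeff_shift [Algebra ℚ (LaurentSeries K)] (ℓ : LaurentSeries K →ₗ[K] K) (ε : ℚ)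
    (X : MvPowerSeries ℕ+ (LaurentSeries K)) (d : ℕ+ →₀ ℕ) :
    innerMap ℓ (MvPowerSeries.coeff d (shift ε X))
      = MvPowerSeries.coeff d (shift ε (mapLin ℓ X)) := by
  rw [coeff_shift, coeff_shift]
  ext k
  rw [coeff_innerMap]
  rcases lt_or_ge k 0 with h | h
  · rw [coeff_ofPowerSeries_of_neg _ h, coeff_ofPowerSeries_of_neg _ h, map_zero]
  · obtain ⟨j, rfl⟩ := Int.eq_ofNat_of_zero_le h
    rw [coeff_ofPowerSeries_natCast, coeff_ofPowerSeries_natCast, PowerSeries.coeff_mk,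
      PowerSeries.coeff_mk, coeff_schur, coeff_schur, map_sum]
    refine Finset.sum_congr rfl fun e _ => ?_
    exact map_rat_smul (_instM := Algebra.toModule) (_instM₂ := Algebra.toModule) ℓ _ _

theorem shift_zero (ε : ℚ) : shift ε (0 : MvPowerSeries ℕ+ K) = 0 := by
  ext1 d
  rw [coeff_shift]
  simp only [map_zero]
  exact map_zero (HahnSeries.ofPowerSeries ℤ K)

end Inner

/-! ### Existence of the transforms, and the closed forms as potentials -/

section ClosedForms

variable {F : Type*} [Field F] [Algebra ℚ F] {Z Y : ℤ → ℤ → MvPowerSeries ℕ+ F}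
  {A : ℕ+ → ℤ → ℤ → MvPowerSeries ℕ+ F}

theorem exists_isEigTransform (Y : ℤ → ℤ → MvPowerSeries ℕ+ F) (φ : Fn F) :
    ∃ σ, IsEigTransform Y φ σ := by
  choose σ hσ using fun n : ℤ => exists_colCoef (fun m => ∑ l ∈ Icc n m, Y m l * φ l) n
    (fun m hm => by rw [Finset.Icc_eq_empty (by omega), Finset.sum_empty])
  exact ⟨σ, hσ⟩

theorem exists_isAdjTransform (Z : ℤ → ℤ → MvPowerSeries ℕ+ F) (ψ : Fn F) :
    ∃ s, IsAdjTransform Z ψ s := by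
  choose s hs using fun n : ℤ => exists_rowCoef (fun m => ∑ l ∈ Ico m n, Dl ψ l * Z l m) n
    (fun m hm => by rw [Finset.Ico_eq_empty (by omega), Finset.sum_empty])
  exact ⟨s, hs⟩

theorem MatrixDressing.shift_mul_adjWave (h : MatrixDressing Z Y A) {w wst : Fn (LaurentSeries F)}
    (hw : IsWave Z w) (hwst : IsEigTransform Y 1 wst) {φ : Fn F} (hφ : IsEig A φ) :
    Dl (fun n => shift 1 (φ n) * wst n) = Fn.map HahnSeries.C φ * Dl wst ∧
      ∀ (i : ℕ+) (n : ℤ), MvPowerSeries.pderiv _ i (shift 1 (φ n) * wst n)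
        = potFlow i (mapMat HahnSeries.C A i) (Dl wst) (Fn.map HahnSeries.C φ) n := by
  obtain ⟨σ, hσ⟩ := exists_isEigTransform Y φ
  have e : σ = fun n => shift 1 (φ n) * wst n := funext (hσ.eq_shift_mul hwst hw h hφ)
  refine ⟨?_, fun i n => ?_⟩
  · rw [← e, hσ.Dl_eq hwst h]
  · rw [← hσ.pderiv_eq hwst h hφ, e]

theorem MatrixDressing.wave_mul_sub_shift (h : MatrixDressing Z Y A) {w wst : Fn (LaurentSeries F)}
    (hw : IsWave Z w) (hwst : IsEigTransform Y 1 wst) {ψ : Fn F} (hψ : IsAdjEig A ψ) :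
    Dl (fun n => w n * (liftOuter (ψ n) - shift (-1) (ψ n))) = w * Dl (Fn.map HahnSeries.C ψ) ∧
      ∀ (i : ℕ+) (n : ℤ),
        MvPowerSeries.pderiv _ i (w n * (liftOuter (ψ n) - shift (-1) (ψ n)))
          = potFlow i (mapMat HahnSeries.C A i) (Dl (Fn.map HahnSeries.C ψ)) w n := by
  obtain ⟨s, hs⟩ := exists_isAdjTransform Z ψ
  have e : s = fun n => w n * (liftOuter (ψ n) - shift (-1) (ψ n)) := by
    funext n
    rw [mul_sub, ← hs.eq_mul_shift hwst hw h hψ, hatTransform, liftOuter]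
    ring
  refine ⟨?_, fun i n => ?_⟩
  · rw [← e, hs.Dl_eq hw h]
  · rw [← hs.pderiv_eq hw h hψ, e]

end ClosedForms

/-! ### Double residues -/

section Residues

variable {K : Type*} [Field K] [CharZero K] {Z Y : PDO K}

theorem IsDressing.exists_isSEP (hZ : IsDressing Z Y) {φ ψ : Fn K} (hφ : IsEigenfunction Z Y φ)
    (hψ : IsAdjointEigenfunction Z Y ψ) : ∃ S : Fn K, IsSEP Z Y (RingHom.id K) φ ψ S := by
  obtain ⟨σ, hσ⟩ := exists_isEigTransform Y.mat φ
  obtain ⟨s, hs⟩ := exists_isAdjTransform Z.mat ψ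
  obtain ⟨S, hS⟩ := hZ.matrixDressing.exists_potential hσ hs hZ.isWave hZ.isEigTransform_adjWave
    (hZ.isEig hφ) (hZ.isAdjEig hψ)
  exact ⟨S, (hZ.isSEP_iff _ _ _ _).mpr hS⟩

omit [CharZero K] in
theorem coeff_atT_add_atT' (S T : MvPowerSeries ℕ+ K) (d d' : ℕ+ →₀ ℕ) :
    MvPowerSeries.coeff d' (MvPowerSeries.coeff d (atT S + atT' T))
      = (if d' = 0 then MvPowerSeries.coeff d S else 0)
        + (if d = 0 then MvPowerSeries.coeff d' T else 0) := by
  classical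
  rw [map_add, map_add, atT, atT', MvPowerSeries.coeff_map, coeff_C_eq_ite, MvPowerSeries.coeff_C,
    apply_ite (MvPowerSeries.coeff d'), map_zero]

omit [CharZero K] in
theorem coeff_resOuter_atT'_mul (E : MvPowerSeries ℕ+ (LaurentSeries K))
    (G : TwoTime (LaurentSeries K)) (d d' : ℕ+ →₀ ℕ) :
    MvPowerSeries.coeff d' (MvPowerSeries.coeff d (resOuter (atT' E * G)))
      = ∑ p ∈ antidiagonal d', resMul (MvPowerSeries.coeff p.1 E)
        (MvPowerSeries.coeff p.2 (MvPowerSeries.coeff d G)) := by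
  classical
  change (MvPowerSeries.coeff d' (MvPowerSeries.coeff d (atT' E * G))).coeff 1 = _
  rw [atT', MvPowerSeries.coeff_C_mul, MvPowerSeries.coeff_mul, HahnSeries.coeff_sum]
  rfl

theorem coeff_atT_mul_atT' {R : Type*} [CommRing R] (B H : MvPowerSeries ℕ+ R) (d d' : ℕ+ →₀ ℕ) :
    MvPowerSeries.coeff d' (MvPowerSeries.coeff d (atT B * atT' H))
      = MvPowerSeries.coeff d B * MvPowerSeries.coeff d' H := by
  rw [atT, atT', MvPowerSeries.coeff_mul_C, MvPowerSeries.coeff_map, MvPowerSeries.coeff_C_mul]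

/-- The residue of `σ(n, t) h(n, t')`, for the closed forms of the potentials. -/
theorem IsDressing.res_eigenPot_mul_adjPot (hZ : IsDressing Z Y) {φ ψ S : Fn K}
    (hφ : IsEigenfunction Z Y φ) (hψ : IsAdjointEigenfunction Z Y ψ)
    (hS : IsSEP Z Y (RingHom.id K) φ ψ S) (n : ℤ) (d d' : ℕ+ →₀ ℕ) :
    (MvPowerSeries.coeff d (eigenPot Y φ n) * MvPowerSeries.coeff d' (adjPot Z ψ n)).coeff 1
      = (if d' = 0 then MvPowerSeries.coeff d (S n) else 0)
        + (if d = 0 then MvPowerSeries.coeff d' (φ n * ψ n - S n) else 0) := by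
  obtain ⟨σ, hσ⟩ := exists_isEigTransform Y.mat φ
  obtain ⟨s, hs⟩ := exists_isAdjTransform Z.mat ψ
  rw [eigenPot, adjPot, ← hσ.eq_shift_mul hZ.isEigTransform_adjWave hZ.isWave hZ.matrixDressing
    (hZ.isEig hφ), ← hs.eq_mul_shift hZ.isEigTransform_adjWave hZ.isWave hZ.matrixDressing
    (hZ.isAdjEig hψ)]
  exact hσ.res_mul_hat hs hZ.isWave hZ.isEigTransform_adjWave hZ.matrixDressing (hZ.isEig hφ)
    (hZ.isAdjEig hψ) (fun i => ((hZ.isSEP_iff _ _ _ _).mp hS).2 i n) d d'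

/-- The residues may be exchanged. The one in `μ` turns `w(t+[λ⁻¹], μ)` into `φ(t+[λ⁻¹])`, hence the
kernel into `S(φ, Δw^*(λ))`. -/
theorem IsDressing.coeff_doubleRes (hZ : IsDressing Z Y) {φ ψ : Fn K}
    (hφ : IsEigenfunction Z Y φ) (n : ℤ) (d d' : ℕ+ →₀ ℕ) :
    MvPowerSeries.coeff d' (MvPowerSeries.coeff d (doubleRes Z Y φ ψ n))
      = (MvPowerSeries.coeff d (eigenPot Y φ n)
        * MvPowerSeries.coeff d' (adjPot Z ψ n)).coeff 1 := by
  classical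
  obtain ⟨σ, hσ⟩ := exists_isEigTransform Y.mat φ
  have key : ∀ p ∈ antidiagonal d', resMul (MvPowerSeries.coeff p.1 (eigenPot Y φ n))
      (MvPowerSeries.coeff p.2 (MvPowerSeries.coeff d
        (resOuter (atT (basicPot Z Y n) * atT' (liftInner (R := K) (adjPot Z ψ n))))))
      = if p.1 = 0 then (MvPowerSeries.coeff d (eigenPot Y φ n)
        * MvPowerSeries.coeff p.2 (adjPot Z ψ n)).coeff 1 else 0 := by
    intro p _
    set ℓ := resMul (MvPowerSeries.coeff p.1 (eigenPot Y φ n)) with hℓ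
    have h1 : mapLin ℓ (wave Z n) = if p.1 = 0 then φ n else 0 := by
      rw [hℓ, eigenPot, ← hσ.eq_shift_mul hZ.isEigTransform_adjWave hZ.isWave hZ.matrixDressing
        (hZ.isEig hφ)]
      exact hσ.res_mul_wave hZ.isWave hZ.isEigTransform_adjWave hZ.matrixDressing
        (hZ.isEig hφ) le_rfl p.1
    have h2 : innerMap ℓ (MvPowerSeries.coeff d (basicPot Z Y n))
        = if p.1 = 0 then MvPowerSeries.coeff d (eigenPot Y φ n) else 0 := by
      rw [basicPot, liftInner_eq_map, MvPowerSeries.coeff_mul, map_sum]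
      simp only [MvPowerSeries.coeff_map, innerMap_mul_innerHom, innerMap_coeff_shift, h1]
      split_ifs with hp
      · rw [eigenPot, MvPowerSeries.coeff_mul]
      · simp [shift_zero]
    have h3 : ℓ ((MvPowerSeries.coeff d (basicPot Z Y n)
        * innerHom K (MvPowerSeries.coeff p.2 (adjPot Z ψ n))).coeff 1)
        = (innerMap ℓ (MvPowerSeries.coeff d (basicPot Z Y n))
          * MvPowerSeries.coeff p.2 (adjPot Z ψ n)).coeff 1 := by
      rw [← innerMap_mul_innerHom, coeff_innerMap]
    change ℓ ((MvPowerSeries.coeff p.2 (MvPowerSeries.coeff d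
      (atT (basicPot Z Y n) * atT' (liftInner (R := K) (adjPot Z ψ n))))).coeff 1) = _
    rw [coeff_atT_mul_atT', liftInner_eq_map, MvPowerSeries.coeff_map, h3, h2]
    split_ifs with hp
    · rfl
    · rw [zero_mul, HahnSeries.coeff_zero]
  -- The residue in `μ` no longer depends on `t'`, so in the convolution over exponents of `t'` only
  -- the term taking the exponent `0` from `ρ` survives.
  rw [doubleRes, coeff_resOuter_atT'_mul, Finset.sum_congr rfl key,
    Finset.sum_eq_single (0, d')]
  · rw [if_pos rfl]
  · intro p hp hp0
    rw [if_neg]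
    intro h
    rw [HasAntidiagonal.mem_antidiagonal, h, zero_add] at hp
    exact hp0 (Prod.ext h hp)
  · intro h
    exact absurd (HasAntidiagonal.mem_antidiagonal.mpr (zero_add d')) h

omit [CharZero K] in
theorem innerMap_resMul (x : LaurentSeries (LaurentSeries K)) (y : LaurentSeries K) :
    innerMap (resMul y) x = (x * HahnSeries.C y).map
      (HahnSeries.coeff.addMonoidHom (1 : ℤ) : LaurentSeries K →+ K) := by
  ext k
  rw [coeff_innerMap, mul_comm x, HahnSeries.C_mul_eq_smul]
  rfl

omit [CharZero K] in
theorem innerMap_innerHom_mul (ℓ : LaurentSeries K →ₗ[K] K) (x : LaurentSeries (LaurentSeries K))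
    (y : LaurentSeries K) : innerMap ℓ (innerHom K y * x) = y * innerMap ℓ x := by
  rw [mul_comm, innerMap_mul_innerHom, mul_comm]

/-- The residue in `λ` turns `w^*(t-[μ⁻¹], λ)` into `ψ(t-[μ⁻¹])`, hence the kernel into `Ŝ(Δw(μ),
ψ(n+1))` at time `t`, now paired with `ρ` at time `t'`. -/
theorem IsDressing.coeff_doubleHatRes (hZ : IsDressing Z Y) {φ ψ : Fn K}
    (hψ : IsAdjointEigenfunction Z Y ψ) (n : ℤ) (d d' : ℕ+ →₀ ℕ) :
    MvPowerSeries.coeff d' (MvPowerSeries.coeff d (doubleHatRes Z Y φ ψ n))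
      = (MvPowerSeries.coeff d' (eigenPot Y φ n)
        * MvPowerSeries.coeff d (adjPot Z ψ n)).coeff 1 := by
  classical
  obtain ⟨s, hs⟩ := exists_isAdjTransform Z.mat ψ
  have key : ∀ p ∈ antidiagonal d', resMul (MvPowerSeries.coeff p.1 (eigenPot Y φ n))
      (MvPowerSeries.coeff p.2 (MvPowerSeries.coeff d
        (resInner (atT (basicHatPot Z Y n) * atT' (liftOuter (adjPot Z ψ n))))))
      = if p.2 = 0 then (MvPowerSeries.coeff p.1 (eigenPot Y φ n)
        * MvPowerSeries.coeff d (adjPot Z ψ n)).coeff 1 else 0 := by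
    intro p _
    set ℓ := resMul (MvPowerSeries.coeff p.2 (adjPot Z ψ n)) with hℓ
    have h1 : mapLin ℓ (adjWave Y n) = if p.2 = 0 then ψ n else 0 := by
      rw [hℓ, adjPot, ← hs.eq_mul_shift hZ.isEigTransform_adjWave hZ.isWave hZ.matrixDressing
        (hZ.isAdjEig hψ)]
      exact hs.res_mul_adjWave hZ.isWave hZ.isEigTransform_adjWave hZ.matrixDressing
        (hZ.isAdjEig hψ) le_rfl p.2
    have h2 : innerMap ℓ (MvPowerSeries.coeff d (basicHatPot Z Y n))
        = if p.2 = 0 then MvPowerSeries.coeff d (adjPot Z ψ n) else 0 := by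
      rw [basicHatPot, liftInner_eq_map, MvPowerSeries.coeff_mul, map_sum]
      simp only [MvPowerSeries.coeff_map, innerMap_innerHom_mul, innerMap_coeff_shift, h1]
      split_ifs with hp
      · rw [adjPot, MvPowerSeries.coeff_mul]
      · simp [shift_zero]
    have h3 : MvPowerSeries.coeff p.2 (MvPowerSeries.coeff d
        (resInner (atT (basicHatPot Z Y n) * atT' (liftOuter (adjPot Z ψ n)))))
        = innerMap ℓ (MvPowerSeries.coeff d (basicHatPot Z Y n)) := by
      change (MvPowerSeries.coeff p.2 (MvPowerSeries.coeff d
        (atT (basicHatPot Z Y n) * atT' (liftOuter (adjPot Z ψ n))))).map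
        (HahnSeries.coeff.addMonoidHom (1 : ℤ) : LaurentSeries K →+ K) = _
      rw [coeff_atT_mul_atT', liftOuter, MvPowerSeries.coeff_map, hℓ, innerMap_resMul]
    rw [h3, h2]
    split_ifs with hp
    · rfl
    · rw [map_zero]
  rw [doubleHatRes, coeff_resOuter_atT'_mul, Finset.sum_congr rfl key,
    Finset.sum_eq_single (d', 0)]
  · rw [if_pos rfl]
  · intro p hp hp0
    rw [if_neg]
    intro h
    rw [HasAntidiagonal.mem_antidiagonal, h, add_zero] at hp
    exact hp0 (Prod.ext hp h)
  · intro h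
    exact absurd (HasAntidiagonal.mem_antidiagonal.mpr (add_zero d')) h

end Residues

end DmKP

end

/-! ### The corollary -/

theorem corollary3p1 {K : Type*} [Field K] [CharZero K] (Z Y : DmKP.PDO K)
    (hZ : DmKP.IsDressing Z Y) (φ ψ : DmKP.Fn K)
    (hφ : DmKP.IsEigenfunction Z Y φ) (hψ : DmKP.IsAdjointEigenfunction Z Y ψ) :
    -- `S(φ, Δ w^*(λ)) = φ(n, t + [λ⁻¹]) w^*(n, t, λ)`
    DmKP.IsSEP Z Y DmKP.incl₁ (DmKP.Fn.map DmKP.incl₁ φ) (DmKP.adjWave Y)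
      (fun n => DmKP.shift 1 (φ n) * DmKP.adjWave Y n) ∧
    -- `Ŝ(Δ w(μ), ψ(n+1)) = w(n, t, μ) ψ(n, t - [μ⁻¹])`
    DmKP.IsHatSEP Z Y DmKP.incl₁ (DmKP.wave Z) (DmKP.Fn.map DmKP.incl₁ ψ)
      (fun n => DmKP.wave Z n * DmKP.shift (-1) (ψ n)) ∧
    -- `S(w(μ), Δψ) = w(n, t, μ) (ψ(n, t) - ψ(n, t - [μ⁻¹]))`
    DmKP.IsSEP Z Y DmKP.incl₁ (DmKP.wave Z) (DmKP.Fn.map DmKP.incl₁ ψ)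
      (fun n => DmKP.wave Z n * (DmKP.liftOuter (ψ n) - DmKP.shift (-1) (ψ n))) ∧
    -- `Ŝ(Δφ, w^*(n+1, λ)) = w^*(n, t, λ) (φ(n, t) - φ(n, t + [λ⁻¹]))`
    DmKP.IsHatSEP Z Y DmKP.incl₁ (DmKP.Fn.map DmKP.incl₁ φ) (DmKP.adjWave Y)
      (fun n => DmKP.adjWave Y n * (DmKP.liftOuter (φ n) - DmKP.shift 1 (φ n))) ∧
    -- the kernels of the double residues are the basic potentials
    -- `S(w(μ), Δ w^*(λ))` and `Ŝ(Δ w(μ), w^*(n+1, λ))`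
    DmKP.IsSEP Z Y DmKP.incl₂ (fun n => DmKP.liftOuter (DmKP.wave Z n))
      (fun n => DmKP.liftInner (DmKP.adjWave Y n)) (DmKP.basicPot Z Y) ∧
    DmKP.IsHatSEP Z Y DmKP.incl₂ (fun n => DmKP.liftInner (DmKP.wave Z n))
      (fun n => DmKP.liftOuter (DmKP.adjWave Y n)) (DmKP.basicHatPot Z Y) ∧
    -- potentials of the pair `(φ, ψ)` exist, and they are double residues up to a term that does
    -- not depend on `t`, namely `Ŝ(n, t')`, respectively `S(n, t')`
    (∃ S : DmKP.Fn K, DmKP.IsSEP Z Y (RingHom.id K) φ ψ S) ∧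
    (∀ S : DmKP.Fn K, DmKP.IsSEP Z Y (RingHom.id K) φ ψ S → ∀ n : ℤ,
      DmKP.doubleRes Z Y φ ψ n = DmKP.atT (S n) + DmKP.atT' (φ n * ψ n - S n)) ∧
    (∀ T : DmKP.Fn K, DmKP.IsHatSEP Z Y (RingHom.id K) φ ψ T → ∀ n : ℤ,
      DmKP.doubleHatRes Z Y φ ψ n = DmKP.atT (T n) + DmKP.atT' (φ n * ψ n - T n)) := by
  have h := hZ.matrixDressing
  have hw := hZ.isWave
  have hwst := hZ.isEigTransform_adjWave
  have eφ := hZ.isEig hφ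
  have eψ := hZ.isAdjEig hψ
  have hw' := hw.liftInner
  have hwst' := hwst.liftInner
  have h' := h.map (HahnSeries.C : K →+* LaurentSeries K)
  have c1 := (hZ.isSEP_iff DmKP.incl₁ (DmKP.Fn.map DmKP.incl₁ φ) (DmKP.adjWave Y)
    (fun n => DmKP.shift 1 (φ n) * DmKP.adjWave Y n)).mpr (h.shift_mul_adjWave hw hwst eφ)
  have c3 := (hZ.isSEP_iff DmKP.incl₁ (DmKP.wave Z) (DmKP.Fn.map DmKP.incl₁ ψ)
    (fun n => DmKP.wave Z n * (DmKP.liftOuter (ψ n) - DmKP.shift (-1) (ψ n)))).mpr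
    (h.wave_mul_sub_shift hw hwst eψ)
  -- The first and third closed forms are reused over the field of Laurent series in the inner
  -- parameter, with `w(μ)` as the eigenfunction here and `w^*(λ)` as the adjoint eigenfunction in
  -- `c6`.
  have c5 := (hZ.isSEP_iff DmKP.incl₂ (fun n => DmKP.liftOuter (DmKP.wave Z n))
    (fun n => DmKP.liftInner (DmKP.adjWave Y n)) (DmKP.basicPot Z Y)).mpr
    (h'.shift_mul_adjWave hw' hwst' (hw.isEig h))
  have c6 := (hZ.isSEP_iff DmKP.incl₂ (fun n => DmKP.liftInner (DmKP.wave Z n))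
    (fun n => DmKP.liftOuter (DmKP.adjWave Y n)) (fun n => DmKP.liftInner (DmKP.wave Z n)
      * (DmKP.liftOuter (DmKP.adjWave Y n) - DmKP.shift (-1) (DmKP.adjWave Y n)))).mpr
    (h'.wave_mul_sub_shift hw' hwst' (hwst.isAdjEig h))
  refine ⟨c1, ⟨_, c3, ?_⟩, c3, ⟨_, c1, ?_⟩, c5, ⟨_, c6, ?_⟩, hZ.exists_isSEP hφ hψ, ?_, ?_⟩
  · funext n
    simp only [Pi.sub_apply, Pi.mul_apply, DmKP.Fn.map, DmKP.liftOuter]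
    ring
  · funext n
    simp only [Pi.sub_apply, Pi.mul_apply, DmKP.Fn.map, DmKP.liftOuter]
    ring
  · funext n
    simp only [Pi.sub_apply, Pi.mul_apply, DmKP.basicHatPot]
    ring
  · intro S hS n
    ext d d'
    rw [hZ.coeff_doubleRes hφ, hZ.res_eigenPot_mul_adjPot hφ hψ hS, DmKP.coeff_atT_add_atT']
  -- The same pairing formula applies with the roles of `t` and `t'` interchanged, which exchanges
  -- `S` and `φ ψ - S`.
  · rintro T ⟨S, hS, rfl⟩ n
    ext d d'
    rw [hZ.coeff_doubleHatRes hψ, hZ.res_eigenPot_mul_adjPot hφ hψ hS, DmKP.coeff_atT_add_atT',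
      Pi.sub_apply, Pi.mul_apply, sub_sub_cancel, add_comm]
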